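/- Let $V$ be an $n$-dimensional real vector space and let $\mathrm{CL}(V\oplus V^*)$ be the Clifford algebra with relation $E\cdot E=\eta(v)$ for $E=v+\eta\in V\oplus V^*$. It acts on $S=\bigoplus_p\wedge^pV^*$ by $E\cdot\phi=i_v\phi+\eta\wedge\phi$, and diagonally on $\oplus^lS$. Let $\mathrm{CL}^k$ be the span of the products of $j$ elements of $V\oplus V^*$ with $0\le j\le k$ and $j\equiv k \pmod 2$, and let $\mathrm{Cpin}(V\oplus V^*)$ be the group of invertible $g$ with $\tilde g^{-1}(V\oplus V^*)g\subset V\oplus V^*$, where $g\mapsto\tilde g$ is the grading involution. Fix $\Phi_V\in\oplus^lS$ and let $\mathcal B(V)=\mathrm{Cpin}(V\oplus V^*)\cdot\Phi_V$. Let $X$ be a compact smooth $n$-manifold without boundary. For $x\in X$ let $\mathcal B(T_xX)\subset\oplus^l\wedge^*T_x^*X$ be the corresponding orbit (transport $\Phi_V$ by a linear isomorphism $T_xX\cong V$ and take the orbit of $\mathrm{Cpin}(T_xX\oplus T_x^*X)$ through it; the result does not depend on the isomorphism), let $\mathcal B(X)=\bigcup_x\mathcal B(T_xX)$, and let $\mathcal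 E_{\mathcal B}(X)$ be the set of smooth sections of $\mathcal B(X)$. A $\mathcal B(V)$-structure is a $\Phi\in\mathcal E_{\mathcal B}(X)$ with $d\Phi=0$. Let $\Phi$ be a $\mathcal B(V)$-structure on $X$ and put $\mathbf E^{k-1}=\mathrm{CL}^k(TX\oplus T^*X)\cdot\Phi\subset\oplus^l\wedge^*T^*X$ for $k\ge0$, with $\Gamma(\mathbf E^{k-1})$ the space of its smooth sections. Then: 1. Each $\mathbf E^{k-1}$ is a smooth vector bundle of constant rank, and $d\,\Gamma(\mathbf E^{k-1})\subset\Gamma(\mathbf E^{k})$ for all $k\ge0$. Hence $0\to\mathbf E^{-1}\xrightarrow{d}\mathbf E^0\xrightarrow{d}\mathbf E^1\xrightarrow{d}\cdots$ is a differential complex ($d\circ d=0$), a subcomplex of the $l$-fold direct sum of the de Rham complex. 2. $\Gamma(\mathbf E^1)$ is the tangent space $T_\Phi\mathcal E_{\mathcal B}(X)$, i.e. the set of velocities at $t=0$ of smooth curves $(\Phi_t)_{t\in\mathbb R}$ in $\mathcal E_{\mathcal B}(X)$ with $\Phi_0=\Phi$. 3. Let $D$ be the set of infinitesimal deformations of $\Phi$: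 the velocities at $t=0$ of smooth curves $(\Phi_t)$ in $\mathcal E_{\mathcal B}(X)$ with $\Phi_0=\Phi$ and $\frac{d}{dt}\big|_{t=0}d\Phi_t=0$. Let $G$ be the tangent space at $\Phi$ of its orbit under diffeomorphisms and exact $b$-fields: the velocities at $t=0$ of the curves $t\mapsto e^{d\gamma_t}\wedge f_t^*\Phi$, for smooth families of diffeomorphisms $f_t$ of $X$ with $f_0=\mathrm{id}$ and of 1-forms $\gamma_t$ with $d\gamma_0=0$. Then $G\subset D$ are linear subspaces of the space of sections of $\oplus^l\wedge^*T^*X$, and $$H^1=\frac{\ker\big(d:\Gamma(\mathbf E^1)\to\Gamma(\mathbf E^2)\big)}{\operatorname{im}\big(d:\Gamma(\mathbf E^0)\to\Gamma(\mathbf E^1)\big)}$$ is isomorphic to $D/G$ by the map that sends the class of $\alpha$ to the class of $\alpha$. -/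

import Mathlib

set_option maxSynthPendingDepth 3

open scoped Manifold ContDiff Topology

noncomputable section

namespace CliffordDeformation

/-! ### Linear algebra on a vector space `V`: Clifford algebra of `V ⊕ V*` and its spinors -/

section LinearAlgebra

variable (V : Type*) [NormedAddCommGroup V] [NormedSpace ℝ V]

/-- The spinor space `S = ⨁ₚ Λᵖ V*` of a finite dimensional space `V`. Since `Λᵖ V* = 0` for
`p > dim V`, the product over all `p` is the direct sum. -/
abbrev Spinor : Type _ := ∀ p : ℕ, V [⋀^Fin p]→L[ℝ] ℝ

/-- The bilinear form `⟨v₁ + η₁, v₂ + η₂⟩ = ½ η₁(v₂) + ½ η₂(v₁)` on `V ⊕ V*`. -/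
def pairing : LinearMap.BilinForm ℝ (V × (V →L[ℝ] ℝ)) :=
  LinearMap.mk₂ ℝ (fun a b => (1 / 2 : ℝ) * a.2 b.1 + (1 / 2 : ℝ) * b.2 a.1)
    (fun a b c => by simp; ring) (fun r a b => by simp; ring)
    (fun a b c => by simp; ring) (fun r a b => by simp; ring)

/-- The quadratic form `‖v + η‖² = ⟨v + η, v + η⟩ = η(v)` on `V ⊕ V*`. -/
def normSq : QuadraticForm ℝ (V × (V →L[ℝ] ℝ)) := (pairing V).toQuadraticMap

theorem normSq_apply (a : V × (V →L[ℝ] ℝ)) : normSq V a = a.2 a.1 := by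
  simp only [normSq, pairing, LinearMap.BilinMap.toQuadraticMap_apply, LinearMap.mk₂_apply]
  ring

/-- The Clifford algebra `CL(V ⊕ V*)`, with relation `E · E = ‖E‖²`. -/
abbrev CL : Type _ := CliffordAlgebra (normSq V)

variable {V}

/-- The interior product `φ ↦ i_v φ`. -/
def contract (v : V) (φ : Spinor V) : Spinor V := fun p => (φ (p + 1)).curryLeft v

/-- The exterior product `φ ↦ η ∧ φ` with a covector: on `p`-forms,
`(η ∧ φ)(v₀, …, vₚ) = ∑ᵢ (-1)ⁱ η(vᵢ) φ(v₀, …, v̂ᵢ, …, vₚ)`. -/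
def wedge (η : V →L[ℝ] ℝ) (φ : Spinor V) : Spinor V
  | 0 => 0
  | p + 1 => ContinuousAlternatingMap.alternatizeUncurryFin (η.smulRight (φ p))

theorem wedge_succ_apply (η : V →L[ℝ] ℝ) (φ : Spinor V) (p : ℕ) (w : Fin (p + 1) → V) :
    wedge η φ (p + 1) w = ∑ i : Fin (p + 1), (-1 : ℤ) ^ (i : ℕ) • (η (w i) * φ p (i.removeNth w)) := by
  simp [wedge, ContinuousAlternatingMap.alternatizeUncurryFin_apply]

/-- The action `E · φ = i_v φ + η ∧ φ` of `E = v + η ∈ V ⊕ V*` on spinors. -/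
def vectorAction : V × (V →L[ℝ] ℝ) →ₗ[ℝ] Module.End ℝ (Spinor V) :=
  LinearMap.mk₂ ℝ (fun a φ => contract a.1 φ + wedge a.2 φ)
    (fun a b φ => by
      ext p w
      cases p with
      | zero => simp [contract, wedge]
      | succ p =>
        simp [contract, wedge_succ_apply, add_mul, smul_add, Finset.sum_add_distrib]; abel)
    (fun r a φ => by
      ext p w
      cases p with
      | zero => simp [contract, wedge]
      | succ p =>
        simp [contract, wedge_succ_apply, mul_assoc, Finset.mul_sum, mul_left_comm])
    (fun a φ ψ => by
      ext p w
      cases p with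
      | zero => simp [contract, wedge]
      | succ p =>
        simp [contract, wedge_succ_apply, mul_add, Finset.sum_add_distrib]; abel)
    (fun r a φ => by
      ext p w
      cases p with
      | zero => simp [contract, wedge]
      | succ p =>
        simp [contract, wedge_succ_apply, Finset.mul_sum, mul_left_comm])

theorem contract_contract (v : V) (φ : Spinor V) : contract v (contract v φ) = 0 := by
  ext p w
  simp [contract]

theorem wedge_wedge (η : V →L[ℝ] ℝ) (φ : Spinor V) : wedge η (wedge η φ) = 0 := by
  ext p w
  match p with
  | 0 => simp [wedge]
  | 1 => simp [wedge, ContinuousAlternatingMap.alternatizeUncurryFin_apply]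
  | p + 2 =>
    have h := ContinuousAlternatingMap.alternatizeUncurryFin_alternatizeUncurryFinCLM_comp_of_symmetric
      (f := η.smulRight (η.smulRight (φ p))) (fun x y => by ext; simp; ring)
    have e : wedge η (wedge η φ) (p + 2) =
        ContinuousAlternatingMap.alternatizeUncurryFin
          (ContinuousAlternatingMap.alternatizeUncurryFinCLM ℝ V ℝ ∘L
            (η.smulRight (η.smulRight (φ p)))) := by
      ext u
      simp [wedge, ContinuousAlternatingMap.alternatizeUncurryFin_apply, Finset.mul_sum,
        mul_left_comm]
    rw [e, h]
    rfl

theorem contract_wedge (v : V) (η : V →L[ℝ] ℝ) (φ : Spinor V) :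
    contract v (wedge η φ) + wedge η (contract v φ) = η v • φ := by
  ext p w
  cases p with
  | zero =>
    have : (0 : Fin 1).removeNth (Matrix.vecCons v w) = w := by ext i; exact i.elim0
    simp [contract, wedge, ContinuousAlternatingMap.alternatizeUncurryFin_apply, this]
  | succ p =>
    have h0 : (0 : Fin (p + 2)).removeNth (Matrix.vecCons v w) = w := by
      ext i; simp [Fin.removeNth]
    have hs : ∀ i : Fin (p + 1), (i.succ).removeNth (Matrix.vecCons v w) =
        Matrix.vecCons v (i.removeNth w) := by
      intro i
      ext j
      refine Fin.cases ?_ (fun j => ?_) j <;> simp [Fin.removeNth]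
    simp only [Pi.add_apply, ContinuousAlternatingMap.add_apply, contract,
      ContinuousAlternatingMap.curryLeft_apply_apply, wedge_succ_apply, Pi.smul_apply,
      ContinuousAlternatingMap.smul_apply]
    rw [Fin.sum_univ_succ]
    simp [h0, hs, pow_succ]

/-- The spin representation of `CL(V ⊕ V*)` on `S`. -/
def spin : CL V →ₐ[ℝ] Module.End ℝ (Spinor V) :=
  CliffordAlgebra.lift (normSq V) ⟨vectorAction, fun a => by
    ext1 φ
    have h := contract_wedge a.1 a.2 φ
    have hl : vectorAction a (vectorAction a φ) =
        contract a.1 (contract a.1 φ) + (contract a.1 (wedge a.2 φ) + wedge a.2 (contract a.1 φ))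
          + wedge a.2 (wedge a.2 φ) := by
      have h1 : ∀ ψ, vectorAction a ψ = contract a.1 ψ + wedge a.2 ψ := fun ψ => rfl
      have h2 : ∀ ψ χ, contract a.1 (ψ + χ) = contract a.1 ψ + contract a.1 χ := by
        intro ψ χ; ext p w; simp [contract]
      have h3 : ∀ ψ χ, wedge a.2 (ψ + χ) = wedge a.2 ψ + wedge a.2 χ := by
        intro ψ χ
        ext p w
        cases p with
        | zero => simp [wedge]
        | succ p => simp [wedge_succ_apply, mul_add, Finset.sum_add_distrib]
      rw [h1, h1, h2, h3]
      abel
    rw [contract_contract, wedge_wedge, h] at hl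
    simpa [normSq_apply, Module.algebraMap_end_apply] using hl⟩

/-- The action of `CL(V ⊕ V*)` on `⊕ˡ S`. -/
def act {l : ℕ} : CL V →ₗ[ℝ] (Fin l → Spinor V) →ₗ[ℝ] (Fin l → Spinor V) :=
  LinearMap.mk₂ ℝ (fun a Φ i => spin a (Φ i))
    (fun a b Φ => by ext1 i; simp) (fun r a Φ => by ext1 i; simp)
    (fun a Φ Ψ => by ext1 i; simp) (fun r a Φ => by ext1 i; simp)

variable (V) in
/-- The conformal pin group
`Cpin(V ⊕ V*) = {g ∈ CL(V ⊕ V*)ˣ | g̃⁻¹ (V ⊕ V*) g ⊆ V ⊕ V*}`, where `g ↦ g̃` is the grading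
involution. -/
def cpin : Set (CL V)ˣ :=
  {g | ∀ a : V × (V →L[ℝ] ℝ), ∃ b : V × (V →L[ℝ] ℝ),
    CliffordAlgebra.involute (↑g⁻¹ : CL V) * CliffordAlgebra.ι (normSq V) a * (g : CL V) =
      CliffordAlgebra.ι (normSq V) b}

variable (V) in
/-- The filtration `CLᵏ`: the span of the products of `j` elements of `V ⊕ V*`, for `j ≤ k` of the
same parity as `k`. -/
def cliffordFiltration (k : ℕ) : Submodule ℝ (CL V) :=
  ⨆ j : {j : ℕ // j ≤ k ∧ j % 2 = k % 2},
    LinearMap.range (CliffordAlgebra.ι (normSq V)) ^ (j : ℕ)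

/-- Pull-back of (tuples of) spinors by a linear map. -/
def pullSpinor {W : Type*} [NormedAddCommGroup W] [NormedSpace ℝ W] {l : ℕ} (e : W →L[ℝ] V)
    (Φ : Fin l → Spinor V) : Fin l → Spinor W :=
  fun i p => (Φ i p).compContinuousLinearMap e

/-- The orbit `𝓑(W) ⊆ ⊕ˡ Λ* W*`, for `W` any space isomorphic to `V`: identify `W` with `V` and
take the orbit of `Cpin(W ⊕ W*)` through the tuple on `W` which corresponds to `ΦV`. (It does not
depend on the identification; for `W = V` it is the orbit `𝓑(V)` of `ΦV`.) -/
def orbit {l : ℕ} (ΦV : Fin l → Spinor V) (W : Type*) [NormedAddCommGroup W] [NormedSpace ℝ W] :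
    Set (Fin l → Spinor W) :=
  {φ | ∃ e : W ≃L[ℝ] V, ∃ g ∈ cpin W, φ = act (g : CL W) (pullSpinor (e : W →L[ℝ] V) ΦV)}

/-- The wedge product `b ∧ φ` with a 2-form `b`: in a basis `(eₖ)` with dual basis `(eᵏ)` it is
`½ ∑ₖ eᵏ ∧ (i_{eₖ} b) ∧ φ`, since `b = ½ ∑ₖ eᵏ ∧ i_{eₖ} b`. -/
def wedgeTwo (b : V [⋀^Fin 2]→L[ℝ] ℝ) (φ : Spinor V) : Spinor V
  | 0 => 0
  | 1 => 0
  | p + 2 => (1 / 2 : ℝ) • ContinuousAlternatingMap.alternatizeUncurryFin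
      (ContinuousAlternatingMap.alternatizeUncurryFinCLM ℝ V ℝ ∘L
        ((ContinuousLinearMap.smulRightL ℝ V (V [⋀^Fin p]→L[ℝ] ℝ)).flip (φ p)) ∘L
        ((ContinuousAlternatingMap.ofSubsingletonLIE (𝕜 := ℝ) (E := V) (F := ℝ)
          (0 : Fin 1)).symm.toContinuousLinearEquiv : (V [⋀^Fin 1]→L[ℝ] ℝ) →L[ℝ] (V →L[ℝ] ℝ)) ∘L
        b.curryLeft)

/-- `e^b ∧ φ = ∑ₖ (1/k!) bᵏ ∧ φ` for a 2-form `b` (the degree `p` part only involves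
`2 k ≤ p`). -/
def expWedge (b : V [⋀^Fin 2]→L[ℝ] ℝ) (φ : Spinor V) : Spinor V :=
  fun p => ∑ k ∈ Finset.range (p + 1), ((k.factorial : ℝ)⁻¹) • ((wedgeTwo b)^[k] φ) p

end LinearAlgebra

/-! ### Differential forms on a manifold

`X` is a manifold without boundary modelled on the vector space `E`. In Mathlib the tangent space
`TangentSpace 𝓘(ℝ, E) x` is by definition the model space `E`, seen through the preferred chart at
`x`; accordingly an element of `Λᵖ Tₓ*X` is an element of `E [⋀^Fin p]→L[ℝ] ℝ`. -/

section Manifold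

variable {E : Type*} [NormedAddCommGroup E] [NormedSpace ℝ E]
  {F : Type*} [NormedAddCommGroup F] [NormedSpace ℝ F]
  {X : Type*} [TopologicalSpace X] [ChartedSpace E X]
  {Y : Type*} [TopologicalSpace Y] [ChartedSpace F Y]

/-- The pull-back `f^* α` of a differential `p`-form by a map `f : X → Y`. -/
def pullback (f : X → Y) {p : ℕ} (α : Y → F [⋀^Fin p]→L[ℝ] ℝ) : X → E [⋀^Fin p]→L[ℝ] ℝ :=
  fun x => (α (f x)).compContinuousLinearMap (mfderiv 𝓘(ℝ, E) 𝓘(ℝ, F) f x : E →L[ℝ] F)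

/-- The expression of a `p`-form in the chart around `x₀`, a `p`-form on (an open subset of) `E`. -/
def chartRep (x₀ : X) {p : ℕ} (α : X → E [⋀^Fin p]→L[ℝ] ℝ) : E → E [⋀^Fin p]→L[ℝ] ℝ :=
  pullback (X := E) (extChartAt 𝓘(ℝ, E) x₀).symm α

/-- Smoothness of a `p`-form. -/
def IsSmooth {p : ℕ} (α : X → E [⋀^Fin p]→L[ℝ] ℝ) : Prop :=
  ∀ x₀ : X, ContDiffOn ℝ ∞ (chartRep x₀ α) (extChartAt 𝓘(ℝ, E) x₀).target

/-- Joint smoothness in `(t, x)` of a one-parameter family of `p`-forms. -/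
def IsSmoothFamily {p : ℕ} (α : ℝ → X → E [⋀^Fin p]→L[ℝ] ℝ) : Prop :=
  ∀ x₀ : X, ContDiffOn ℝ ∞ (fun q : ℝ × E => chartRep x₀ (α q.1) q.2)
    (Set.univ ×ˢ (extChartAt 𝓘(ℝ, E) x₀).target)

/-- The exterior derivative of a `p`-form, computed in the chart around each point. -/
def extD {p : ℕ} (α : X → E [⋀^Fin p]→L[ℝ] ℝ) : X → E [⋀^Fin (p + 1)]→L[ℝ] ℝ :=
  fun x => pullback (Y := E) (extChartAt 𝓘(ℝ, E) x) (extDeriv (chartRep x α)) x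

theorem chartRep_add (x₀ : X) {p : ℕ} (α β : X → E [⋀^Fin p]→L[ℝ] ℝ) :
    chartRep x₀ (α + β) = chartRep x₀ α + chartRep x₀ β := rfl

theorem chartRep_smul (x₀ : X) {p : ℕ} (r : ℝ) (α : X → E [⋀^Fin p]→L[ℝ] ℝ) :
    chartRep x₀ (r • α) = r • chartRep x₀ α := rfl

theorem IsSmooth.differentiableAt {p : ℕ} {α : X → E [⋀^Fin p]→L[ℝ] ℝ} (h : IsSmooth α) (x : X) :
    DifferentiableAt ℝ (chartRep x α) (extChartAt 𝓘(ℝ, E) x x) :=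
  ((h x).contDiffAt (extChartAt_target_mem_nhds x)).differentiableAt (by simp)

theorem extD_add {p : ℕ} {α β : X → E [⋀^Fin p]→L[ℝ] ℝ} (hα : IsSmooth α) (hβ : IsSmooth β) :
    extD (α + β) = extD α + extD β := by
  funext x
  simp only [extD, pullback, chartRep_add, Pi.add_apply]
  rw [extDeriv_add (hα.differentiableAt x) (hβ.differentiableAt x)]
  rfl

theorem extD_smul {p : ℕ} (r : ℝ) (α : X → E [⋀^Fin p]→L[ℝ] ℝ) :
    extD (r • α) = r • extD α := by
  funext x
  simp only [extD, pullback, chartRep_smul, Pi.smul_apply]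
  rw [extDeriv_smul]
  rfl

variable (E X) in
/-- Sections (not necessarily smooth) of `⊕ˡ Λ* T*X`. -/
abbrev FormTuple (l : ℕ) : Type _ := X → Fin l → Spinor E

variable {l : ℕ}

variable (E X l) in
/-- The smooth sections of `⊕ˡ Λ* T*X`. -/
def smoothForms : Submodule ℝ (FormTuple E X l) where
  carrier := {α | ∀ i p, IsSmooth (fun x => α x i p)}
  add_mem' hα hβ := fun i p x₀ => (hα i p x₀).add (hβ i p x₀)
  zero_mem' := fun _ p _ => contDiffOn_const (c := (0 : E [⋀^Fin p]→L[ℝ] ℝ))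
  smul_mem' r _ hα := fun i p x₀ => (hα i p x₀).const_smul r

/-- The exterior derivative on sections of `⊕ˡ Λ* T*X`. -/
def d (α : FormTuple E X l) : FormTuple E X l := fun x i p =>
  match p with
  | 0 => 0
  | p + 1 => extD (fun y => α y i p) x

theorem d_add {α β : FormTuple E X l} (hα : α ∈ smoothForms E X l) (hβ : β ∈ smoothForms E X l) :
    d (α + β) = d α + d β := by
  funext x i p
  cases p with
  | zero => simp [d]
  | succ p => exact congrFun (extD_add (hα i p) (hβ i p)) x

theorem d_smul (r : ℝ) (α : FormTuple E X l) : d (r • α) = r • d α := by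
  funext x i p
  cases p with
  | zero => simp [d]
  | succ p => exact congrFun (extD_smul r (fun y => α y i p)) x

theorem d_zero : d (0 : FormTuple E X l) = 0 := by
  simpa using d_smul (0 : ℝ) (0 : FormTuple E X l)

/-! ### `𝓑(V)`-structures and the deformation complex -/

variable {V : Type*} [NormedAddCommGroup V] [NormedSpace ℝ V]

variable (E X) in
/-- The smooth sections of the bundle `𝓑(X) ⊆ ⊕ˡ Λ* T*X` with fibres `𝓑(TₓX)`. -/
def orbitSections (ΦV : Fin l → Spinor V) : Set (FormTuple E X l) :=
  {Φ | Φ ∈ smoothForms E X l ∧ ∀ x, Φ x ∈ orbit ΦV E}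

variable (E X) in
/-- The `𝓑(V)`-structures on `X`: the `d`-closed smooth sections of `𝓑(X)`. -/
def structures (ΦV : Fin l → Spinor V) : Set (FormTuple E X l) :=
  {Φ | Φ ∈ orbitSections E X ΦV ∧ d Φ = 0}

/-- The fibre `CLᵏ · Φₓ` of `𝐄ᵏ⁻¹` at `x`. -/
def fibre (Φ : FormTuple E X l) (k : ℕ) (x : X) : Submodule ℝ (Fin l → Spinor E) :=
  (cliffordFiltration E k).map (act.flip (Φ x))

/-- The smooth sections `Γ(𝐄ᵏ⁻¹)` of `𝐄ᵏ⁻¹ = CLᵏ · Φ` (mind the shift of the index). -/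
def sections (Φ : FormTuple E X l) (k : ℕ) : Submodule ℝ (FormTuple E X l) :=
  smoothForms E X l ⊓ Submodule.pi Set.univ (fibre Φ k)

/-- The kernel of `d : Γ(𝐄ᵏ⁻¹) → Γ(𝐄ᵏ)`. -/
def cocycles (Φ : FormTuple E X l) (k : ℕ) : Submodule ℝ (FormTuple E X l) where
  carrier := {α | α ∈ sections Φ k ∧ d α = 0}
  add_mem' {α β} hα hβ := ⟨add_mem hα.1 hβ.1, by rw [d_add hα.1.1 hβ.1.1, hα.2, hβ.2, add_zero]⟩
  zero_mem' := ⟨zero_mem _, d_zero⟩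
  smul_mem' r α hα := ⟨Submodule.smul_mem _ r hα.1, by rw [d_smul, hα.2, smul_zero]⟩

/-- The image of `d` on `Γ(𝐄ᵏ⁻¹)`. -/
def coboundaries (Φ : FormTuple E X l) (k : ℕ) : Submodule ℝ (FormTuple E X l) where
  carrier := d '' (sections Φ k : Set (FormTuple E X l))
  add_mem' := by
    rintro _ _ ⟨α, hα, rfl⟩ ⟨β, hβ, rfl⟩
    exact ⟨α + β, add_mem hα hβ, d_add hα.1 hβ.1⟩
  zero_mem' := ⟨0, zero_mem _, d_zero⟩
  smul_mem' := by
    rintro r _ ⟨α, hα, rfl⟩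
    exact ⟨r • α, Submodule.smul_mem _ r hα, d_smul r α⟩

/-- The cohomology `Hᵏ = ker (d : Γ(𝐄ᵏ) → Γ(𝐄ᵏ⁺¹)) / im (d : Γ(𝐄ᵏ⁻¹) → Γ(𝐄ᵏ))`, `k ≥ 0`. -/
abbrev cohomology (Φ : FormTuple E X l) (k : ℕ) : Type _ :=
  cocycles Φ (k + 1) ⧸ (coboundaries Φ k).submoduleOf (cocycles Φ (k + 1))

/-! ### Infinitesimal deformations -/

/-- `α` is the derivative at `t = 0` of the curve `Ψ` of sections of `⊕ˡ Λ* T*X`. -/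
def HasVelocity (Ψ : ℝ → FormTuple E X l) (α : FormTuple E X l) : Prop :=
  ∀ x i p, HasDerivAt (fun t => Ψ t x i p) (α x i p) 0

/-- `Ψ` is a smooth curve of sections of the bundle `𝓑(X)` with `Ψ₀ = Φ`. -/
def IsCurveInOrbit (ΦV : Fin l → Spinor V) (Φ : FormTuple E X l) (Ψ : ℝ → FormTuple E X l) :
    Prop :=
  (∀ i p, IsSmoothFamily (fun t x => Ψ t x i p)) ∧ (∀ t, Ψ t ∈ orbitSections E X ΦV) ∧ Ψ 0 = Φ

/-- The tangent space at `Φ` of the space of smooth sections of `𝓑(X)`. -/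
def tangentOrbitSections (ΦV : Fin l → Spinor V) (Φ : FormTuple E X l) :
    Set (FormTuple E X l) :=
  {α | ∃ Ψ : ℝ → FormTuple E X l, IsCurveInOrbit ΦV Φ Ψ ∧ HasVelocity Ψ α}

/-- The infinitesimal deformations of the `𝓑(V)`-structure `Φ`: the velocities of the smooth curves
`Ψ` of sections of `𝓑(X)` through `Φ` which satisfy the equation `d Ψₜ = 0` to first order at
`t = 0`. -/
def infinitesimalDeformations (ΦV : Fin l → Spinor V) (Φ : FormTuple E X l) :
    Set (FormTuple E X l) :=
  {α | ∃ Ψ : ℝ → FormTuple E X l, IsCurveInOrbit ΦV Φ Ψ ∧ HasVelocity Ψ α ∧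
    HasVelocity (fun t => d (Ψ t)) 0}

/-- The action `Φ ↦ e^{dγ} ∧ f^* Φ` of the diffeomorphism `f` and of the exact `b`-field `dγ`. -/
def gaugeAct (γ : X → E [⋀^Fin 1]→L[ℝ] ℝ) (f : X → X) (Φ : FormTuple E X l) : FormTuple E X l :=
  fun x i => expWedge (extD γ x) (fun p => pullback f (fun y => Φ y i p) x)

/-- The tangent space at `Φ` of the orbit of `Φ` under the group of the transformations
`e^{dγ} ∧ f^*`: the velocities of `t ↦ e^{dγₜ} ∧ fₜ^* Φ` for smooth families of diffeomorphisms
`fₜ` with `f₀ = id` and of 1-forms `γₜ` with `dγ₀ = 0`. -/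
def tangentGaugeOrbit (Φ : FormTuple E X l) : Set (FormTuple E X l) :=
  {α | ∃ (γ : ℝ → X → E [⋀^Fin 1]→L[ℝ] ℝ) (f : ℝ → X ≃ₘ^∞⟮𝓘(ℝ, E), 𝓘(ℝ, E)⟯ X),
    IsSmoothFamily γ ∧ extD (γ 0) = 0 ∧
    ContMDiff (𝓘(ℝ, ℝ).prod 𝓘(ℝ, E)) 𝓘(ℝ, E) ∞ (fun q : ℝ × X => f q.1 q.2) ∧
    (∀ x, f 0 x = x) ∧ HasVelocity (fun t => gaugeAct (γ t) (f t) Φ) α}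

/-- The fibres `CLᵏ · Φₓ` form a smooth vector bundle of constant rank: locally they have a smooth
frame. -/
def IsVectorBundle (Φ : FormTuple E X l) (k : ℕ) : Prop :=
  ∃ r : ℕ, ∀ x₀ : X, ∃ U ∈ 𝓝 x₀, ∃ s : Fin r → FormTuple E X l,
    (∀ j, s j ∈ sections Φ k) ∧
    ∀ x ∈ U, LinearIndependent ℝ (fun j => s j x) ∧
      Submodule.span ℝ (Set.range fun j => s j x) = fibre Φ k x

end Manifold

end CliffordDeformation

end

set_option maxSynthPendingDepth 3

open scoped Manifold ContDiff Topology

noncomputable section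

namespace CliffordDeformation

/-! In a chart the exterior derivative is `altT` of the derivative, i.e. `dα = ∑ᵢ eⁱ · ∂ᵢα` with
`eⁱ` acting by Clifford multiplication. Everything rests on one infinitesimal fact: if `Φ` takes
values in the orbit, then every directional derivative of `Φ` lies in `CL² · Φ`
(`deriv_mem_cliff_two`). Granted this, closedness of `Φ` says that `D = DΦ` has values in `CL² · Φ`
and `altT D = 0`. The Clifford relation gives `altT (a · D) = D(a.1) - a · altT D`, so by induction
on the length of a word `w`, `altT (w · D)` lies in `CLᵏ⁺¹ · Φ` for `w` of length `k`
(`altT_word_mem_cliff`). With the Leibniz rule and a partition of unity this shows that `d` raises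
the filtration by one.

The rank is constant because two points of an orbit differ by an operator which normalizes `V ⊕ V*`
in the twisted sense, and such an operator carries words to words of the same length. Words that are
independent at one point therefore stay a frame nearby.

For the infinitesimal fact, write a curve in the orbit as `g(t) · φ`. The `g(t)` are arbitrary
choices, with no continuity. By second countability all but countably many points of the graph of
`g` are accumulation points of it (`countable_setOf_isolated`). At such a time the difference
quotients are taken along group elements tending to `1`, and a slice argument
(`exists_twistedLie_of_tendsto`) puts the velocity in the Lie algebra applied to `φ`. That Lie
algebra acts through scalars and products of two vectors (`diag_mem_cliff_two`). The countably many
exceptional times are removed by continuity and constancy of the rank.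

Conversely `1 + s a b` lies in `Cpin` for small `s`, so local words of length two, cut off and
applied one after the other, realize each section of `CL² · Φ` as a velocity. Since `d` commutes
with the time derivative, the infinitesimal deformations are the closed sections of `CL² · Φ`.

Finally, for `dΦ = 0`, Cartan's formula identifies the velocity of `e^{dγ} ∧ f^* Φ` with `d((v + θ)
· Φ)`, where `v` and `θ` are the velocities of `f` and `γ`. Each section of `CL¹ · Φ` has the form
`(v + θ) · Φ` with `v`, `θ` realized by such families (`exists_gaugeFamily`). So the two quotients
of the theorem have the same numerator and the same denominator. -/

section

/-! ### Words in `V ⊕ V*` and the filtration `CLᵏ · φ`. -/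

section CliffordWords

variable {V : Type*} [NormedAddCommGroup V] [NormedSpace ℝ V] {l : ℕ}

/-- The action of `V ⊕ V*` on tuples of spinors. -/
def tact : V × (V →L[ℝ] ℝ) →ₗ[ℝ] Module.End ℝ (Fin l → Spinor V) :=
  act ∘ₗ CliffordAlgebra.ι (normSq V)

theorem act_mul (x y : CL V) (Φ : Fin l → Spinor V) : act (x * y) Φ = act x (act y Φ) := by
  ext1 i
  simp [act]

theorem act_one (Φ : Fin l → Spinor V) : act (1 : CL V) Φ = Φ := by
  ext1 i
  simp [act]

theorem act_ι (a : V × (V →L[ℝ] ℝ)) (Φ : Fin l → Spinor V) :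
    act (CliffordAlgebra.ι (normSq V) a) Φ = tact a Φ := rfl

theorem act_apply (x : CL V) (Φ : Fin l → Spinor V) (i : Fin l) : act x Φ i = spin x (Φ i) := rfl

theorem spin_ι (a : V × (V →L[ℝ] ℝ)) : spin (CliffordAlgebra.ι (normSq V) a) = vectorAction a := by
  simp [spin]

theorem tact_apply (a : V × (V →L[ℝ] ℝ)) (Φ : Fin l → Spinor V) (i : Fin l) :
    tact a Φ i = vectorAction a (Φ i) := by
  rw [← act_ι, act_apply, spin_ι]

theorem vectorAction_apply (a : V × (V →L[ℝ] ℝ)) (φ : Spinor V) :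
    vectorAction a φ = contract a.1 φ + wedge a.2 φ := rfl

theorem ι_anticomm (a b : V × (V →L[ℝ] ℝ)) :
    CliffordAlgebra.ι (normSq V) a * CliffordAlgebra.ι (normSq V) b
      + CliffordAlgebra.ι (normSq V) b * CliffordAlgebra.ι (normSq V) a
      = algebraMap ℝ (CL V) (a.2 b.1 + b.2 a.1) := by
  rw [CliffordAlgebra.ι_mul_ι_add_swap, QuadraticMap.polar]
  congr 1
  simp [normSq_apply]
  ring

theorem vectorAction_anticomm (a b : V × (V →L[ℝ] ℝ)) (φ : Spinor V) :
    vectorAction a (vectorAction b φ) + vectorAction b (vectorAction a φ)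
      = (a.2 b.1 + b.2 a.1) • φ := by
  have h := congrArg (fun x => spin x φ) (ι_anticomm a b)
  simpa [spin_ι, Module.algebraMap_end_apply, add_smul] using h

theorem tact_anticomm (a b : V × (V →L[ℝ] ℝ)) (Φ : Fin l → Spinor V) :
    tact a (tact b Φ) + tact b (tact a Φ) = (a.2 b.1 + b.2 a.1) • Φ := by
  ext1 i
  simpa [tact_apply] using vectorAction_anticomm a b (Φ i)

/-- The action of a word in `V ⊕ V*` on tuples of spinors. -/
def word (ws : List (V × (V →L[ℝ] ℝ))) : Module.End ℝ (Fin l → Spinor V) := (ws.map tact).prod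

@[simp] theorem word_nil (φ : Fin l → Spinor V) : word [] φ = φ := rfl

@[simp] theorem word_cons (a : V × (V →L[ℝ] ℝ)) (ws : List (V × (V →L[ℝ] ℝ)))
    (φ : Fin l → Spinor V) : word (a :: ws) φ = tact a (word ws φ) := by
  simp [word]

/-- The subspace `CLᵏ · φ`, as the span of the words of length at most `k` and the parity of `k`. -/
def cliff (φ : Fin l → Spinor V) (k : ℕ) : Submodule ℝ (Fin l → Spinor V) :=
  Submodule.span ℝ {ψ | ∃ ws : List (V × (V →L[ℝ] ℝ)),
    ws.length ≤ k ∧ ws.length % 2 = k % 2 ∧ word ws φ = ψ}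

theorem word_mem_cliff (φ : Fin l → Spinor V) {k : ℕ} {ws : List (V × (V →L[ℝ] ℝ))}
    (h : ws.length ≤ k) (h' : ws.length % 2 = k % 2) : word ws φ ∈ cliff φ k :=
  Submodule.subset_span ⟨ws, h, h', rfl⟩

theorem act_list_prod (ws : List (V × (V →L[ℝ] ℝ))) (φ : Fin l → Spinor V) :
    act (ws.map (CliffordAlgebra.ι (normSq V))).prod φ = word ws φ := by
  induction ws with
  | nil => simp [act_one]
  | cons a ws ih => simp [act_mul, ih, act_ι]

theorem mem_pow_range_ι (j : ℕ) (x : CL V)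
    (hx : x ∈ LinearMap.range (CliffordAlgebra.ι (normSq V)) ^ j) :
    x ∈ Submodule.span ℝ {y | ∃ ws : List (V × (V →L[ℝ] ℝ)),
      ws.length = j ∧ (ws.map (CliffordAlgebra.ι (normSq V))).prod = y} := by
  induction j generalizing x with
  | zero =>
    rw [pow_zero, Submodule.one_eq_span] at hx
    refine Submodule.span_mono ?_ hx
    rintro _ rfl
    exact ⟨[], rfl, rfl⟩
  | succ j ih =>
    rw [pow_succ'] at hx
    refine Submodule.mul_induction_on hx ?_ (fun x y => add_mem)
    rintro _ ⟨a, rfl⟩ y hy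
    refine Submodule.span_induction ?_ (by simp) (fun x y _ _ hx hy => ?_) (fun r x _ hx => ?_)
      (ih y hy)
    · rintro _ ⟨ws, h, rfl⟩
      exact Submodule.subset_span ⟨a :: ws, by simp [h], by simp⟩
    · rw [mul_add]; exact add_mem hx hy
    · rw [mul_smul_comm]; exact Submodule.smul_mem _ r hx

theorem list_prod_mem_pow_range_ι (ws : List (V × (V →L[ℝ] ℝ))) :
    (ws.map (CliffordAlgebra.ι (normSq V))).prod ∈
      LinearMap.range (CliffordAlgebra.ι (normSq V)) ^ ws.length := by
  induction ws with
  | nil => simp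
  | cons a ws ih =>
    simp only [List.map_cons, List.prod_cons, List.length_cons]
    rw [pow_succ']
    exact Submodule.mul_mem_mul ⟨a, rfl⟩ ih

/-- Replaces the fibre by a span of words, so that later claims about `CLᵏ · φ` reduce by linearity
to single words. -/
theorem map_cliffordFiltration (φ : Fin l → Spinor V) (k : ℕ) :
    (cliffordFiltration V k).map (act.flip φ) = cliff φ k := by
  apply le_antisymm
  · rw [Submodule.map_le_iff_le_comap, cliffordFiltration, iSup_le_iff]
    rintro ⟨j, hj, hj'⟩ x hx
    have h := mem_pow_range_ι j x hx
    refine Submodule.span_le.2 ?_ h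
    rintro _ ⟨ws, rfl, rfl⟩
    simp only [Submodule.comap_coe, Set.mem_preimage, LinearMap.flip_apply, SetLike.mem_coe]
    rw [act_list_prod]
    exact word_mem_cliff φ hj hj'
  · rw [cliff, Submodule.span_le]
    rintro _ ⟨ws, h, h', rfl⟩
    refine ⟨(ws.map (CliffordAlgebra.ι (normSq V))).prod, ?_, act_list_prod ws φ⟩
    refine Submodule.mem_iSup_of_mem (⟨ws.length, h, h'⟩ : {j : ℕ // j ≤ k ∧ j % 2 = k % 2}) ?_
    exact list_prod_mem_pow_range_ι ws

/-- The parity of the length is fixed, so the filtration grows in steps of two only. -/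
theorem cliff_mono (φ : Fin l → Spinor V) (k : ℕ) : cliff φ k ≤ cliff φ (k + 2) := by
  refine Submodule.span_mono ?_
  rintro _ ⟨ws, h, h', rfl⟩
  exact ⟨ws, by omega, by omega, rfl⟩

theorem tact_mem_cliff {φ ψ : Fin l → Spinor V} {k : ℕ} (a : V × (V →L[ℝ] ℝ))
    (h : ψ ∈ cliff φ k) : tact a ψ ∈ cliff φ (k + 1) := by
  refine Submodule.span_induction (p := fun ψ _ => tact a ψ ∈ cliff φ (k + 1)) ?_ (by simp)
    (fun x y _ _ hx hy => ?_) (fun r x _ hx => ?_) h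
  · rintro _ ⟨ws, h, h', rfl⟩
    rw [← word_cons]
    exact word_mem_cliff φ (by simp; omega) (by simp; omega)
  · rw [map_add]; exact add_mem hx hy
  · rw [map_smul]; exact Submodule.smul_mem _ r hx

theorem word_mem_cliff_add {φ ψ : Fin l → Spinor V} {k : ℕ} (ws : List (V × (V →L[ℝ] ℝ)))
    (h : ψ ∈ cliff φ k) : word ws ψ ∈ cliff φ (k + ws.length) := by
  induction ws with
  | nil => simpa
  | cons a ws ih => simpa [add_assoc] using tact_mem_cliff a ih

theorem self_mem_cliff_zero (φ : Fin l → Spinor V) : φ ∈ cliff φ 0 :=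
  word_mem_cliff φ (ws := []) (by simp) (by simp)

/-- Induction on elements of `CLᵏ · φ`: linear maps which agree with the Clifford action up to
an automorphism carry `CLᵏ · φ` into `CLᵏ · φ'`. -/
theorem cliff_map_le {V' : Type*} [NormedAddCommGroup V'] [NormedSpace ℝ V'] {l' : ℕ}
    (φ : Fin l → Spinor V) (φ' : Fin l' → Spinor V') (k : ℕ)
    (T : (Fin l → Spinor V) →ₗ[ℝ] (Fin l' → Spinor V'))
    (h : ∀ ws : List (V × (V →L[ℝ] ℝ)), ws.length ≤ k → ws.length % 2 = k % 2 →
      T (word ws φ) ∈ cliff φ' k) :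
    (cliff φ k).map T ≤ cliff φ' k := by
  rw [cliff, Submodule.map_span, Submodule.span_le]
  rintro _ ⟨_, ⟨ws, hk, hk', rfl⟩, rfl⟩
  exact h ws hk hk'

end CliffordWords

/-! ### The symbol of the exterior derivative and its commutation with vectors. -/

section ExteriorSymbol

variable {V : Type*} [NormedAddCommGroup V] [NormedSpace ℝ V] [FiniteDimensional ℝ V] {l : ℕ}

variable (V) in
/-- A basis of `V`. -/
def bas : Module.Basis (Fin (Module.finrank ℝ V)) ℝ V := Module.finBasis ℝ V

/-- The elements of the dual basis. -/
def dbas (i : Fin (Module.finrank ℝ V)) : V →L[ℝ] ℝ := ((bas V).coord i).toContinuousLinearMap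

theorem sum_dbas (v : V) : ∑ i, dbas i v • bas V i = v := (bas V).sum_repr v

theorem sum_dbas_smul (η : V →L[ℝ] ℝ) : ∑ i, η (bas V i) • dbas i = η := by
  ext v
  conv_rhs => rw [← sum_dbas v]
  simp [mul_comm]

/-- The antisymmetrization `∑ᵢ eⁱ ∧ D eᵢ` of a linear map with values in tuples of spinors: the
symbol of the exterior derivative. -/
def altT : (V →ₗ[ℝ] Fin l → Spinor V) →ₗ[ℝ] Fin l → Spinor V :=
  ∑ i, (tact ((0 : V), dbas i)) ∘ₗ LinearMap.applyₗ (bas V i)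

theorem altT_apply (D : V →ₗ[ℝ] Fin l → Spinor V) :
    altT D = ∑ i, tact ((0 : V), dbas i) (D (bas V i)) := by
  simp [altT]

/-- The relation `eⁱ a + a eⁱ = eⁱ(a.1)` is summed over `i`, with `∑ eⁱ(v) eᵢ = v`. This is the
algebraic form of Cartan's formula `d i_v + i_v d = L_v`. -/
theorem altT_tact (a : V × (V →L[ℝ] ℝ)) (D : V →ₗ[ℝ] Fin l → Spinor V) :
    altT (tact a ∘ₗ D) = D a.1 - tact a (altT D) := by
  have h : ∀ i, tact ((0 : V), dbas i) (tact a (D (bas V i)))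
      = D (dbas i a.1 • bas V i) - tact a (tact ((0 : V), dbas i) (D (bas V i))) := fun i => by
    rw [eq_sub_iff_add_eq, tact_anticomm, map_smul]
    simp
  simp only [altT_apply, LinearMap.comp_apply, h, Finset.sum_sub_distrib, map_sum]
  rw [← map_sum, sum_dbas]

/-- If `D` takes values in `CL² · φ` and has vanishing antisymmetrization, then the
antisymmetrization of `w · D` for a word `w` of length `k` lies in `CLᵏ⁺¹ · φ`. -/
theorem altT_word_mem_cliff {φ : Fin l → Spinor V} {D : V →ₗ[ℝ] Fin l → Spinor V}
    (hD : ∀ v, D v ∈ cliff φ 2) (h0 : altT D = 0) (ws : List (V × (V →L[ℝ] ℝ))) :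
    altT (word ws ∘ₗ D) ∈ cliff φ (ws.length + 1) := by
  induction ws with
  | nil =>
    have : word [] ∘ₗ D = D := rfl
    rw [this, h0]; exact zero_mem _
  | cons a ws ih =>
    have : word (a :: ws) ∘ₗ D = tact a ∘ₗ (word ws ∘ₗ D) := by ext1 v; simp
    rw [this, altT_tact]
    -- Splitting off the letter `a` leaves `a · altT (ws · D)`, covered by induction, and `ws ·
    -- D(a.1)`, which has degree `ws.length + 2` because `D` has values in `CL² · φ`. That is
    -- exactly the degree allowed.
    refine sub_mem ?_ (by simpa using tact_mem_cliff a ih)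
    have := word_mem_cliff_add ws (hD a.1)
    rwa [add_comm] at this

/-- Serves for the term `df ∧ ψ` of the Leibniz rule. -/
theorem altT_smulRight (η : V →L[ℝ] ℝ) (ψ : Fin l → Spinor V) :
    altT ((η : V →ₗ[ℝ] ℝ).smulRight ψ) = tact ((0 : V), η) ψ := by
  simp only [altT_apply, LinearMap.smulRight_apply, map_smul]
  conv_rhs => rw [← sum_dbas_smul η]
  have : ((0 : V), ∑ i, η (bas V i) • dbas i) = ∑ i, η (bas V i) • ((0 : V), dbas i) := by
    ext <;> simp [Prod.fst_sum, Prod.snd_sum]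
  rw [this]
  simp only [map_sum, map_smul, LinearMap.sum_apply, LinearMap.smul_apply,
    ContinuousLinearMap.coe_coe]

theorem altT_zero_apply (D : V →ₗ[ℝ] Fin l → Spinor V) (j : Fin l) : altT D j 0 = 0 := by
  simp [altT_apply, tact_apply, vectorAction_apply, contract, wedge]

omit [FiniteDimensional ℝ V] in
theorem contract_zero_left (φ : Spinor V) : contract 0 φ = 0 := by
  ext p w
  simp [contract]

/-- Matches `altT` with the antisymmetrization in the definition of `extDeriv`; both sides are
linear in `D'`, which is a sum of the rank one maps `eⁱ ⊗ D'(eᵢ)`. -/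
theorem altT_succ_apply (D : V →ₗ[ℝ] Fin l → Spinor V) (j : Fin l) (p : ℕ)
    (D' : V →L[ℝ] V [⋀^Fin p]→L[ℝ] ℝ) (h : ∀ v, D v j p = D' v) :
    altT D j (p + 1) = ContinuousAlternatingMap.alternatizeUncurryFin D' := by
  have h1 : D' = ∑ i, (dbas i).smulRight (D (bas V i) j p) := by
    ext1 v
    conv_lhs => rw [← sum_dbas v]
    simp [h]
  rw [h1, ← ContinuousAlternatingMap.alternatizeUncurryFinCLM_apply, map_sum]
  simp [altT_apply, tact_apply, vectorAction_apply, contract_zero_left, wedge]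

end ExteriorSymbol

end

section

/-! ### Naturality under linear isomorphisms, and elements of the conformal pin group. -/

section Equivariance

variable {V : Type*} [NormedAddCommGroup V] [NormedSpace ℝ V]
  {W : Type*} [NormedAddCommGroup W] [NormedSpace ℝ W]
  {W' : Type*} [NormedAddCommGroup W'] [NormedSpace ℝ W'] {l : ℕ}

variable (l) in
/-- Pull-back of tuples of spinors as a linear map. -/
def pullT (e : W →L[ℝ] V) : (Fin l → Spinor V) →ₗ[ℝ] (Fin l → Spinor W) where
  toFun := pullSpinor e
  map_add' _ _ := rfl
  map_smul' _ _ := rfl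

theorem pullT_apply (e : W →L[ℝ] V) (Φ : Fin l → Spinor V) : pullT l e Φ = pullSpinor e Φ := rfl

/-- Pull-back of spinors as a linear map. -/
def pullS (e : W →L[ℝ] V) : Spinor V →ₗ[ℝ] Spinor W where
  toFun φ p := (φ p).compContinuousLinearMap e
  map_add' _ _ := rfl
  map_smul' _ _ := rfl

theorem pullS_apply (e : W →L[ℝ] V) (φ : Spinor V) (p : ℕ) :
    pullS e φ p = (φ p).compContinuousLinearMap e := rfl

theorem pullSpinor_apply (e : W →L[ℝ] V) (Φ : Fin l → Spinor V) (i : Fin l) :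
    pullSpinor e Φ i = pullS e (Φ i) := rfl

theorem pullSpinor_comp (e : W →L[ℝ] V) (f : W' →L[ℝ] W) (Φ : Fin l → Spinor V) :
    pullSpinor f (pullSpinor e Φ) = pullSpinor (e ∘L f) Φ := rfl

theorem pullSpinor_id (Φ : Fin l → Spinor V) :
    pullSpinor (ContinuousLinearMap.id ℝ V) Φ = Φ := rfl

theorem pullS_contract (e : W →L[ℝ] V) (v : W) (φ : Spinor V) :
    pullS e (contract (e v) φ) = contract v (pullS e φ) := by
  funext p
  exact (ContinuousAlternatingMap.curryLeft_compContinuousLinearMap (φ (p + 1)) e v).symm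

theorem pullS_wedge (e : W →L[ℝ] V) (η : V →L[ℝ] ℝ) (φ : Spinor V) :
    pullS e (wedge η φ) = wedge (η ∘L e) (pullS e φ) := by
  ext p w
  cases p with
  | zero => rfl
  | succ p =>
    rw [wedge_succ_apply]
    exact wedge_succ_apply η φ p (fun i => e (w i))

/-- The isomorphism of `V ⊕ V*` with `W ⊕ W*` induced by an isomorphism of `W` with `V`. -/
def pullW (e : W ≃L[ℝ] V) : (V × (V →L[ℝ] ℝ)) →ₗ[ℝ] W × (W →L[ℝ] ℝ) where
  toFun a := (e.symm a.1, a.2 ∘L (e : W →L[ℝ] V))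
  map_add' a b := by ext <;> simp
  map_smul' r a := by ext <;> simp

theorem pullW_pullW_symm (e : W ≃L[ℝ] V) (a : W × (W →L[ℝ] ℝ)) :
    pullW e (pullW e.symm a) = a := by
  ext <;> simp [pullW]

theorem pullS_vectorAction (e : W ≃L[ℝ] V) (a : V × (V →L[ℝ] ℝ)) (φ : Spinor V) :
    pullS (e : W →L[ℝ] V) (vectorAction a φ) = vectorAction (pullW e a) (pullS e φ) := by
  rw [vectorAction_apply, vectorAction_apply, map_add, pullS_wedge]
  congr 1
  rw [← pullS_contract]
  simp [pullW]

theorem pullSpinor_tact (e : W ≃L[ℝ] V) (a : V × (V →L[ℝ] ℝ)) (Φ : Fin l → Spinor V) :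
    pullSpinor (e : W →L[ℝ] V) (tact a Φ) = tact (pullW e a) (pullSpinor e Φ) := by
  ext1 i
  rw [pullSpinor_apply, tact_apply, tact_apply, pullS_vectorAction, pullSpinor_apply]

theorem pullSpinor_word (e : W ≃L[ℝ] V) (ws : List (V × (V →L[ℝ] ℝ))) (Φ : Fin l → Spinor V) :
    pullSpinor (e : W →L[ℝ] V) (word ws Φ) = word (ws.map (pullW e)) (pullSpinor e Φ) := by
  induction ws with
  | nil => rfl
  | cons a ws ih => simp [pullSpinor_tact, ih]

theorem pullSpinor_symm_pullSpinor (e : W ≃L[ℝ] V) (Φ : Fin l → Spinor V) :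
    pullSpinor (e.symm : V →L[ℝ] W) (pullSpinor (e : W →L[ℝ] V) Φ) = Φ := by
  rw [pullSpinor_comp, ContinuousLinearEquiv.coe_comp_coe_symm, pullSpinor_id]

theorem pullSpinor_pullSpinor_symm (e : W ≃L[ℝ] V) (Φ : Fin l → Spinor W) :
    pullSpinor (e : W →L[ℝ] V) (pullSpinor (e.symm : V →L[ℝ] W) Φ) = Φ := by
  rw [pullSpinor_comp, ContinuousLinearEquiv.coe_symm_comp_coe, pullSpinor_id]

theorem pullSpinor_mem_cliff (e : W ≃L[ℝ] V) {φ ψ : Fin l → Spinor V} {k : ℕ}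
    (h : ψ ∈ cliff φ k) : pullSpinor (e : W →L[ℝ] V) ψ ∈ cliff (pullSpinor e φ) k := by
  refine cliff_map_le φ _ k (pullT l e) (fun ws hk hk' => ?_) ⟨ψ, h, rfl⟩
  rw [pullT_apply, pullSpinor_word]
  exact word_mem_cliff _ (by simpa) (by simpa)

/-- The isometry of `V ⊕ V*` with `W ⊕ W*` induced by an isomorphism of `W` with `V`. -/
def pullIsometry (e : W ≃L[ℝ] V) : normSq V →qᵢ normSq W :=
  { pullW e with
    map_app' a := by simp [normSq_apply, pullW] }

theorem pullSpinor_act (e : W ≃L[ℝ] V) (x : CL V) (Φ : Fin l → Spinor V) :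
    pullSpinor (e : W →L[ℝ] V) (act x Φ) =
      act (CliffordAlgebra.map (pullIsometry e) x) (pullSpinor e Φ) := by
  induction x using CliffordAlgebra.induction generalizing Φ with
  | algebraMap r =>
    rw [AlgHom.commutes, Algebra.algebraMap_eq_smul_one, Algebra.algebraMap_eq_smul_one, map_smul,
      map_smul, LinearMap.smul_apply, LinearMap.smul_apply, act_one, act_one]
    rfl
  | ι a => rw [act_ι, pullSpinor_tact, CliffordAlgebra.map_apply_ι, act_ι]; rfl
  | mul x y hx hy => rw [act_mul, hx, hy, map_mul, act_mul]
  | add x y hx hy =>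
    simp only [map_add, LinearMap.add_apply, ← hx, ← hy]
    rfl

theorem involute_map_pullIsometry (e : W ≃L[ℝ] V) (x : CL V) :
    CliffordAlgebra.involute (CliffordAlgebra.map (pullIsometry e) x) =
      CliffordAlgebra.map (pullIsometry e) (CliffordAlgebra.involute x) := by
  induction x using CliffordAlgebra.induction with
  | algebraMap r => simp only [AlgHom.commutes]
  | ι a => simp [CliffordAlgebra.map_apply_ι, CliffordAlgebra.involute_ι]
  | mul x y hx hy => simp only [map_mul, hx, hy]
  | add x y hx hy => simp only [map_add, hx, hy]

theorem map_mem_cpin (e : W ≃L[ℝ] V) {g : (CL V)ˣ} (hg : g ∈ cpin V) :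
    Units.map (CliffordAlgebra.map (pullIsometry e) : CL V →* CL W) g ∈ cpin W := by
  intro a
  obtain ⟨b, hb⟩ := hg (pullW e.symm a)
  refine ⟨pullW e b, ?_⟩
  have h := congrArg (CliffordAlgebra.map (pullIsometry e)) hb
  simp only [map_mul, CliffordAlgebra.map_apply_ι, ← involute_map_pullIsometry] at h
  have ha : pullIsometry e (pullW e.symm a) = a := pullW_pullW_symm e a
  rw [ha] at h
  exact h

theorem mul_mem_cpin {g h : (CL V)ˣ} (hg : g ∈ cpin V) (hh : h ∈ cpin V) : g * h ∈ cpin V := by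
  intro a
  obtain ⟨b, hb⟩ := hg a
  obtain ⟨c, hc⟩ := hh b
  refine ⟨c, ?_⟩
  rw [← hc, ← hb]
  simp only [mul_inv_rev, Units.val_mul, map_mul, mul_assoc]

/-- An isomorphism induces an isometry of `V ⊕ V*`, hence a map of Clifford algebras which preserves
`cpin`; the identification with the model space is composed with it. Thus membership in `𝓑(X)` can
be tested in any chart. -/
theorem pullSpinor_mem_orbit {U : Type*} [NormedAddCommGroup U] [NormedSpace ℝ U]
    {ΦV : Fin l → Spinor U} {φ : Fin l → Spinor V} (e : W ≃L[ℝ] V) (h : φ ∈ orbit ΦV V) :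
    pullSpinor (e : W →L[ℝ] V) φ ∈ orbit ΦV W := by
  obtain ⟨f, g, hg, rfl⟩ := h
  refine ⟨e.trans f, _, map_mem_cpin e hg, ?_⟩
  rw [pullSpinor_act]
  rfl

theorem act_mem_orbit {U : Type*} [NormedAddCommGroup U] [NormedSpace ℝ U]
    {ΦV : Fin l → Spinor U} {φ : Fin l → Spinor V} (h : φ ∈ orbit ΦV V) {g : (CL V)ˣ}
    (hg : g ∈ cpin V) : act (g : CL V) φ ∈ orbit ΦV V := by
  obtain ⟨f, g', hg', rfl⟩ := h
  exact ⟨f, _, mul_mem_cpin hg hg', by rw [Units.val_mul, act_mul]⟩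

/-- If its norm does not vanish, `1 + s a b` lies in the conformal pin group. -/
theorem exists_cpin_one_add_smul (a b : V × (V →L[ℝ] ℝ)) (s : ℝ)
    (hN : 1 + s * (a.2 b.1 + b.2 a.1) + s ^ 2 * (a.2 a.1 * b.2 b.1) ≠ 0) :
    ∃ g ∈ cpin V, ∀ {l : ℕ} (φ : Fin l → Spinor V),
      act (g : CL V) φ = φ + s • tact a (tact b φ) := by
  set N := 1 + s * (a.2 b.1 + b.2 a.1) + s ^ 2 * (a.2 a.1 * b.2 b.1) with hNdef
  have sq : ∀ c : V × (V →L[ℝ] ℝ), CliffordAlgebra.ι (normSq V) c * CliffordAlgebra.ι (normSq V) c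
      = (c.2 c.1) • (1 : CL V) := fun c => by
    rw [CliffordAlgebra.ι_sq_scalar, normSq_apply, Algebra.algebraMap_eq_smul_one]
  have ac : ∀ c d : V × (V →L[ℝ] ℝ),
      CliffordAlgebra.ι (normSq V) c * CliffordAlgebra.ι (normSq V) d =
      (c.2 d.1 + d.2 c.1) • (1 : CL V) -
        CliffordAlgebra.ι (normSq V) d * CliffordAlgebra.ι (normSq V) c := fun c d => by
    rw [eq_sub_iff_add_eq, ι_anticomm, Algebra.algebraMap_eq_smul_one]
  set A := CliffordAlgebra.ι (normSq V) a with hA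
  set B := CliffordAlgebra.ι (normSq V) b with hB
  set σ := a.2 b.1 + b.2 a.1 with hσ
  set α := a.2 a.1
  set β := b.2 b.1
  have hBA : B * A = σ • (1 : CL V) - A * B := by rw [ac b a, add_comm]
  have hABBA : A * B * (B * A) = (α * β) • (1 : CL V) := by
    rw [mul_assoc, ← mul_assoc B, sq b, smul_mul_assoc, one_mul, mul_smul_comm, sq a, smul_smul,
      mul_comm]
  have hBAAB : B * A * (A * B) = (α * β) • (1 : CL V) := by
    rw [mul_assoc, ← mul_assoc A, sq a, smul_mul_assoc, one_mul, mul_smul_comm, sq b, smul_smul]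
  -- The reversed element `1 + s b a` is the inverse up to the scalar `N`, because `ab + ba = σ` and
  -- `(ab)(ba) = a² b²`.
  have e1 : (1 + s • (A * B)) * (1 + s • (B * A)) = N • (1 : CL V) := by
    rw [add_mul, mul_add, mul_add, smul_mul_smul_comm, hABBA, one_mul, one_mul, mul_one, hBA]
    module
  have e2 : (1 + s • (B * A)) * (1 + s • (A * B)) = N • (1 : CL V) := by
    rw [add_mul, mul_add, mul_add, smul_mul_smul_comm, hBAAB, one_mul, one_mul, mul_one, hBA]
    module
  let g : (CL V)ˣ := ⟨1 + s • (A * B), N⁻¹ • (1 + s • (B * A)), by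
      rw [mul_smul_comm, e1, smul_smul, inv_mul_cancel₀ hN, one_smul], by
      rw [smul_mul_assoc, e2, smul_smul, inv_mul_cancel₀ hN, one_smul]⟩
  refine ⟨g, fun c => ?_, fun φ => ?_⟩
  · set C := CliffordAlgebra.ι (normSq V) c with hC
    set κ := a.2 c.1 + c.2 a.1
    set μ := b.2 c.1 + c.2 b.1
    have h1 : B * A * C + C * A * B = κ • B - μ • A + σ • C := by
      have h : B * A * C = κ • B - μ • A + C * (B * A) := by
        rw [mul_assoc, ac a c, mul_sub, mul_smul_comm, mul_one, ← mul_assoc B, ac b c, sub_mul,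
          smul_mul_assoc, one_mul, mul_assoc]
        abel
      rw [h, hBA, mul_sub, mul_smul_comm, mul_one, mul_assoc]
      abel
    have h2 : A * C * A = κ • A - α • C := by
      rw [ac a c, sub_mul, smul_mul_assoc, one_mul, mul_assoc, sq a, mul_smul_comm, mul_one]
    have h3 : B * A * B = σ • B - β • A := by
      rw [hBA, sub_mul, smul_mul_assoc, one_mul, mul_assoc, sq b, mul_smul_comm, mul_one]
    have h4 : B * C * B = μ • B - β • C := by
      rw [ac b c, sub_mul, smul_mul_assoc, one_mul, mul_assoc, sq b, mul_smul_comm, mul_one]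
    have h5 : B * A * C * (A * B) = κ • (σ • B - β • A) - α • (μ • B - β • C) := by
      have : B * A * C * (A * B) = B * (A * C * A) * B := by simp only [mul_assoc]
      rw [this, h2, mul_sub, sub_mul, mul_smul_comm, smul_mul_assoc, h3, mul_smul_comm,
        smul_mul_assoc, h4]
    have hinv : CliffordAlgebra.involute ((g⁻¹ : (CL V)ˣ) : CL V) = N⁻¹ • (1 + s • (B * A)) := by
      change CliffordAlgebra.involute (N⁻¹ • (1 + s • (B * A))) = _
      simp [hA, hB, CliffordAlgebra.involute_ι]
    -- The vector is read off from the expansion of `(1 + s BA) C (1 + s AB)`: `h1` shows that the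
    -- term of order `s` is a vector and `h5` does so for order `s²`. The involution plays no role,
    -- as the element is even.
    refine ⟨N⁻¹ • (c + s • (κ • b - μ • a + σ • c)
      + s ^ 2 • (κ • (σ • b - β • a) - α • (μ • b - β • c))), ?_⟩
    rw [hinv]
    change N⁻¹ • (1 + s • (B * A)) * C * (1 + s • (A * B)) = _
    simp only [map_smul, map_add, map_sub, ← hA, ← hB, ← hC]
    rw [← h1, ← h5]
    simp only [smul_mul_assoc, add_mul, mul_add, one_mul, mul_one, mul_smul_comm, smul_smul,
      ← mul_assoc]
    module
  · change act (1 + s • (A * B)) φ = _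
    rw [map_add, map_smul, LinearMap.add_apply, LinearMap.smul_apply, act_one, act_mul]
    rfl

/-- The conformal pin group contains the non-zero scalars. -/
theorem exists_cpin_smul (r : ℝ) (hr : r ≠ 0) :
    ∃ g ∈ cpin V, ∀ {l : ℕ} (φ : Fin l → Spinor V), act (g : CL V) φ = r • φ := by
  let g : (CL V)ˣ := ⟨r • 1, r⁻¹ • 1, by simp [smul_smul, hr], by simp [smul_smul, hr]⟩
  refine ⟨g, fun c => ⟨c, ?_⟩, fun φ => ?_⟩
  · change CliffordAlgebra.involute (r⁻¹ • (1 : CL V)) * _ * (r • (1 : CL V)) = _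
    simp [smul_smul, hr]
  · change act (r • (1 : CL V)) φ = _
    rw [map_smul, LinearMap.smul_apply, act_one]

end Equivariance

end

section

/-! ### Operators that normalize a subspace up to an involution. -/

section TwistedNormalizer

variable {A : Type*} [Ring A] [Algebra ℝ A]

/-- The invertible elements `g` for which `a ↦ (P g P)⁻¹ a g` and its inverse preserve `W`. -/
def twistedNormalizer (P : A) (W : Submodule ℝ A) : Set A :=
  {g | ∃ g', g * g' = 1 ∧ g' * g = 1 ∧ (∀ a ∈ W, P * g' * P * a * g ∈ W) ∧
    ∀ a ∈ W, P * g * P * a * g' ∈ W}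

theorem mul_mem_twistedNormalizer {P : A} (hP : P * P = 1) {W : Submodule ℝ A} {g h : A}
    (hg : g ∈ twistedNormalizer P W) (hh : h ∈ twistedNormalizer P W) :
    g * h ∈ twistedNormalizer P W := by
  obtain ⟨g', h1, h2, h3, h4⟩ := hg
  obtain ⟨h', k1, k2, k3, k4⟩ := hh
  refine ⟨h' * g', ?_, ?_, fun a ha => ?_, fun a ha => ?_⟩
  · rw [mul_assoc, ← mul_assoc h, k1, one_mul, h1]
  · rw [mul_assoc, ← mul_assoc g', h2, one_mul, k2]
  · have := k3 _ (h3 a ha)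
    have e : P * h' * P * (P * g' * P * a * g) * h = P * (h' * (P * P) * g') * P * a * (g * h) := by
      simp only [mul_assoc]
    rwa [e, hP, mul_one] at this
  · have := h4 _ (k4 a ha)
    have e : P * g * P * (P * h * P * a * h') * g' = P * (g * (P * P) * h) * P * a * (h' * g') := by
      simp only [mul_assoc]
    rwa [e, hP, mul_one] at this

theorem inv_mem_twistedNormalizer {P : A} {W : Submodule ℝ A} {g g' : A}
    (hg : g ∈ twistedNormalizer P W) (hgg' : g * g' = 1) : g' ∈ twistedNormalizer P W := by
  obtain ⟨g'', h1, h2, h3, h4⟩ := hg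
  obtain rfl : g'' = g' := by rw [← mul_one g'', ← hgg', ← mul_assoc, h2, one_mul]
  exact ⟨g, h2, h1, h4, h3⟩

end TwistedNormalizer

/-! ### The parity operator, and finite dimensionality of the spinor space. -/

section FiniteDimension

variable {V : Type*} [NormedAddCommGroup V] [NormedSpace ℝ V]

/-- The parity operator on spinors. -/
def parity : Module.End ℝ (Spinor V) where
  toFun φ p := (-1 : ℝ) ^ p • φ p
  map_add' φ ψ := by funext p; simp
  map_smul' r φ := by funext p; simp [smul_comm r]

theorem parity_apply (φ : Spinor V) (p : ℕ) : parity φ p = (-1 : ℝ) ^ p • φ p := rfl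

theorem parity_mul_parity : (parity : Module.End ℝ (Spinor V)) * parity = 1 := by
  ext1 φ
  funext p
  simp [parity_apply, smul_smul, ← mul_pow]

theorem parity_vectorAction_parity (a : V × (V →L[ℝ] ℝ)) :
    parity * vectorAction a * parity = -vectorAction a := by
  ext φ p w
  cases p with
  | zero => simp [parity_apply, vectorAction_apply, contract, wedge]
  | succ p =>
    have h1 : ((-1 : ℝ) ^ p * (-1) ^ p) = 1 := by rw [← mul_pow]; simp
    have h2 : wedge a.2 (parity φ) (p + 1) w = (-1 : ℝ) ^ p * wedge a.2 φ (p + 1) w := by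
      rw [wedge_succ_apply, wedge_succ_apply, Finset.mul_sum]
      refine Finset.sum_congr rfl fun i _ => ?_
      rw [parity_apply, ContinuousAlternatingMap.smul_apply, smul_eq_mul, mul_left_comm,
        mul_smul_comm]
    have h3 : contract a.1 (parity φ) (p + 1) w = (-1 : ℝ) ^ p * contract a.1 φ (p + 1) w := by
      simp [parity_apply, contract, pow_succ]
    simp only [Module.End.mul_apply, parity_apply, vectorAction_apply, LinearMap.neg_apply,
      Pi.add_apply, Pi.neg_apply, ContinuousAlternatingMap.smul_apply,
      ContinuousAlternatingMap.add_apply, ContinuousAlternatingMap.neg_apply, h2, h3, smul_eq_mul,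
      pow_succ]
    linear_combination (-contract a.1 φ (p + 1) w - wedge a.2 φ (p + 1) w) * h1

/-- Turns the grading involution into a conjugation, so that the condition defining `cpin` makes
sense for operators on spinors, whether or not they come from the Clifford algebra. -/
theorem parity_spin_parity (x : CL V) :
    parity * spin x * parity = spin (CliffordAlgebra.involute x) := by
  induction x using CliffordAlgebra.induction with
  | algebraMap r => simp [Algebra.algebraMap_eq_smul_one, parity_mul_parity]
  | ι a => rw [spin_ι, parity_vectorAction_parity, CliffordAlgebra.involute_ι, map_neg, spin_ι]
  | mul x y hx hy =>
    rw [map_mul, map_mul, map_mul, ← hx, ← hy]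
    have : parity * spin x * parity * (parity * spin y * parity) =
      parity * spin x * (parity * parity) * spin y * parity := by simp only [mul_assoc]
    rw [this, parity_mul_parity, mul_one]
    simp only [mul_assoc]
  | add x y hx hy => simp only [map_add, ← hx, ← hy, mul_add, add_mul]

instance finiteDimensional_forms [FiniteDimensional ℝ V] (p : ℕ) :
    FiniteDimensional ℝ (V [⋀^Fin p]→L[ℝ] ℝ) :=
  Module.Finite.of_injective
    ({ toFun := fun f => f.toMultilinearMap
       map_add' := fun _ _ => rfl
       map_smul' := fun _ _ => rfl } :
      (V [⋀^Fin p]→L[ℝ] ℝ) →ₗ[ℝ] MultilinearMap ℝ (fun _ : Fin p => V) ℝ)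
    fun f g h => by
      ext w
      exact congrArg (fun m : MultilinearMap ℝ (fun _ : Fin p => V) ℝ => m w) h

/-- This is what makes the infinite product `Spinor` finite dimensional. -/
theorem form_eq_zero [FiniteDimensional ℝ V] {p : ℕ} (hp : Module.finrank ℝ V < p)
    (f : V [⋀^Fin p]→L[ℝ] ℝ) : f = 0 := by
  ext w
  refine f.toAlternatingMap.map_linearDependent w fun h => ?_
  have := h.fintype_card_le_finrank
  simp at this
  omega

variable (V) in
/-- Spinors with the vanishing components omitted. -/
abbrev TruncSpinor : Type _ := ∀ p : Fin (Module.finrank ℝ V + 1), V [⋀^Fin (p : ℕ)]→L[ℝ] ℝ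

variable (V) in
/-- Forgetting the vanishing components of a spinor. -/
def trunc [FiniteDimensional ℝ V] : Spinor V ≃ₗ[ℝ] TruncSpinor V where
  toFun φ p := φ p
  map_add' _ _ := rfl
  map_smul' _ _ := rfl
  invFun ψ p := if h : p < Module.finrank ℝ V + 1 then ψ ⟨p, h⟩ else 0
  left_inv φ := by
    funext p
    by_cases h : p < Module.finrank ℝ V + 1
    · simp [h]
    · simp [h, form_eq_zero (show Module.finrank ℝ V < p by omega) (φ p)]
  right_inv ψ := by
    funext p
    exact dif_pos p.2

instance finiteDimensional_spinor [FiniteDimensional ℝ V] : FiniteDimensional ℝ (Spinor V) :=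
  Module.Finite.equiv (trunc V).symm

end FiniteDimension

/-! ### The group of normalizing operators and constancy of the rank on orbits. -/

section SpinorGroup

variable {V : Type*} [NormedAddCommGroup V] [NormedSpace ℝ V] {l : ℕ}

/-- The diagonal action of an operator on tuples. -/
def diag {S : Type*} [AddCommGroup S] [Module ℝ S] (g : Module.End ℝ S) : Module.End ℝ (Fin l → S) :=
  g.compLeft (Fin l)

@[simp] theorem diag_apply {S : Type*} [AddCommGroup S] [Module ℝ S] (g : Module.End ℝ S)
    (φ : Fin l → S) (i : Fin l) : diag g φ i = g (φ i) := rfl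

theorem diag_mul {S : Type*} [AddCommGroup S] [Module ℝ S] (g h : Module.End ℝ S)
    (φ : Fin l → S) : diag (g * h) φ = diag g (diag h φ) := rfl

variable (V) in
/-- The subspace of operators on spinors given by the vectors in `V ⊕ V*`. -/
def vectorOps : Submodule ℝ (Module.End ℝ (Spinor V)) := LinearMap.range vectorAction

variable (V) in
/-- The group of operators on spinors which normalize `V ⊕ V*`. -/
def spinorGroup : Set (Module.End ℝ (Spinor V)) := twistedNormalizer parity (vectorOps V)

/-- The definition of `cpin` asks for one inclusion only. The map `T` is injective and sends the
finite dimensional space `V ⊕ V*` into itself, hence onto itself, so the inclusion holds for the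
inverse as well. -/
theorem cpin_inv [FiniteDimensional ℝ V] {g : (CL V)ˣ} (hg : g ∈ cpin V)
    (a : V × (V →L[ℝ] ℝ)) : ∃ b, CliffordAlgebra.involute (g : CL V) *
      CliffordAlgebra.ι (normSq V) a * (↑g⁻¹ : CL V) = CliffordAlgebra.ι (normSq V) b := by
  let T : CL V →ₗ[ℝ] CL V := LinearMap.mulLeft ℝ (CliffordAlgebra.involute (↑g⁻¹ : CL V)) ∘ₗ
    LinearMap.mulRight ℝ (g : CL V)
  have hT : ∀ x, CliffordAlgebra.involute (g : CL V) * T x * (↑g⁻¹ : CL V) = x := fun x => by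
    have h1 : CliffordAlgebra.involute (g : CL V) * CliffordAlgebra.involute (↑g⁻¹ : CL V) = 1 := by
      rw [← map_mul]; simp
    simp only [T, LinearMap.comp_apply, LinearMap.mulLeft_apply, LinearMap.mulRight_apply]
    rw [← mul_assoc, h1, one_mul, mul_assoc]
    simp
  have hinj : Function.Injective T := fun x y h => by rw [← hT x, h, hT]
  let R := LinearMap.range (CliffordAlgebra.ι (normSq V))
  have hle : R.map T ≤ R := by
    rintro _ ⟨_, ⟨c, rfl⟩, rfl⟩
    obtain ⟨b, hb⟩ := hg c
    exact ⟨b, by rw [← hb]; simp [T, mul_assoc]⟩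
  have heq : R.map T = R := Submodule.eq_of_le_of_finrank_eq hle
    (LinearEquiv.finrank_eq (Submodule.equivMapOfInjective T hinj R)).symm
  have : CliffordAlgebra.ι (normSq V) a ∈ R.map T := by rw [heq]; exact ⟨a, rfl⟩
  obtain ⟨_, ⟨b, rfl⟩, hb⟩ := this
  exact ⟨b, by rw [← hb, hT]⟩

theorem spin_mem_spinorGroup [FiniteDimensional ℝ V] {g : (CL V)ˣ} (hg : g ∈ cpin V) :
    spin (g : CL V) ∈ spinorGroup V := by
  refine ⟨spin (↑g⁻¹ : CL V), by rw [← map_mul]; simp, by rw [← map_mul]; simp, ?_, ?_⟩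
  · rintro _ ⟨a, rfl⟩
    obtain ⟨b, hb⟩ := hg a
    exact ⟨b, by rw [parity_spin_parity, ← spin_ι, ← spin_ι, ← map_mul, ← map_mul, hb]⟩
  · rintro _ ⟨a, rfl⟩
    obtain ⟨b, hb⟩ := cpin_inv hg a
    exact ⟨b, by rw [parity_spin_parity, ← spin_ι, ← spin_ι, ← map_mul, ← map_mul, hb]⟩

theorem parity_pullS_parity (e : V ≃L[ℝ] V) :
    parity * pullS (e : V →L[ℝ] V) * parity = pullS (e : V →L[ℝ] V) := by
  ext φ p w
  have h1 : ((-1 : ℝ) ^ p * (-1) ^ p) = 1 := by rw [← mul_pow]; simp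
  simp [parity_apply, pullS_apply, ← mul_assoc, h1]

/-- Needed because two points of an orbit may use different identifications with the model space;
the normalizer absorbs `GL(V)` together with `Cpin`. -/
theorem pullS_mem_spinorGroup (e : V ≃L[ℝ] V) : pullS (e : V →L[ℝ] V) ∈ spinorGroup V := by
  have h1 : ∀ e : V ≃L[ℝ] V, pullS (e : V →L[ℝ] V) * pullS (e.symm : V →L[ℝ] V) = 1 := fun e => by
    ext φ p w
    simp [pullS_apply, Function.comp_def]
  have h2 : ∀ (e : V ≃L[ℝ] V), ∀ a ∈ vectorOps V,
      parity * pullS (e : V →L[ℝ] V) * parity * a * pullS (e.symm : V →L[ℝ] V) ∈ vectorOps V := by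
    rintro e _ ⟨a, rfl⟩
    refine ⟨pullW e a, ?_⟩
    ext1 φ
    rw [parity_pullS_parity, Module.End.mul_apply, Module.End.mul_apply, pullS_vectorAction,
      ← Module.End.mul_apply (pullS _), h1, Module.End.one_apply]
  exact ⟨pullS (e.symm : V →L[ℝ] V), h1 e, h1 e.symm, h2 e.symm, h2 e⟩

/-- Two elements of the orbit differ by an element of the spinor group. -/
theorem exists_spinorGroup_of_mem_orbit [FiniteDimensional ℝ V] {U : Type*} [NormedAddCommGroup U]
    [NormedSpace ℝ U] {ΦV : Fin l → Spinor U} {φ ψ : Fin l → Spinor V} (hφ : φ ∈ orbit ΦV V)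
    (hψ : ψ ∈ orbit ΦV V) : ∃ g ∈ spinorGroup V, ψ = diag g φ := by
  obtain ⟨e, g, hg, rfl⟩ := hφ
  obtain ⟨f, h, hh, rfl⟩ := hψ
  -- The operator undoes `g`, changes the identification from `e` to `f`, then applies `h`.
  have key := mul_mem_twistedNormalizer parity_mul_parity (spin_mem_spinorGroup hh)
    (mul_mem_twistedNormalizer parity_mul_parity (pullS_mem_spinorGroup (f.trans e.symm))
    (inv_mem_twistedNormalizer (spin_mem_spinorGroup hg)
      (show spin (g : CL V) * spin (↑g⁻¹ : CL V) = 1 by rw [← map_mul]; simp)))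
  refine ⟨_, key, ?_⟩
  rw [diag_mul, diag_mul]
  have h1 : diag (spin (↑g⁻¹ : CL V)) (act (g : CL V) (pullSpinor (e : V →L[ℝ] U) ΦV)) =
      pullSpinor (e : V →L[ℝ] U) ΦV := by
    have : diag (spin (↑g⁻¹ : CL V)) (act (g : CL V) (pullSpinor (e : V →L[ℝ] U) ΦV)) =
      act (↑g⁻¹ : CL V) (act (g : CL V) (pullSpinor (e : V →L[ℝ] U) ΦV)) := rfl
    rw [this, ← act_mul]
    simp [act_one]
  rw [h1]
  have h2 : diag (pullS ((f.trans e.symm : V ≃L[ℝ] V) : V →L[ℝ] V))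
      (pullSpinor (e : V →L[ℝ] U) ΦV) = pullSpinor (f : V →L[ℝ] U) ΦV := by
    have : diag (pullS ((f.trans e.symm : V ≃L[ℝ] V) : V →L[ℝ] V))
      (pullSpinor (e : V →L[ℝ] U) ΦV) = pullSpinor ((f.trans e.symm : V ≃L[ℝ] V) : V →L[ℝ] V)
        (pullSpinor (e : V →L[ℝ] U) ΦV) := rfl
    rw [this, pullSpinor_comp]
    congr 1
    ext v
    change e (e.symm (f v)) = f v
    simp
  rw [h2]
  rfl

/-- A letter `a` passes `g` at the price of becoming another letter and of replacing `g` by its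
conjugate under parity. After the whole word only the parity of its length matters. -/
theorem exists_word_diag {g g' : Module.End ℝ (Spinor V)} (h1 : g * g' = 1)
    (h2 : ∀ a ∈ vectorOps V, parity * g' * parity * a * g ∈ vectorOps V)
    (φ : Fin l → Spinor V) (ws : List (V × (V →L[ℝ] ℝ))) :
    ∃ ws' : List (V × (V →L[ℝ] ℝ)), ws'.length = ws.length ∧ word ws (diag g φ) =
      diag (if ws.length % 2 = 0 then g else parity * g * parity) (word ws' φ) := by
  have hp := parity_mul_parity (V := V)
  have e1 : parity * g * parity * (parity * g' * parity) = 1 := by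
    rw [show parity * g * parity * (parity * g' * parity) =
      parity * (g * (parity * parity) * g') * parity by simp only [mul_assoc], hp, mul_one, h1,
      mul_one, hp]
  have key : ∀ a : V × (V →L[ℝ] ℝ), ∃ b : V × (V →L[ℝ] ℝ),
      vectorAction a * g = parity * g * parity * vectorAction b ∧
      vectorAction a * (parity * g * parity) = g * vectorAction b := by
    intro a
    obtain ⟨b, hb⟩ := h2 _ ⟨a, rfl⟩
    have e2 : vectorAction a * g = parity * g * parity * vectorAction b := by
      rw [hb, show parity * g * parity * (parity * g' * parity * vectorAction a * g) =
        parity * g * parity * (parity * g' * parity) * (vectorAction a * g) by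
          simp only [mul_assoc], e1, one_mul]
    refine ⟨b, e2, ?_⟩
    have e3 : parity * (vectorAction a * g) * parity =
      parity * (parity * g * parity * vectorAction b) * parity := by rw [e2]
    have e4 : parity * (vectorAction a * g) * parity =
        (parity * vectorAction a * parity) * (parity * g * parity) := by
      rw [show (parity * vectorAction a * parity) * (parity * g * parity) =
        parity * (vectorAction a * (parity * parity) * g) * parity by simp only [mul_assoc],
        hp, mul_one]
    have e5 : parity * (parity * g * parity * vectorAction b) * parity =
        (parity * parity) * g * (parity * vectorAction b * parity) := by simp only [mul_assoc]
    rw [e4, e5, hp, one_mul, parity_vectorAction_parity, parity_vectorAction_parity, neg_mul,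
      mul_neg, neg_inj] at e3
    exact e3
  induction ws with
  | nil => exact ⟨[], rfl, rfl⟩
  | cons a ws ih =>
    obtain ⟨ws', hl, hw⟩ := ih
    obtain ⟨b, hb, hb'⟩ := key a
    have tact_eq : ∀ (c : V × (V →L[ℝ] ℝ)) (ψ : Fin l → Spinor V),
      tact c ψ = diag (vectorAction c) ψ := fun c ψ => by ext1 i; rw [tact_apply, diag_apply]
    refine ⟨b :: ws', by simp [hl], ?_⟩
    rw [word_cons, hw, word_cons, tact_eq, tact_eq, ← diag_mul, ← diag_mul, List.length_cons]
    rcases Nat.mod_two_eq_zero_or_one ws.length with h | h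
    · rw [if_pos h, if_neg (by omega), hb]
    · rw [if_neg (by omega), if_pos (by omega), hb']

/-- All words that span `CLᵏ` have the parity of `k`, so by `exists_word_diag` one and the same
operator maps `CLᵏ · φ` onto a space containing `CLᵏ · gφ`. -/
theorem finrank_cliff_diag_le [FiniteDimensional ℝ V] {g : Module.End ℝ (Spinor V)}
    (hg : g ∈ spinorGroup V) (φ : Fin l → Spinor V) (k : ℕ) :
    Module.finrank ℝ (cliff (diag g φ) k) ≤ Module.finrank ℝ (cliff φ k) := by
  obtain ⟨g', h1, -, h2, -⟩ := hg
  refine le_trans (Submodule.finrank_mono (t := (cliff φ k).map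
    (diag (if k % 2 = 0 then g else parity * g * parity))) ?_) (Submodule.finrank_map_le _ _)
  rw [cliff, Submodule.span_le]
  rintro _ ⟨ws, hk, hk', rfl⟩
  obtain ⟨ws', hl, hw⟩ := exists_word_diag h1 h2 φ ws
  rw [hk'] at hw
  exact ⟨word ws' φ, word_mem_cliff φ (by omega) (by omega), hw.symm⟩

/-- The dimension of `CLᵏ · φ` is constant on the orbit. -/
theorem finrank_cliff_eq [FiniteDimensional ℝ V] {U : Type*} [NormedAddCommGroup U]
    [NormedSpace ℝ U] {ΦV : Fin l → Spinor U} {φ ψ : Fin l → Spinor V} (hφ : φ ∈ orbit ΦV V)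
    (hψ : ψ ∈ orbit ΦV V) (k : ℕ) :
    Module.finrank ℝ (cliff φ k) = Module.finrank ℝ (cliff ψ k) := by
  obtain ⟨g, hg, rfl⟩ := exists_spinorGroup_of_mem_orbit hφ hψ
  obtain ⟨h, hh, he⟩ := exists_spinorGroup_of_mem_orbit hψ hφ
  refine le_antisymm ?_ (finrank_cliff_diag_le hg φ k)
  conv_lhs => rw [he]
  exact finrank_cliff_diag_le hh _ k

end SpinorGroup

end

section

/-! ### The vacuum spinor and Schur's lemma. -/

section Vacuum

variable {V : Type*} [NormedAddCommGroup V] [NormedSpace ℝ V]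

variable (V) in
/-- The spinor `1 ∈ Λ⁰ V*`. -/
def vacuum : Spinor V := Pi.single 0 (ContinuousAlternatingMap.constOfIsEmpty ℝ V (Fin 0) 1)

theorem contract_vacuum (v : V) : contract v (vacuum V) = 0 := by
  ext p w
  simp [contract, vacuum]

theorem parity_vacuum : parity (vacuum V) = vacuum V := by
  ext p w
  cases p with
  | zero => simp [parity_apply]
  | succ p => simp [parity_apply, vacuum]

/-- A form of positive degree is determined by its contractions, so only the component of degree `0`
survives. -/
theorem exists_eq_smul_vacuum {φ : Spinor V} (h : ∀ v, contract v φ = 0) :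
    ∃ r : ℝ, φ = r • vacuum V := by
  refine ⟨φ 0 ![], ?_⟩
  ext p w
  cases p with
  | zero =>
    rw [Subsingleton.elim w ![]]
    simp [vacuum]
  | succ p =>
    have := congrArg (fun ψ : Spinor V => ψ p (Fin.tail w)) (h (w 0))
    simp only [contract, ContinuousAlternatingMap.curryLeft_apply_apply] at this
    have hw : Matrix.vecCons (w 0) (Fin.tail w) = w := Fin.cons_self_tail w
    rw [hw] at this
    simp [vacuum, this]

theorem eq_sum_single [FiniteDimensional ℝ V] (φ : Spinor V) :
    φ = ∑ p ∈ Finset.range (Module.finrank ℝ V + 1), Pi.single p (φ p) := by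
  funext q
  rw [Finset.sum_apply]
  by_cases h : q < Module.finrank ℝ V + 1
  · rw [Finset.sum_eq_single_of_mem q (Finset.mem_range.2 h)]
    · simp
    · intro p _ hp
      simp [hp.symm]
  · rw [form_eq_zero (show Module.finrank ℝ V < q by omega) (φ q), Finset.sum_eq_zero]
    intro p hp
    rw [Finset.mem_range] at hp
    rw [Pi.single_eq_of_ne (by omega)]

/-- Euler's identity `∑ eⁱ ∧ i_{eᵢ} f = (p + 1) f` for a form of degree `p + 1`. -/
theorem single_succ_eq [FiniteDimensional ℝ V] (p : ℕ) (f : V [⋀^Fin (p + 1)]→L[ℝ] ℝ) :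
    (Pi.single (p + 1) f : Spinor V) = ((p : ℝ) + 1)⁻¹ •
      ∑ i, wedge (dbas i) (Pi.single p (f.curryLeft (bas V i)) : Spinor V) := by
  have h : f.curryLeft = ∑ i, (dbas i).smulRight (f.curryLeft (bas V i)) := by
    ext1 v
    conv_lhs => rw [← sum_dbas v]
    simp
  have h2 := ContinuousAlternatingMap.alternatizeUncurryFin_curryLeft f
  rw [h, ← ContinuousAlternatingMap.alternatizeUncurryFinCLM_apply, map_sum] at h2
  funext q
  rw [Pi.smul_apply, Finset.sum_apply]
  cases q with
  | zero => simp [wedge]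
  | succ q =>
    by_cases hq : q = p
    · subst hq
      simp only [wedge, Pi.single_eq_same]
      simp only [ContinuousAlternatingMap.alternatizeUncurryFinCLM_apply] at h2
      rw [h2, ← Nat.cast_smul_eq_nsmul ℝ, smul_smul, Nat.cast_add, Nat.cast_one,
        inv_mul_cancel₀ (by positivity), one_smul]
    · have h0 : ∀ i, wedge (dbas i) (Pi.single p (f.curryLeft (bas V i)) : Spinor V) (q + 1) = 0 := by
        intro i
        ext w
        rw [wedge_succ_apply]
        simp [Pi.single_eq_of_ne hq]
      rw [Pi.single_eq_of_ne (by omega), Finset.sum_eq_zero fun i _ => h0 i, smul_zero]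

/-- Spinors are generated by the vacuum under exterior multiplication. -/
theorem eq_zero_of_vacuum [FiniteDimensional ℝ V] (Y : Module.End ℝ (Spinor V))
    (h0 : Y (vacuum V) = 0) (h : ∀ (η : V →L[ℝ] ℝ) (φ : Spinor V), Y φ = 0 → Y (wedge η φ) = 0) :
    Y = 0 := by
  have key : ∀ p (f : V [⋀^Fin p]→L[ℝ] ℝ), Y (Pi.single p f) = 0 := by
    intro p
    induction p with
    | zero =>
      intro f
      have : (Pi.single 0 f : Spinor V) = f ![] • vacuum V := by
        ext p w
        cases p with
        | zero => rw [Subsingleton.elim w ![]]; simp [vacuum]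
        | succ p => simp [vacuum]
      rw [this, map_smul, h0, smul_zero]
    | succ p ih =>
      intro f
      rw [single_succ_eq, map_smul, map_sum, Finset.sum_eq_zero, smul_zero]
      intro i _
      exact h _ _ (ih _)
  ext1 φ
  rw [eq_sum_single φ, map_sum, Finset.sum_eq_zero fun p _ => key p _]
  rfl

theorem vectorAction_left (v : V) (φ : Spinor V) :
    vectorAction (v, (0 : V →L[ℝ] ℝ)) φ = contract v φ := by
  rw [vectorAction_apply]
  have : wedge (0 : V →L[ℝ] ℝ) φ = 0 := by
    ext p w
    cases p with
    | zero => simp [wedge]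
    | succ p => simp [wedge_succ_apply]
  simp [this]

theorem vectorAction_right (η : V →L[ℝ] ℝ) (φ : Spinor V) :
    vectorAction ((0 : V), η) φ = wedge η φ := by
  rw [vectorAction_apply, contract_zero_left, zero_add]

/-- Schur's lemma for the spin representation. -/
theorem exists_eq_smul_one [FiniteDimensional ℝ V] (Z : Module.End ℝ (Spinor V))
    (h : ∀ a, vectorAction a * Z = Z * vectorAction a) : ∃ r : ℝ, Z = r • 1 := by
  have h' : ∀ a φ, vectorAction a (Z φ) = Z (vectorAction a φ) := fun a φ =>
    LinearMap.congr_fun (h a) φ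
  -- `Z` commutes with contractions, so it sends the vacuum to a spinor killed by all contractions.
  -- It is then determined by its value on the vacuum, since it commutes with exterior
  -- multiplication.
  obtain ⟨r, hr⟩ := exists_eq_smul_vacuum (φ := Z (vacuum V)) fun v => by
    rw [← vectorAction_left, h', vectorAction_left, contract_vacuum, map_zero]
  refine ⟨r, sub_eq_zero.1 (eq_zero_of_vacuum _ (by simp [hr]) fun η φ hφ => ?_)⟩
  rw [LinearMap.sub_apply, LinearMap.smul_apply, Module.End.one_apply] at hφ ⊢
  rw [← vectorAction_right, ← h', ← map_smul, ← map_sub, hφ, map_zero]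

/-- As for Schur's lemma, the vacuum goes to a multiple `r` of itself; oddness of `Z` and evenness
of the vacuum force `r = -r`. -/
theorem eq_zero_of_anticomm [FiniteDimensional ℝ V] (Z : Module.End ℝ (Spinor V))
    (h : ∀ a, vectorAction a * Z = -(Z * vectorAction a)) (hodd : parity * Z * parity = -Z) :
    Z = 0 := by
  have h' : ∀ a φ, Z (vectorAction a φ) = - vectorAction a (Z φ) := fun a φ => by
    have := LinearMap.congr_fun (h a) φ
    simp only [Module.End.mul_apply, LinearMap.neg_apply] at this
    rw [this, neg_neg]
  obtain ⟨r, hr⟩ := exists_eq_smul_vacuum (φ := Z (vacuum V)) fun v => by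
    rw [← vectorAction_left, ← neg_inj, ← h', vectorAction_left, contract_vacuum, map_zero,
      neg_zero]
  refine eq_zero_of_vacuum Z ?_ fun η φ hφ => by rw [← vectorAction_right, h', hφ]; simp
  have h1 := LinearMap.congr_fun hodd (vacuum V)
  simp only [Module.End.mul_apply, LinearMap.neg_apply, parity_vacuum, hr, map_smul] at h1
  rw [hr]
  have h2 : (2 : ℝ) • r • vacuum V = 0 := by
    rw [two_smul]
    nth_rewrite 2 [h1]
    exact add_neg_cancel _
  exact (smul_eq_zero.1 h2).resolve_left two_ne_zero

end Vacuum

/-! ### The Lie algebra of the spinor group acts through `CL²`. -/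

section SpinorLieAlgebra

variable {V : Type*} [NormedAddCommGroup V] [NormedSpace ℝ V] [FiniteDimensional ℝ V] {l : ℕ}

omit [FiniteDimensional ℝ V] in
theorem vectorAction_anticomm' (a b : V × (V →L[ℝ] ℝ)) :
    vectorAction a * vectorAction b =
      (a.2 b.1 + b.2 a.1) • (1 : Module.End ℝ (Spinor V)) - vectorAction b * vectorAction a := by
  rw [eq_sub_iff_add_eq]
  ext1 φ
  exact vectorAction_anticomm a b φ

theorem sum_dual_frame (a : V × (V →L[ℝ] ℝ)) :
    ∑ i, (dbas i a.1 • (bas V i, (0 : V →L[ℝ] ℝ)) + a.2 (bas V i) • ((0 : V), dbas i)) = a := by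
  apply Prod.ext
  · simp [Prod.fst_sum, sum_dbas]
  · simp [Prod.snd_sum, sum_dbas_smul]

/-- An operator on spinors whose commutators with vectors are vectors is the sum of a scalar and of
products of two vectors. -/
theorem exists_eq_of_commutator (X : Module.End ℝ (Spinor V))
    (B : V × (V →L[ℝ] ℝ) → V × (V →L[ℝ] ℝ))
    (hB : ∀ a, vectorAction a * X - X * vectorAction a = vectorAction (B a)) :
    ∃ r : ℝ, X = r • 1 + (1 / 2 : ℝ) • ∑ i,
      (vectorAction ((0 : V), dbas i) * vectorAction (B (bas V i, 0)) +
        vectorAction (bas V i, (0 : V →L[ℝ] ℝ)) * vectorAction (B (0, dbas i))) := by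
  let σ : V × (V →L[ℝ] ℝ) → V × (V →L[ℝ] ℝ) → ℝ := fun a b => a.2 b.1 + b.2 a.1
  have ac : ∀ a b, vectorAction a * vectorAction b =
      σ a b • (1 : Module.End ℝ (Spinor V)) - vectorAction b * vectorAction a :=
    vectorAction_anticomm'
  -- `B` is skew for the pairing: `ab + ba` is a scalar, so its commutator with `X` vanishes.
  have skew : ∀ a b, σ a (B b) • (1 : Module.End ℝ (Spinor V)) = -(σ (B a) b) • 1 := by
    intro a b
    have h1 : (σ a b • (1 : Module.End ℝ (Spinor V))) * X - X * (σ a b • 1) = 0 := by simp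
    have h2 : σ a b • (1 : Module.End ℝ (Spinor V)) =
        vectorAction a * vectorAction b + vectorAction b * vectorAction a := by
      rw [ac a b]; abel
    have h3 : σ a (B b) • (1 : Module.End ℝ (Spinor V)) =
        vectorAction a * vectorAction (B b) + vectorAction (B b) * vectorAction a := by
      rw [ac a (B b)]; abel
    have h4 : σ (B a) b • (1 : Module.End ℝ (Spinor V)) =
        vectorAction (B a) * vectorAction b + vectorAction b * vectorAction (B a) := by
      rw [ac (B a) b]; abel
    rw [neg_smul, eq_neg_iff_add_eq_zero, h3, h4, ← hB, ← hB, ← h1, h2]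
    noncomm_ring
  have pair : ∀ a c c', vectorAction a * (vectorAction c * vectorAction (B c')) -
      vectorAction c * vectorAction (B c') * vectorAction a =
      σ a c • vectorAction (B c') + σ (B a) c' • vectorAction c := by
    intro a c c'
    have h1 : vectorAction (B c') * vectorAction a =
        -(σ (B a) c' • (1 : Module.End ℝ (Spinor V))) - vectorAction a * vectorAction (B c') := by
      rw [ac (B c') a, ← neg_smul, ← skew]
      congr 2
      exact add_comm _ _
    rw [← mul_assoc, ac a c, mul_assoc, h1]
    simp only [sub_mul, mul_sub, mul_neg, smul_mul_assoc, mul_smul_comm, one_mul, mul_one,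
      ← mul_assoc]
    abel
  -- Linearity of `B` is not assumed; it holds after applying `vectorAction`, which gives a
  -- commutator with `X`.
  have Badd : ∀ (ι : Type) (s : Finset ι) (r : ι → ℝ) (f : ι → V × (V →L[ℝ] ℝ)),
      ∑ i ∈ s, r i • vectorAction (B (f i)) = vectorAction (B (∑ i ∈ s, r i • f i)) := by
    intro ι s r f
    simp only [← hB, map_sum, map_smul, Finset.sum_mul, Finset.mul_sum, smul_sub,
      Finset.sum_sub_distrib, smul_mul_assoc, mul_smul_comm]
  set Y := ∑ i, (vectorAction ((0 : V), dbas i) * vectorAction (B (bas V i, 0)) +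
        vectorAction (bas V i, (0 : V →L[ℝ] ℝ)) * vectorAction (B (0, dbas i))) with hY
  -- In `[a, Y]` the vector `a` pairs with either factor of each product. The first pairing gives `B
  -- a` by linearity and the second gives `B a` again by skewness. Hence the factor `1/2` in the
  -- statement, and `X - Y/2` commutes with all vectors.
  have hYa : ∀ a, vectorAction a * Y - Y * vectorAction a = (2 : ℝ) • vectorAction (B a) := by
    intro a
    have h1 : vectorAction a * Y - Y * vectorAction a =
        ∑ i, (dbas i a.1 • vectorAction (B (bas V i, 0)) +
          a.2 (bas V i) • vectorAction (B (0, dbas i))) +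
        ∑ i, ((B a).2 (bas V i) • vectorAction ((0 : V), dbas i) +
          dbas i (B a).1 • vectorAction (bas V i, (0 : V →L[ℝ] ℝ))) := by
      rw [hY, Finset.mul_sum, Finset.sum_mul, ← Finset.sum_sub_distrib, ← Finset.sum_add_distrib]
      refine Finset.sum_congr rfl fun i _ => ?_
      rw [mul_add, add_mul, add_sub_add_comm, pair, pair]
      simp only [σ, map_zero, zero_add, add_zero, zero_apply]
      abel
    have h2 : ∑ i, (dbas i a.1 • vectorAction (B (bas V i, 0)) +
          a.2 (bas V i) • vectorAction (B (0, dbas i))) = vectorAction (B a) := by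
      rw [Finset.sum_add_distrib, Badd, Badd]
      simp only [← hB]
      rw [← add_sub_add_comm, ← add_mul, ← mul_add, ← map_add, ← Finset.sum_add_distrib,
        sum_dual_frame]
    have h3 : ∑ i, ((B a).2 (bas V i) • vectorAction ((0 : V), dbas i) +
          dbas i (B a).1 • vectorAction (bas V i, (0 : V →L[ℝ] ℝ))) = vectorAction (B a) := by
      conv_rhs => rw [← sum_dual_frame (B a)]
      rw [map_sum]
      refine Finset.sum_congr rfl fun i _ => ?_
      rw [map_add, map_smul, map_smul, add_comm]
    rw [h1, h2, h3, two_smul]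
  obtain ⟨r, hr⟩ := exists_eq_smul_one (X - (1 / 2 : ℝ) • Y) fun a => by
    have := hYa a
    rw [← sub_eq_zero, mul_sub, sub_mul, mul_smul_comm, smul_mul_assoc, sub_sub_sub_comm, hB,
      ← smul_sub, this, smul_smul]
    norm_num
  exact ⟨r, by rw [← hr]; abel⟩

/-- Once `X` is shown to be even, the hypothesis says that ordinary commutators with vectors are
vectors, and `exists_eq_of_commutator` writes `X` as a scalar plus products of two vectors. -/
theorem diag_mem_cliff_two (X : Module.End ℝ (Spinor V))
    (hX : ∀ a ∈ vectorOps V, a * X - parity * X * parity * a ∈ vectorOps V)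
    (φ : Fin l → Spinor V) : diag X φ ∈ cliff φ 2 := by
  choose B hB using fun a => hX (vectorAction a) ⟨a, rfl⟩
  have hp := parity_mul_parity (V := V)
  set X' := parity * X * parity with hX'
  have hB' : ∀ a, vectorAction a * X' - X * vectorAction a = vectorAction (B a) := fun a => by
    have h1 : parity * vectorAction (B a) * parity =
      parity * (vectorAction a * X - X' * vectorAction a) * parity := by rw [hB]
    have h2 : parity * (vectorAction a * X - X' * vectorAction a) * parity =
        (parity * vectorAction a * parity) * X' - X * (parity * vectorAction a * parity) := by
      rw [hX', mul_sub, sub_mul]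
      congr 1
      · rw [show parity * vectorAction a * parity * (parity * X * parity) =
          parity * vectorAction a * (parity * parity) * X * parity by simp only [mul_assoc], hp]
        simp only [mul_assoc, one_mul]
      · rw [show parity * (parity * X * parity * vectorAction a) * parity =
          (parity * parity) * X * (parity * vectorAction a * parity) by simp only [mul_assoc], hp,
          one_mul]
    rw [h2, parity_vectorAction_parity, parity_vectorAction_parity] at h1
    rw [← neg_inj, h1]
    noncomm_ring
  -- `X` and its parity conjugate have the same twisted commutators, so their difference
  -- anticommutes with all vectors; it is odd, hence zero.
  have hodd : X - X' = 0 := by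
    refine eq_zero_of_anticomm _ (fun a => ?_) ?_
    · have := (hB a).symm.trans (hB' a).symm
      have h3 : vectorAction a * X - vectorAction a * X' = X' * vectorAction a - X * vectorAction a := by
        rw [sub_eq_sub_iff_add_eq_add] at this ⊢
        rw [← sub_eq_zero] at this ⊢
        rw [← this]
        abel
      rw [mul_sub, h3, sub_mul]
      abel
    · rw [hX', mul_sub, sub_mul, show parity * (parity * X * parity) * parity =
        (parity * parity) * X * (parity * parity) by simp only [mul_assoc], hp]
      simp
  have hXX : X' = X := (sub_eq_zero.1 hodd).symm
  rw [hXX] at hB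
  obtain ⟨r, hr⟩ := exists_eq_of_commutator X B fun a => (hB a).symm
  have hd : diag X φ = r • φ + (1 / 2 : ℝ) • ∑ i,
      (tact ((0 : V), dbas i) (tact (B (bas V i, 0)) φ) +
        tact (bas V i, (0 : V →L[ℝ] ℝ)) (tact (B (0, dbas i)) φ)) := by
    ext1 j
    rw [diag_apply, hr]
    simp [tact_apply, Finset.sum_apply]
  have h2 : ∀ a b, tact a (tact b φ) ∈ cliff φ 2 := fun a b =>
    word_mem_cliff φ (ws := [a, b]) (by simp) (by simp)
  rw [hd]
  exact add_mem (Submodule.smul_mem _ _ (cliff_mono φ 0 (self_mem_cliff_zero φ)))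
    (Submodule.smul_mem _ _ (sum_mem fun i _ => add_mem (h2 _ _) (h2 _ _)))

end SpinorLieAlgebra

end

section

open Filter

/-! ### Exponentials and logarithms in closed subalgebras. -/

section ExpSubalgebra

variable {A : Type*} [NormedRing A] [NormedAlgebra ℝ A] [CompleteSpace A]

theorem exp_add_of_commute_real {x y : A} (h : Commute x y) :
    NormedSpace.exp (x + y) = NormedSpace.exp x * NormedSpace.exp y := by
  let : NormedAlgebra ℚ A := NormedAlgebra.restrictScalars ℚ ℝ A
  exact NormedSpace.exp_add_of_commute h

theorem exp_mul_exp_neg (x : A) : NormedSpace.exp x * NormedSpace.exp (-x) = 1 := by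
  rw [← exp_add_of_commute_real (Commute.refl x).neg_right, add_neg_cancel, NormedSpace.exp_zero]

theorem exp_neg_mul_exp (x : A) : NormedSpace.exp (-x) * NormedSpace.exp x = 1 := by
  rw [← exp_add_of_commute_real (Commute.refl x).neg_left, neg_add_cancel, NormedSpace.exp_zero]

theorem exp_conj_involution {P : A} (hP : P * P = 1) (x : A) :
    P * NormedSpace.exp x * P = NormedSpace.exp (P * x * P) := by
  let : NormedAlgebra ℚ A := NormedAlgebra.restrictScalars ℚ ℝ A
  exact (NormedSpace.exp_units_conj (⟨P, P, hP, hP⟩ : Aˣ) x).symm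

/-- Near `0`, the logarithms of elements of a closed subalgebra lie in the subalgebra. -/
theorem eventually_mem_of_exp_mem (B : Subalgebra ℝ A) (hB : IsClosed (B : Set A)) :
    ∀ᶠ x in 𝓝 (0 : A), NormedSpace.exp x ∈ B → x ∈ B := by
  have : CompleteSpace B := hB.completeSpace_coe
  have hA : HasStrictFDerivAt (NormedSpace.exp : A → A)
      ((ContinuousLinearEquiv.refl ℝ A : A ≃L[ℝ] A) : A →L[ℝ] A) 0 := hasStrictFDerivAt_exp_zero
  have hBd : HasStrictFDerivAt (NormedSpace.exp : B → B)
      ((ContinuousLinearEquiv.refl ℝ B : B ≃L[ℝ] B) : B →L[ℝ] B) 0 := hasStrictFDerivAt_exp_zero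
  have hcoe : ∀ b : B, ((NormedSpace.exp b : B) : A) = NormedSpace.exp (b : A) := fun b => by
    let : NormedAlgebra ℚ A := NormedAlgebra.restrictScalars ℚ ℝ A
    let : NormedAlgebra ℚ B := NormedAlgebra.restrictScalars ℚ ℝ B
    exact NormedSpace.map_exp B.val continuous_subtype_val b
  -- Two local logarithms are compared, one in `A` and one in `B`. The logarithm of `exp x` in `B`
  -- is small and has the same exponential in `A`, so local uniqueness in `A` forces it to be `x`.
  have h1 := hA.eventually_left_inverse
  have h2 := hBd.eventually_right_inverse
  have h3 := hBd.localInverse_tendsto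
  rw [NormedSpace.exp_zero] at h2 h3
  have h4 : ∀ᶠ b in 𝓝 (1 : B), hA.localInverse _ _ _
      (NormedSpace.exp (hBd.localInverse _ _ _ b : A)) = (hBd.localInverse _ _ _ b : A) := by
    have : Tendsto (fun b => ((hBd.localInverse _ _ _ b : B) : A)) (𝓝 1) (𝓝 0) :=
      (continuous_subtype_val.tendsto _).comp h3
    exact this.eventually h1
  obtain ⟨U, hU, hU'⟩ := mem_nhds_subtype _ _ _ |>.1 (h2.and h4)
  have h5 : ∀ᶠ x in 𝓝 (0 : A), NormedSpace.exp x ∈ U := by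
    have := hA.continuousAt
    rw [ContinuousAt, NormedSpace.exp_zero] at this
    exact this hU
  filter_upwards [h1, h5] with x hx hxU hxB
  obtain ⟨e1, e2⟩ := hU' (show (⟨_, hxB⟩ : B) ∈ _ from hxU)
  have e3 := congrArg (fun b : B => (b : A)) e1
  simp only [hcoe] at e3
  rw [e3, hx] at e2
  rw [e2]
  exact Subtype.property _

end ExpSubalgebra

/-! ### The Lie algebra of the twisted normalizer and its exponential map. -/

section TwistedLieAlgebra

variable {A : Type*} [NormedRing A] [NormedAlgebra ℝ A] [FiniteDimensional ℝ A]

/-- The Lie algebra of the twisted normalizer. -/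
def twistedLie (P : A) (W : Submodule ℝ A) : Submodule ℝ A where
  carrier := {X | ∀ a ∈ W, a * X - P * X * P * a ∈ W}
  add_mem' {X Y} hX hY a ha := by
    have := add_mem (hX a ha) (hY a ha)
    rwa [show a * X - P * X * P * a + (a * Y - P * Y * P * a) =
      a * (X + Y) - P * (X + Y) * P * a by noncomm_ring] at this
  zero_mem' a ha := by simp
  smul_mem' r X hX a ha := by
    have := W.smul_mem r (hX a ha)
    simpa [smul_sub] using this

/-- The operator `a ↦ a X - P X P a`. -/
def twistedAd (P : A) : A →L[ℝ] A →L[ℝ] A :=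
  (ContinuousLinearMap.mul ℝ A).flip - (ContinuousLinearMap.mul ℝ A) ∘L
    ((ContinuousLinearMap.mul ℝ A P) ∘L ((ContinuousLinearMap.mul ℝ A).flip P))

omit [FiniteDimensional ℝ A] in
theorem twistedAd_apply (P X a : A) : twistedAd P X a = a * X - P * X * P * a := by
  simp [twistedAd, mul_assoc]

theorem exp_mulLeft_apply (X a : A) :
    NormedSpace.exp (ContinuousLinearMap.mul ℝ A X) a = NormedSpace.exp X * a := by
  have : CompleteSpace A := FiniteDimensional.complete ℝ A
  have h1 := (NormedSpace.exp_series_hasSum_exp' (𝕂 := ℝ) (ContinuousLinearMap.mul ℝ A X)).mapL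
    (ContinuousLinearMap.apply ℝ A a)
  have h2 := (NormedSpace.exp_series_hasSum_exp' (𝕂 := ℝ) X).mapL
    ((ContinuousLinearMap.mul ℝ A).flip a)
  have h3 : ∀ n, ((ContinuousLinearMap.mul ℝ A X) ^ n) a = X ^ n * a := fun n => by
    induction n with
    | zero => simp
    | succ n ih => rw [pow_succ', mul_apply_eq_comp, ih, pow_succ', mul_assoc]; rfl
  refine h1.unique (h2.congr_fun fun n => ?_)
  simp [h3]

theorem exp_mulRight_apply (X a : A) :
    NormedSpace.exp ((ContinuousLinearMap.mul ℝ A).flip X) a = a * NormedSpace.exp X := by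
  have : CompleteSpace A := FiniteDimensional.complete ℝ A
  have h1 := (NormedSpace.exp_series_hasSum_exp' (𝕂 := ℝ)
    ((ContinuousLinearMap.mul ℝ A).flip X)).mapL (ContinuousLinearMap.apply ℝ A a)
  have h2 := (NormedSpace.exp_series_hasSum_exp' (𝕂 := ℝ) X).mapL (ContinuousLinearMap.mul ℝ A a)
  have h3 : ∀ n, (((ContinuousLinearMap.mul ℝ A).flip X) ^ n) a = a * X ^ n := fun n => by
    induction n with
    | zero => simp
    | succ n ih => rw [pow_succ', mul_apply_eq_comp, ih, pow_succ, ← mul_assoc]; rfl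
  refine h1.unique (h2.congr_fun fun n => ?_)
  simp [h3]

/-- Right multiplication by `X` and left multiplication by `-PXP` commute, so the exponential of
their sum is the product of the exponentials. -/
theorem exp_twistedAd_apply {P : A} (hP : P * P = 1) (X a : A) :
    NormedSpace.exp (twistedAd P X) a = P * NormedSpace.exp (-X) * P * a * NormedSpace.exp X := by
  have : CompleteSpace A := FiniteDimensional.complete ℝ A
  have h : twistedAd P X = (ContinuousLinearMap.mul ℝ A).flip X +
      ContinuousLinearMap.mul ℝ A (P * (-X) * P) := by
    ext a
    simp [twistedAd_apply, mul_assoc, sub_eq_add_neg]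
  have hc : Commute ((ContinuousLinearMap.mul ℝ A).flip X)
      (ContinuousLinearMap.mul ℝ A (P * (-X) * P)) := by
    ext a
    simp [mul_assoc]
  rw [h, exp_add_of_commute_real hc, mul_apply_eq_comp, exp_mulLeft_apply,
    exp_mulRight_apply, exp_conj_involution hP]

/-- The algebra of operators which preserve a subspace. -/
def stabilizerAlgebra (W : Submodule ℝ A) : Subalgebra ℝ (A →L[ℝ] A) where
  carrier := {T | ∀ a ∈ W, T a ∈ W}
  mul_mem' hS hT a ha := hS _ (hT a ha)
  add_mem' hS hT a ha := add_mem (hS a ha) (hT a ha)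
  algebraMap_mem' r a ha := by
    simpa [Algebra.algebraMap_eq_smul_one] using W.smul_mem r ha

theorem isClosed_stabilizerAlgebra (W : Submodule ℝ A) :
    IsClosed (stabilizerAlgebra W : Set (A →L[ℝ] A)) := by
  have : (stabilizerAlgebra W : Set (A →L[ℝ] A)) =
      ⋂ a ∈ W, (fun T : A →L[ℝ] A => T a) ⁻¹' (W : Set A) := by
    ext T
    simp only [Set.mem_iInter, Set.mem_preimage]
    rfl
  rw [this]
  exact isClosed_biInter fun a _ =>
    W.closed_of_finiteDimensional.preimage (ContinuousLinearMap.apply ℝ A a).continuous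

omit [FiniteDimensional ℝ A] in
theorem mem_twistedLie_iff {P : A} {W : Submodule ℝ A} {X : A} :
    X ∈ twistedLie P W ↔ twistedAd P X ∈ stabilizerAlgebra W := by
  simp only [twistedLie, stabilizerAlgebra, Submodule.mem_mk, AddSubmonoid.mem_mk,
    Subalgebra.mem_mk, ← twistedAd_apply]
  rfl

theorem exp_mem_stabilizerAlgebra {W : Submodule ℝ A} {T : A →L[ℝ] A}
    (hT : T ∈ stabilizerAlgebra W) : NormedSpace.exp T ∈ stabilizerAlgebra W :=
  let : NormedAlgebra ℚ (A →L[ℝ] A) := NormedAlgebra.restrictScalars ℚ ℝ _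
  NormedSpace.exp_mem (R := ℝ) (isClosed_stabilizerAlgebra W) hT

theorem exp_mem_twistedNormalizer {P : A} (hP : P * P = 1) {W : Submodule ℝ A} {X : A}
    (hX : X ∈ twistedLie P W) : NormedSpace.exp X ∈ twistedNormalizer P W := by
  have : CompleteSpace A := FiniteDimensional.complete ℝ A
  refine ⟨NormedSpace.exp (-X), exp_mul_exp_neg X, exp_neg_mul_exp X, fun a ha => ?_,
    fun a ha => ?_⟩
  · rw [← exp_twistedAd_apply hP]
    exact exp_mem_stabilizerAlgebra (mem_twistedLie_iff.1 hX) a ha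
  · have := exp_mem_stabilizerAlgebra (mem_twistedLie_iff.1 ((twistedLie P W).neg_mem hX)) a ha
    rwa [exp_twistedAd_apply hP, neg_neg] at this

/-- If `exp X` normalizes `W`, then `exp (twistedAd P X)` lies in the closed algebra of operators
preserving `W`; for small `X` the logarithm `twistedAd P X` lies there too. -/
theorem eventually_mem_twistedLie {P : A} (hP : P * P = 1) (W : Submodule ℝ A) :
    ∀ᶠ X in 𝓝 (0 : A), NormedSpace.exp X ∈ twistedNormalizer P W → X ∈ twistedLie P W := by
  have : CompleteSpace A := FiniteDimensional.complete ℝ A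
  have h1 : Tendsto (twistedAd P) (𝓝 0) (𝓝 0) := by
    have := (twistedAd P).continuous.tendsto 0
    rwa [map_zero] at this
  filter_upwards [h1.eventually
    (eventually_mem_of_exp_mem (stabilizerAlgebra W) (isClosed_stabilizerAlgebra W))] with X hX hG
  rw [mem_twistedLie_iff]
  refine hX fun a ha => ?_
  obtain ⟨g', h1, h2, h3, -⟩ := hG
  obtain rfl : g' = NormedSpace.exp (-X) := by
    rw [← mul_one g', ← exp_mul_exp_neg X, ← mul_assoc, h2, one_mul]
  rw [exp_twistedAd_apply hP]
  exact h3 a ha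

end TwistedLieAlgebra

end

section

open Filter

/-! ### Tangent directions of orbits by a slice argument. -/

section OrbitSlice

variable {A : Type*} [NormedRing A] [NormedAlgebra ℝ A] [FiniteDimensional ℝ A]
  {M : Type*} [NormedAddCommGroup M] [NormedSpace ℝ M]

/-- The product of exponentials `exp (p X) exp (q X) exp (r X)` for projections with `p + q + r = 1`
is a local diffeomorphism at `0`. -/
theorem hasStrictFDerivAt_exp_mul_exp_mul_exp {p q r : A →L[ℝ] A}
    (h : p + q + r = ContinuousLinearMap.id ℝ A) :
    HasStrictFDerivAt
      (fun X => NormedSpace.exp (p X) * NormedSpace.exp (q X) * NormedSpace.exp (r X))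
      ((ContinuousLinearEquiv.refl ℝ A : A ≃L[ℝ] A) : A →L[ℝ] A) 0 := by
  have : CompleteSpace A := FiniteDimensional.complete ℝ A
  have key : ∀ u : A →L[ℝ] A, HasStrictFDerivAt (fun X => NormedSpace.exp (u X)) u 0 := fun u => by
    have h0 : HasStrictFDerivAt (NormedSpace.exp : A → A) (1 : A →L[ℝ] A) (u 0) := by
      rw [map_zero]
      exact hasStrictFDerivAt_exp_zero
    exact h0.comp 0 u.hasStrictFDerivAt
  have := ((key p).mul' (key q)).mul' (key r)
  refine this.congr_fderiv ?_
  ext X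
  have hX := congrArg (fun T : A →L[ℝ] A => T X) h
  simp [NormedSpace.exp_zero] at hX ⊢
  conv_rhs => rw [← hX]
  abel

/-- If `h → 1` in the twisted normalizer, the limits of the difference quotients of `h · φ` lie in
the image of the Lie algebra. -/
theorem exists_twistedLie_of_tendsto {P : A} (hP : P * P = 1) {W : Submodule ℝ A}
    (ρ : A →L[ℝ] M →L[ℝ] M) (hone : ∀ m, ρ 1 m = m) (hmul : ∀ x y m, ρ (x * y) m = ρ x (ρ y m))
    {ι : Type*} {𝓕 : Filter ι} [NeBot 𝓕] {h : ι → A} (hG : ∀ᶠ i in 𝓕, h i ∈ twistedNormalizer P W)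
    (h1 : Tendsto h 𝓕 (𝓝 1)) {ε : ι → ℝ} {φ w : M}
    (hw : Tendsto (fun i => ε i • (ρ (h i) φ - φ)) 𝓕 (𝓝 w)) :
    ∃ X ∈ twistedLie P W, ρ X φ = w := by
  have : CompleteSpace A := FiniteDimensional.complete ℝ A
  set 𝔤 := twistedLie P W
  let f : A →ₗ[ℝ] M := (ContinuousLinearMap.apply ℝ M φ ∘L ρ : A →L[ℝ] M)
  have hf : ∀ X, f X = ρ X φ := fun X => rfl
  obtain ⟨q, hq⟩ := LinearMap.exists_leftInverse_of_injective 𝔤.subtype (Submodule.ker_subtype _)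
  obtain ⟨r, hr⟩ := LinearMap.exists_leftInverse_of_injective (𝔤 ⊓ LinearMap.ker f).subtype
    (Submodule.ker_subtype _)
  have hq' : ∀ X (hX : X ∈ 𝔤), (q X : A) = X := fun X hX =>
    congrArg Subtype.val (LinearMap.congr_fun hq ⟨X, hX⟩)
  have hr' : ∀ X (hX : X ∈ 𝔤 ⊓ LinearMap.ker f), (r X : A) = X := fun X hX =>
    congrArg Subtype.val (LinearMap.congr_fun hr ⟨X, hX⟩)
  -- The splitting of `A` behind the slice: `pk` projects to the isotropy algebra of `φ` in `𝔤`,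
  -- `pm` to a complement of it inside `𝔤`, and `pn` to a complement of `𝔤`.
  let qA : A →ₗ[ℝ] A := 𝔤.subtype ∘ₗ q
  let pk : A →ₗ[ℝ] A := (𝔤 ⊓ LinearMap.ker f).subtype ∘ₗ r ∘ₗ qA
  let pm : A →ₗ[ℝ] A := qA - pk
  let pn : A →ₗ[ℝ] A := LinearMap.id - qA
  have hqA : ∀ X, qA X ∈ 𝔤 := fun X => (q X).2
  have hqq : ∀ X ∈ 𝔤, qA X = X := hq'
  have hpk : ∀ X, pk X ∈ 𝔤 ⊓ LinearMap.ker f := fun X => (r (qA X)).2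
  have hpm : ∀ X, pm X ∈ 𝔤 := fun X => sub_mem (hqA X) (hpk X).1
  have hpn : ∀ X, pn X ∈ 𝔤 → pn X = 0 := fun X hX => by
    rw [← hqq _ hX]
    simp [pn, hqq _ (hqA X)]
  have hinj : ∀ Y ∈ LinearMap.range pm, f Y = 0 → Y = 0 := by
    rintro _ ⟨X, rfl⟩ hX
    have h2 : (r (pm X) : A) = pm X := hr' _ ⟨hpm X, hX⟩
    have h3 : (r (pm X) : A) = (r (qA X) : A) - r (r (qA X) : A) := by
      simp [pm, pk]
    rw [← h2, h3, hr' _ (r (qA X)).2, sub_self]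
  let PM := LinearMap.toContinuousLinearMap pm
  let PN := LinearMap.toContinuousLinearMap pn
  let PK := LinearMap.toContinuousLinearMap pk
  have hd := hasStrictFDerivAt_exp_mul_exp_mul_exp (p := PM) (q := PN) (r := PK) (by
    ext X; simp [PM, PN, PK, pm, pn])
  set Ψ : A → A := fun X => NormedSpace.exp (PM X) * NormedSpace.exp (PN X) * NormedSpace.exp (PK X)
    with hΨ
  have hΨ0 : Ψ 0 = 1 := by simp [hΨ, NormedSpace.exp_zero]
  have hri := hd.eventually_right_inverse
  have hti := hd.localInverse_tendsto
  rw [hΨ0] at hri hti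
  set x : ι → A := fun i => hd.localInverse _ _ _ (h i) with hx
  have hx0 : Tendsto x 𝓕 (𝓝 0) := hti.comp h1
  have hN0 : Tendsto (fun i => PN (x i)) 𝓕 (𝓝 0) := by
    have := (PN.continuous.tendsto 0).comp hx0
    rwa [map_zero] at this
  have hM0 : Tendsto (fun i => PM (x i)) 𝓕 (𝓝 0) := by
    have := (PM.continuous.tendsto 0).comp hx0
    rwa [map_zero] at this
  -- eventually `h` is a product of an exponential and an element fixing `φ`
  have hfix : ∀ X ∈ 𝔤 ⊓ LinearMap.ker f, ρ (NormedSpace.exp X) φ = φ := by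
    intro X hX
    have hs := (NormedSpace.exp_series_hasSum_exp' (𝕂 := ℝ) X).mapL
      (ContinuousLinearMap.apply ℝ M φ ∘L ρ)
    have h0 : ∀ n ≠ 0, (ContinuousLinearMap.apply ℝ M φ ∘L ρ) (((n.factorial : ℝ)⁻¹) • X ^ n) = 0 := by
      intro n hn
      obtain ⟨m, rfl⟩ := Nat.exists_eq_succ_of_ne_zero hn
      have : ρ X φ = 0 := hX.2
      simp [pow_succ, hmul, this]
    have h2 := hs.unique (hasSum_single 0 h0)
    simpa [hone] using h2
  have hfact : ∀ᶠ i in 𝓕, ρ (h i) φ = ρ (NormedSpace.exp (PM (x i))) φ := by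
    filter_upwards [hG, h1.eventually hri, hN0.eventually (eventually_mem_twistedLie hP W)] with
      i hi1 hi2 hi3
    have e1 : h i = Ψ (x i) := hi2.symm
    have hK : PK (x i) ∈ 𝔤 ⊓ LinearMap.ker f := hpk (x i)
    -- The middle factor is a product of group elements, so its small exponent lies in `𝔤`; as it
    -- also lies in a complement of `𝔤`, it is zero. The last factor fixes `φ`.
    have e2 : NormedSpace.exp (PN (x i)) =
        NormedSpace.exp (-PM (x i)) * (h i * NormedSpace.exp (-PK (x i))) := by
      rw [e1, hΨ]
      simp only [mul_assoc, exp_mul_exp_neg, mul_one]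
      rw [← mul_assoc, exp_neg_mul_exp, one_mul]
    have e3 : PN (x i) = 0 := hpn _ (hi3 (by
      rw [e2]
      exact mul_mem_twistedNormalizer hP
        (exp_mem_twistedNormalizer hP (neg_mem (hpm (x i))))
        (mul_mem_twistedNormalizer hP hi1 (exp_mem_twistedNormalizer hP (neg_mem hK.1)))))
    rw [e1, hΨ]
    simp only [e3, NormedSpace.exp_zero, mul_one]
    rw [hmul, hfix _ hK]
  -- lower bound on the complement of the isotropy algebra
  obtain ⟨K, hK0, hK⟩ : ∃ K : ℝ, 0 < K ∧ ∀ Y ∈ LinearMap.range pm, ‖Y‖ ≤ K * ‖f Y‖ := by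
    obtain ⟨K, hK0, hK⟩ := LinearMap.exists_antilipschitzWith (f.domRestrict (LinearMap.range pm))
      (LinearMap.ker_eq_bot'.2 fun Y hY => Subtype.ext (hinj Y Y.2 hY))
    exact ⟨K, hK0, fun Y hY => by simpa using hK.le_mul_norm (map_zero _) ⟨Y, hY⟩⟩
  set y : ι → A := fun i => PM (x i)
  have ho : (fun X : A => ρ (NormedSpace.exp X) φ - φ - ρ X φ) =o[𝓝 0] fun X : A => X := by
    have hD : HasFDerivAt (fun X : A => ρ (NormedSpace.exp X) φ)
        ((ContinuousLinearMap.apply ℝ M φ ∘L ρ) ∘L (1 : A →L[ℝ] A)) 0 :=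
      (ContinuousLinearMap.hasFDerivAt (ContinuousLinearMap.apply ℝ M φ ∘L ρ)).comp 0
        hasFDerivAt_exp_zero
    have := hD.isLittleO
    simpa [NormedSpace.exp_zero, hone] using this
  have ho' := ho.comp_tendsto hM0
  have hbound : ∀ᶠ i in 𝓕, ‖y i‖ ≤ 2 * K * ‖ρ (h i) φ - φ‖ := by
    -- The constant `(2K)⁻¹` lets the remainder of the first order expansion be absorbed: after
    -- multiplication by `K` it costs only half of `‖y i‖`.
    have := ho'.def (c := (2 * K)⁻¹) (by positivity)
    filter_upwards [this, hfact] with i hi hi'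
    simp only [Function.comp_apply] at hi
    rw [hi']
    have h2 := hK (y i) ⟨x i, rfl⟩
    have h3 : ‖f (y i)‖ ≤ ‖ρ (NormedSpace.exp (y i)) φ - φ‖ + (2 * K)⁻¹ * ‖y i‖ := by
      have : f (y i) = (ρ (NormedSpace.exp (y i)) φ - φ) -
        (ρ (NormedSpace.exp (y i)) φ - φ - ρ (y i) φ) := by rw [hf]; abel
      rw [this]
      exact (norm_sub_le _ _).trans (by gcongr)
    have h4 : K * ‖f (y i)‖ ≤ K * ‖ρ (NormedSpace.exp (y i)) φ - φ‖ + ‖y i‖ / 2 := by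
      refine (mul_le_mul_of_nonneg_left h3 hK0.le).trans (le_of_eq ?_)
      field_simp
    linarith
  -- By `hbound` an error `o(y)` is also `o(hφ - φ)`, so `ε y` applied to `φ` has the limit `w`.
  -- Convergence of `ε y` itself is not needed, since the image of `𝔤` is closed.
  have hlim : Tendsto (fun i => f (ε i • y i)) 𝓕 (𝓝 w) := by
    have hz : Tendsto (fun i => ε i • (ρ (h i) φ - φ) - f (ε i • y i)) 𝓕 (𝓝 0) := by
      have hO : (fun i => ε i • (ρ (h i) φ - φ) - f (ε i • y i)) =o[𝓕]
          fun i => ε i • (ρ (h i) φ - φ) := by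
        have e1 : (fun i => ε i • (ρ (h i) φ - φ) - f (ε i • y i)) =ᶠ[𝓕]
            fun i => ε i • (ρ (NormedSpace.exp (y i)) φ - φ - ρ (y i) φ) := by
          filter_upwards [hfact] with i hi
          rw [hi, map_smul, hf, ← smul_sub]
        refine e1.trans_isLittleO ?_
        have e2 : (fun i => ε i • y i) =O[𝓕] fun i => ε i • (ρ (h i) φ - φ) :=
          (Asymptotics.isBigO_refl ε 𝓕).smul (Asymptotics.IsBigO.of_bound _ hbound)
        exact ((Asymptotics.isBigO_refl ε 𝓕).smul_isLittleO ho').trans_isBigO e2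
      exact (hO.trans_isBigO (hw.isBigO_one ℝ)).tendsto_zero_of_tendsto tendsto_const_nhds
    simpa using hw.sub hz
  have hclosed : IsClosed ((𝔤.map f : Submodule ℝ M) : Set M) :=
    (𝔤.map f).closed_of_finiteDimensional
  obtain ⟨X, hX, hXw⟩ := hclosed.mem_of_tendsto hlim
    (Eventually.of_forall fun i => ⟨ε i • y i, 𝔤.smul_mem _ (hpm _), rfl⟩)
  exact ⟨X, hX, hXw⟩

end OrbitSlice

/-! ### Isolated points of graphs. -/

section Accumulation

/-- For all but countably many `t`, the point `(t, g t)` of the graph of `g` is not isolated. -/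
theorem countable_setOf_isolated {Z : Type*} [TopologicalSpace Z] [SecondCountableTopology Z]
    (g : ℝ → Z) : {t | ¬ NeBot (𝓝[≠] t ⊓ comap g (𝓝 (g t)))}.Countable := by
  let b := TopologicalSpace.countableBasis (ℝ × Z)
  -- An isolated point of the graph has a basic neighbourhood that meets the graph only there; this
  -- injects the exceptional times into a countable basis.
  have key : ∀ t ∈ {t | ¬ NeBot (𝓝[≠] t ⊓ comap g (𝓝 (g t)))}, ∃ U ∈ b, (t, g t) ∈ U ∧
      ∀ s, (s, g s) ∈ U → s = t := by
    intro t ht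
    have h1 : comap (fun s => (s, g s)) (𝓝 (t, g t)) ⊓ 𝓟 {t}ᶜ = ⊥ := by
      rw [nhds_prod_eq, Filter.comap_prod]
      have e : comap (Prod.fst ∘ fun s => (s, g s)) (𝓝 t) = 𝓝 t := comap_id
      rw [e, inf_right_comm]
      exact Filter.not_neBot.1 ht
    rw [Filter.inf_principal_eq_bot, compl_compl] at h1
    obtain ⟨V, hV, hVt⟩ := Filter.mem_comap.1 h1
    obtain ⟨U, hU, htU, hUV⟩ := (TopologicalSpace.isBasis_countableBasis _).mem_nhds_iff.1 hV
    exact ⟨U, hU, htU, fun s hs => hVt (hUV hs)⟩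
  choose! U hU hU' hU'' using key
  refine Set.MapsTo.countable_of_injOn (f := U) (t := b) (fun t ht => hU t ht) ?_
    (TopologicalSpace.countable_countableBasis _)
  intro s hs t ht hst
  exact hU'' t ht s (hst ▸ hU' s hs)

end Accumulation

end

section

open Filter

/-! ### Calculus for tuples of spinors after truncation. -/

section TruncTuple

variable {E : Type*} [NormedAddCommGroup E] [NormedSpace ℝ E] [FiniteDimensional ℝ E] {l : ℕ}

variable (E l) in
/-- Tuples of spinors, with the vanishing components omitted. -/
def truncT : (Fin l → Spinor E) ≃ₗ[ℝ] (Fin l → TruncSpinor E) :=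
  LinearEquiv.piCongrRight fun _ => trunc E

theorem truncT_apply (φ : Fin l → Spinor E) (i : Fin l) (p : Fin (Module.finrank ℝ E + 1)) :
    truncT E l φ i p = φ i p := rfl

theorem contDiffWithinAt_truncT {H : Type*} [NormedAddCommGroup H] [NormedSpace ℝ H]
    {c : H → Fin l → Spinor E} {s : Set H} {y : H} {n : WithTop ℕ∞} :
    ContDiffWithinAt ℝ n (fun y => truncT E l (c y)) s y ↔
      ∀ i p, ContDiffWithinAt ℝ n (fun y => c y i p) s y := by
  simp only [contDiffWithinAt_pi, truncT_apply]
  refine ⟨fun h i p => ?_, fun h i p => h i p⟩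
  by_cases hp : p < Module.finrank ℝ E + 1
  · exact h i ⟨p, hp⟩
  · have : (fun y => c y i p) = fun _ => 0 := by
      funext y
      exact form_eq_zero (by omega) _
    rw [this]
    exact contDiffWithinAt_const

theorem contDiffAt_truncT {H : Type*} [NormedAddCommGroup H] [NormedSpace ℝ H]
    {c : H → Fin l → Spinor E} {y : H} {n : WithTop ℕ∞} :
    ContDiffAt ℝ n (fun y => truncT E l (c y)) y ↔ ∀ i p, ContDiffAt ℝ n (fun y => c y i p) y := by
  simp only [← contDiffWithinAt_univ, contDiffWithinAt_truncT]

theorem continuousAt_truncT {H : Type*} [TopologicalSpace H]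
    {c : H → Fin l → Spinor E} {y : H} (h : ∀ i p, ContinuousAt (fun y => c y i p) y) :
    ContinuousAt (fun y => truncT E l (c y)) y :=
  continuousAt_pi.2 fun i => continuousAt_pi.2 fun p => h i p

theorem hasDerivAt_truncT {c : ℝ → Fin l → Spinor E} {c' : Fin l → Spinor E} {t : ℝ}
    (h : ∀ i p, HasDerivAt (fun s => c s i p) (c' i p) t) :
    HasDerivAt (fun s => truncT E l (c s)) (truncT E l c') t :=
  hasDerivAt_pi.2 fun i => hasDerivAt_pi.2 fun p => h i p

/-- The infinite product `Spinor` has no norm; conjugated with truncation, any linear operator acts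
on a finite dimensional normed space and is smooth. -/
theorem ContDiffWithinAt.linear_tuple {H : Type*} [NormedAddCommGroup H] [NormedSpace ℝ H]
    {c : H → Fin l → Spinor E} {s : Set H} {y : H} {n : WithTop ℕ∞}
    (h : ∀ i p, ContDiffWithinAt ℝ n (fun y => c y i p) s y) (T : Module.End ℝ (Fin l → Spinor E))
    (i : Fin l) (p : ℕ) : ContDiffWithinAt ℝ n (fun y => T (c y) i p) s y := by
  revert i p
  rw [← contDiffWithinAt_truncT] at h ⊢
  let L := LinearMap.toContinuousLinearMap ((truncT E l).toLinearMap ∘ₗ T ∘ₗ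
    (truncT E l).symm.toLinearMap)
  have := L.contDiff.contDiffAt.comp_contDiffWithinAt y h
  refine this.congr_of_eventuallyEq (Eventually.of_forall fun z => ?_) ?_ <;> simp [L]

theorem ContinuousAt.linear_tuple {H : Type*} [TopologicalSpace H]
    {c : H → Fin l → Spinor E} {y : H} (h : ∀ i p, ContinuousAt (fun y => c y i p) y)
    (T : Module.End ℝ (Fin l → Spinor E)) :
    ContinuousAt (fun y => truncT E l (T (c y))) y := by
  let L := LinearMap.toContinuousLinearMap ((truncT E l).toLinearMap ∘ₗ T ∘ₗ
    (truncT E l).symm.toLinearMap)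
  have := L.continuous.continuousAt.comp (continuousAt_truncT h)
  refine this.congr (Eventually.of_forall fun z => ?_)
  simp [L]

theorem LinearIndependent.eventually_tuple {ι H : Type*} [Finite ι] [TopologicalSpace H]
    {v : ι → H → Fin l → Spinor E} {y : H}
    (hv : ∀ j, ContinuousAt (fun z => truncT E l (v j z)) y)
    (h : LinearIndependent ℝ fun j => v j y) : ∀ᶠ z in 𝓝 y, LinearIndependent ℝ fun j => v j z := by
  have h1 : ∀ z, LinearIndependent ℝ (fun j => v j z) ↔
      LinearIndependent ℝ (fun j => truncT E l (v j z)) := fun z =>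
    ((truncT E l).toLinearMap.linearIndependent_iff (LinearEquiv.ker _)).symm
  simp only [h1] at h ⊢
  have h2 : ContinuousAt (fun z j => truncT E l (v j z)) y := continuousAt_pi.2 hv
  exact h2.eventually (isOpen_setOfPred_linearIndependent.mem_nhds h)

/-- A basis of `CLᵏ · φ` which consists of words. -/
theorem exists_word_basis (φ : Fin l → Spinor E) (k : ℕ) :
    ∃ ws : Fin (Module.finrank ℝ (cliff φ k)) → List (E × (E →L[ℝ] ℝ)),
      (∀ j, (ws j).length ≤ k ∧ (ws j).length % 2 = k % 2) ∧
      LinearIndependent ℝ fun j => word (ws j) φ := by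
  obtain ⟨f, hf, -, hli⟩ := Submodule.exists_fun_fin_finrank_span_eq ℝ
    {ψ | ∃ ws : List (E × (E →L[ℝ] ℝ)), ws.length ≤ k ∧ ws.length % 2 = k % 2 ∧ word ws φ = ψ}
  choose ws h1 h2 h3 using hf
  refine ⟨ws, fun j => ⟨h1 j, h2 j⟩, ?_⟩
  have h4 : f = fun j => word (ws j) φ := (funext h3).symm
  exact h4 ▸ hli

/-- A count of dimensions, to be used with words chosen at another point of the orbit, where the
rank is the same. -/
theorem span_word_basis {φ : Fin l → Spinor E} {k r : ℕ} (hr : Module.finrank ℝ (cliff φ k) = r)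
    {ws : Fin r → List (E × (E →L[ℝ] ℝ))}
    (hws : ∀ j, (ws j).length ≤ k ∧ (ws j).length % 2 = k % 2)
    (hli : LinearIndependent ℝ fun j => word (ws j) φ) :
    Submodule.span ℝ (Set.range fun j => word (ws j) φ) = cliff φ k := by
  refine Submodule.eq_of_le_of_finrank_eq ?_ ?_
  · rw [Submodule.span_le]
    rintro _ ⟨j, rfl⟩
    exact word_mem_cliff φ (hws j).1 (hws j).2
  · rw [hr, finrank_span_eq_card hli, Fintype.card_fin]

end TruncTuple

/-! ### Velocities of curves in an orbit. -/

section OrbitTangent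

variable {E : Type*} [NormedAddCommGroup E] [NormedSpace ℝ E] [FiniteDimensional ℝ E] {l : ℕ}
  {U : Type*} [NormedAddCommGroup U] [NormedSpace ℝ U] {ΦV : Fin l → Spinor U}

variable (E) in
/-- Operators on spinors as continuous operators on truncated spinors. -/
def opEquiv : Module.End ℝ (Spinor E) ≃ₐ[ℝ] (TruncSpinor E →L[ℝ] TruncSpinor E) :=
  ((trunc E).conjAlgEquiv ℝ).trans (Module.End.toContinuousLinearMap (TruncSpinor E))

theorem opEquiv_apply (X : Module.End ℝ (Spinor E)) (φ : Spinor E) :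
    opEquiv E X (trunc E φ) = trunc E (X φ) := by
  change trunc E (X ((trunc E).symm (trunc E φ))) = _
  rw [LinearEquiv.symm_apply_apply]

variable (E l) in
/-- The diagonal action of operators on tuples. -/
def diagL : (TruncSpinor E →L[ℝ] TruncSpinor E) →L[ℝ]
    (Fin l → TruncSpinor E) →L[ℝ] (Fin l → TruncSpinor E) :=
  LinearMap.toContinuousLinearMap
    { toFun := fun X => ContinuousLinearMap.pi fun i => X ∘L ContinuousLinearMap.proj i
      map_add' := fun _ _ => rfl
      map_smul' := fun _ _ => rfl }

theorem diagL_opEquiv (X : Module.End ℝ (Spinor E)) (φ : Fin l → Spinor E) :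
    diagL E l (opEquiv E X) (truncT E l φ) = truncT E l (diag X φ) := by
  funext i
  exact opEquiv_apply X (φ i)

theorem opEquiv_mem_twistedNormalizer {g : Module.End ℝ (Spinor E)} (hg : g ∈ spinorGroup E) :
    opEquiv E g ∈ twistedNormalizer (opEquiv E parity)
      ((vectorOps E).map (opEquiv E).toLinearMap) := by
  obtain ⟨g', h1, h2, h3, h4⟩ := hg
  refine ⟨opEquiv E g', by rw [← map_mul, h1, map_one], by rw [← map_mul, h2, map_one], ?_, ?_⟩
  · rintro _ ⟨a, ha, rfl⟩
    exact ⟨_, h3 a ha, by simp⟩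
  · rintro _ ⟨a, ha, rfl⟩
    exact ⟨_, h4 a ha, by simp⟩

/-- The velocities of a differentiable curve in the orbit are tangent to it for almost all times. -/
theorem countable_setOf_deriv_notMem {J : Set ℝ} (hJ : IsOpen J) {c c' : ℝ → Fin l → Spinor E}
    (hc : ∀ t ∈ J, c t ∈ orbit ΦV E)
    (hd : ∀ t ∈ J, ∀ i p, HasDerivAt (fun s => c s i p) (c' t i p) t) :
    {t ∈ J | c' t ∉ cliff (c t) 2}.Countable := by
  rcases J.eq_empty_or_nonempty with rfl | ⟨t₀, ht₀⟩
  · simp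
  have hex : ∀ t, ∃ g, t ∈ J → g ∈ spinorGroup E ∧ c t = diag g (c t₀) := fun t => by
    by_cases ht : t ∈ J
    · obtain ⟨g, hg, hg'⟩ := exists_spinorGroup_of_mem_orbit (hc t₀ ht₀) (hc t ht)
      exact ⟨g, fun _ => ⟨hg, hg'⟩⟩
    · exact ⟨0, fun h => absurd h ht⟩
  choose g hg using hex
  -- At every other time `t` there are `s → t` with `g s → g t`, whence `g s (g t)⁻¹ → 1`, although
  -- `g` was chosen without regard to continuity.
  refine (countable_setOf_isolated fun t => opEquiv E (g t)).mono ?_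
  rintro t ⟨ht, ht'⟩ hne
  refine ht' ?_
  set 𝓕 := 𝓝[≠] t ⊓ comap (fun t => opEquiv E (g t)) (𝓝 (opEquiv E (g t)))
  obtain ⟨g', hg1, hg2, hg3, hg4⟩ := (hg t ht).1
  have hg' : g' ∈ spinorGroup E := ⟨g t, hg2, hg1, hg4, hg3⟩
  have hlim : Tendsto (fun s => opEquiv E (g s * g')) 𝓕 (𝓝 1) := by
    have h1 : Tendsto (fun t => opEquiv E (g t)) 𝓕 (𝓝 (opEquiv E (g t))) :=
      tendsto_comap.mono_left inf_le_right
    have h2 := h1.mul_const (opEquiv E g')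
    simp only [← map_mul, hg1, map_one] at h2
    exact h2
  have hJ𝓕 : ∀ᶠ s in 𝓕, s ∈ J :=
    (nhdsWithin_le_nhds.trans' inf_le_left : 𝓕 ≤ 𝓝 t) (hJ.mem_nhds ht)
  have hcs : ∀ s ∈ J, c s = diag (g s * g') (c t) := fun s hs => by
    have h1 : diag g' (c t) = c t₀ := by
      rw [(hg t ht).2, ← diag_mul, hg2]
      rfl
    rw [diag_mul, h1, (hg s hs).2]
  have hw : Tendsto (fun s => (s - t)⁻¹ •
      (diagL E l (opEquiv E (g s * g')) (truncT E l (c t)) - truncT E l (c t))) 𝓕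
      (𝓝 (truncT E l (c' t))) := by
    have h1 := (hasDerivAt_iff_tendsto_slope.1 (hasDerivAt_truncT (hd t ht))).mono_left
      (inf_le_left : 𝓕 ≤ _)
    refine h1.congr' ?_
    filter_upwards [hJ𝓕] with s hs
    rw [diagL_opEquiv, ← hcs s hs, slope_def_module]
  have hone : ∀ m, diagL E l 1 m = m := fun m => rfl
  have hmul : ∀ x y m, diagL E l (x * y) m = diagL E l x (diagL E l y m) := fun x y m => rfl
  obtain ⟨X, hX, hXw⟩ := exists_twistedLie_of_tendsto
    (P := opEquiv E parity) (by rw [← map_mul, parity_mul_parity, map_one])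
    (diagL E l) hone hmul (hJ𝓕.mono fun s hs => opEquiv_mem_twistedNormalizer
      (mul_mem_twistedNormalizer parity_mul_parity (hg s hs).1 hg')) hlim hw
  obtain ⟨Y, rfl⟩ := (opEquiv E).surjective X
  rw [diagL_opEquiv] at hXw
  rw [← (truncT E l).injective hXw]
  refine diag_mem_cliff_two Y (fun a ha => ?_) (c t)
  obtain ⟨b, hb, hb'⟩ := hX _ ⟨a, ha, rfl⟩
  have : b = a * Y - parity * Y * parity * a := (opEquiv E).injective (by simpa using hb')
  rwa [← this]

/-- The velocity of a curve in the orbit is tangent to it. -/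
theorem deriv_mem_cliff_two {J : Set ℝ} (hJ : IsOpen J) {c c' : ℝ → Fin l → Spinor E}
    (hc : ∀ t ∈ J, c t ∈ orbit ΦV E)
    (hd : ∀ t ∈ J, ∀ i p, HasDerivAt (fun s => c s i p) (c' t i p) t) {t₀ : ℝ} (ht₀ : t₀ ∈ J)
    (hc' : ∀ i p, ContinuousAt (fun t => c' t i p) t₀) : c' t₀ ∈ cliff (c t₀) 2 := by
  by_contra hne
  obtain ⟨ws, hws, hli⟩ := exists_word_basis (c t₀) 2
  -- A velocity outside `CL² · c t₀` together with a word basis gives more independent vectors than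
  -- the rank. They stay independent near `t₀`, but all of them lie in `CL² · c t` for a dense set
  -- of times `t`, where the rank is the same.
  let v : Option (Fin (Module.finrank ℝ (cliff (c t₀) 2))) → ℝ → Fin l → Spinor E :=
    fun o t => Option.casesOn' o (c' t) fun j => word (ws j) (c t)
  have hv : LinearIndependent ℝ fun o => v o t₀ := by
    refine linearIndependent_option'.2 ⟨hli, ?_⟩
    rwa [span_word_basis rfl hws hli]
  have hcont : ∀ o, ContinuousAt (fun t => truncT E l (v o t)) t₀ := by
    rintro (_ | j)
    · exact continuousAt_truncT hc'
    · exact ContinuousAt.linear_tuple (fun i p => (hd t₀ ht₀ i p).continuousAt) _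
  have hev := LinearIndependent.eventually_tuple hcont hv
  obtain ⟨t, ht', ht, htJ⟩ :=
    ((countable_setOf_deriv_notMem hJ hc hd).dense_compl ℝ).inter_nhds_nonempty (hev.and (hJ.mem_nhds ht₀))
  have htc : c' t ∈ cliff (c t) 2 := by
    by_contra h
    exact ht' ⟨htJ, h⟩
  have hmem : ∀ o, v o t ∈ cliff (c t) 2 := by
    rintro (_ | j)
    · exact htc
    · exact word_mem_cliff _ (hws j).1 (hws j).2
  have hli' : LinearIndependent ℝ fun o => (⟨v o t, hmem o⟩ : cliff (c t) 2) :=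
    LinearIndependent.of_comp (cliff (c t) 2).subtype ht
  have := hli'.fintype_card_le_finrank
  rw [Fintype.card_option, Fintype.card_fin, finrank_cliff_eq (hc t₀ ht₀) (hc t htJ)] at this
  omega

end OrbitTangent

end

section

open Filter Set

/-! ### Smoothness of maps with values in forms. -/

section FormCalculus

variable {E : Type*} [NormedAddCommGroup E] [NormedSpace ℝ E] [FiniteDimensional ℝ E]
  {H : Type*} [NormedAddCommGroup H] [NormedSpace ℝ H]

/-- Smoothness of a map with values in forms can be tested on vectors. -/
theorem contDiffWithinAt_form {p : ℕ} {α : H → E [⋀^Fin p]→L[ℝ] ℝ} {s : Set H} {y : H}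
    {n : WithTop ℕ∞} (h : ∀ w : Fin p → E, ContDiffWithinAt ℝ n (fun q => α q w) s y) :
    ContDiffWithinAt ℝ n α s y := by
  let b := Module.finBasis ℝ E
  let ev : (E [⋀^Fin p]→L[ℝ] ℝ) →ₗ[ℝ] ((Fin p → Fin (Module.finrank ℝ E)) → ℝ) :=
    { toFun := fun f j => f fun i => b (j i)
      map_add' := fun _ _ => rfl
      map_smul' := fun _ _ => rfl }
  have hinj : LinearMap.ker ev = ⊥ := by
    rw [LinearMap.ker_eq_bot']
    intro f hf
    have : (f.toAlternatingMap : E [⋀^Fin p]→ₗ[ℝ] ℝ) = 0 := by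
      refine Module.Basis.ext_alternating b fun v _ => ?_
      exact congrFun hf v
    ext w
    exact congrArg (fun g : E [⋀^Fin p]→ₗ[ℝ] ℝ => g w) this
  obtain ⟨r, hr⟩ := LinearMap.exists_leftInverse_of_injective ev hinj
  have h1 : ContDiffWithinAt ℝ n (fun q => LinearMap.toContinuousLinearMap r (ev (α q))) s y :=
    (LinearMap.toContinuousLinearMap r).contDiff.contDiffAt.comp_contDiffWithinAt y
      (contDiffWithinAt_pi.2 fun j => h _)
  refine h1.congr_of_eventuallyEq (Eventually.of_forall fun q => ?_) ?_ <;>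
  exact (LinearMap.congr_fun hr _).symm

theorem ContDiffWithinAt.form_comp {p : ℕ} {α : H → E [⋀^Fin p]→L[ℝ] ℝ} {L : H → E →L[ℝ] E}
    {s : Set H} {y : H} {n : WithTop ℕ∞} (hα : ContDiffWithinAt ℝ n α s y)
    (hL : ContDiffWithinAt ℝ n L s y) :
    ContDiffWithinAt ℝ n (fun q => (α q).compContinuousLinearMap (L q)) s y := by
  refine contDiffWithinAt_form fun w => ?_
  have h1 : ContDiffWithinAt ℝ n (fun q => (α q).toContinuousMultilinearMap) s y :=
    (ContinuousAlternatingMap.toContinuousMultilinearMapCLM (𝕜 := ℝ) (E := E) (F := ℝ)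
      (ι := Fin p) ℝ).contDiff.contDiffAt.comp_contDiffWithinAt y hα
  have h2 := (ContinuousMultilinearMap.analyticAt_uncurry_compContinuousLinearMap (𝕜 := ℝ)
    (Fm := fun _ : Fin p => E) (Em := fun _ => E) (G := ℝ)
    (q := (fun _ => L y, (α y).toContinuousMultilinearMap))).contDiffAt (n := n)
  have h3 := h2.comp_contDiffWithinAt y ((contDiffWithinAt_pi.2 fun _ => hL).prodMk h1)
  have h4 := (ContinuousMultilinearMap.apply ℝ (fun _ : Fin p => E) ℝ
    w).contDiff.contDiffAt.comp_contDiffWithinAt y h3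
  exact h4

end FormCalculus

/-! ### Forms in charts and their transformation. -/

section Charts

variable {E : Type*} [NormedAddCommGroup E] [NormedSpace ℝ E]
  {X : Type*} [TopologicalSpace X] [ChartedSpace E X] {l : ℕ}
  {Y : Type*} [TopologicalSpace Y] [ChartedSpace E Y]
  {Z : Type*} [TopologicalSpace Z] [ChartedSpace E Z]

variable (E) in
/-- The derivative of a map, as a linear map between the model spaces. -/
def mder (f : X → Y) (x : X) : E →L[ℝ] E := mfderiv 𝓘(ℝ, E) 𝓘(ℝ, E) f x

theorem mder_comp {f : X → Y} {g : Y → Z} (x : X)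
    (hg : MDifferentiableAt 𝓘(ℝ, E) 𝓘(ℝ, E) g (f x))
    (hf : MDifferentiableAt 𝓘(ℝ, E) 𝓘(ℝ, E) f x) : mder E (g ∘ f) x = mder E g (f x) ∘L mder E f x :=
  mfderiv_comp x hg hf

theorem mder_eq_fderiv (f : E → E) (y : E) : mder E f y = fderiv ℝ f y := mfderiv_eq_fderiv

theorem pullback_eq (f : X → Y) {p : ℕ} (α : Y → E [⋀^Fin p]→L[ℝ] ℝ) (x : X) :
    pullback f α x = (α (f x)).compContinuousLinearMap (mder E f x) := rfl

/-- The expression of a tuple of forms in a chart. -/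
def rep (x₀ : X) (α : FormTuple E X l) (y : E) : Fin l → Spinor E :=
  pullSpinor (mder E (extChartAt 𝓘(ℝ, E) x₀).symm y) (α ((extChartAt 𝓘(ℝ, E) x₀).symm y))

variable [IsManifold 𝓘(ℝ, E) ∞ X]

variable (E X) in
theorem isManifold_one : IsManifold 𝓘(ℝ, E) 1 X := IsManifold.of_le (n := ∞) (by simp)

theorem mdifferentiableAt_chart_symm {x₀ : X} {y : E}
    (hy : y ∈ (extChartAt 𝓘(ℝ, E) x₀).target) :
    MDifferentiableAt 𝓘(ℝ, E) 𝓘(ℝ, E) (extChartAt 𝓘(ℝ, E) x₀).symm y := by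
  have := isManifold_one E X
  have := mdifferentiableWithinAt_extChartAt_symm (I := 𝓘(ℝ, E)) hy
  rwa [show range 𝓘(ℝ, E) = univ by simp, mdifferentiableWithinAt_univ] at this

theorem mdifferentiableAt_chart {x₀ x : X} (hx : x ∈ (extChartAt 𝓘(ℝ, E) x₀).source) :
    MDifferentiableAt 𝓘(ℝ, E) 𝓘(ℝ, E) (extChartAt 𝓘(ℝ, E) x₀) x := by
  have := isManifold_one E X
  exact mdifferentiableAt_extChartAt (I := 𝓘(ℝ, E)) (by simpa using hx)

/-- The derivative of a chart as an isomorphism. -/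
theorem exists_equiv_chart {x₀ : X} {y : E} (hy : y ∈ (extChartAt 𝓘(ℝ, E) x₀).target) :
    ∃ L : E ≃L[ℝ] E, (L : E →L[ℝ] E) = mder E (extChartAt 𝓘(ℝ, E) x₀).symm y ∧
      (L.symm : E →L[ℝ] E) = mder E (extChartAt 𝓘(ℝ, E) x₀) ((extChartAt 𝓘(ℝ, E) x₀).symm y) := by
  have := isManifold_one E X
  have h1 := mfderivWithin_extChartAt_symm_comp_mfderiv_extChartAt (I := 𝓘(ℝ, E)) hy
  have h2 := mfderiv_extChartAt_comp_mfderivWithin_extChartAt_symm (I := 𝓘(ℝ, E)) hy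
  rw [show range 𝓘(ℝ, E) = univ by simp, mfderivWithin_univ] at h1 h2
  exact ⟨ContinuousLinearEquiv.equivOfInverse (mder E (extChartAt 𝓘(ℝ, E) x₀).symm y)
    (mder E (extChartAt 𝓘(ℝ, E) x₀) ((extChartAt 𝓘(ℝ, E) x₀).symm y))
    (fun v => congrArg (fun g => g v) h2) (fun v => congrArg (fun g => g v) h1), rfl, rfl⟩

/-- The tangent space at `x` is the model space seen through the chart at `x`, which is why
pointwise computations are made in that chart. -/
theorem mder_chart_self (x : X) :
    mder E (extChartAt 𝓘(ℝ, E) x) x = ContinuousLinearMap.id ℝ E := by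
  have := isManifold_one E X
  exact mfderiv_extChartAt_self (I := 𝓘(ℝ, E)) (x := x)

theorem mder_chart_symm_self (x : X) :
    mder E (extChartAt 𝓘(ℝ, E) x).symm (extChartAt 𝓘(ℝ, E) x x) = ContinuousLinearMap.id ℝ E := by
  have := isManifold_one E X
  have := mfderivWithin_range_extChartAt_symm (I := 𝓘(ℝ, E)) (x := x)
  rw [show range 𝓘(ℝ, E) = univ by simp, mfderivWithin_univ] at this
  exact this

theorem rep_self (x : X) (α : FormTuple E X l) : rep x α (extChartAt 𝓘(ℝ, E) x x) = α x := by
  rw [rep, mder_chart_symm_self, extChartAt_to_inv, pullSpinor_id]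

theorem chartRep_self (x : X) {p : ℕ} (α : X → E [⋀^Fin p]→L[ℝ] ℝ) :
    chartRep x α (extChartAt 𝓘(ℝ, E) x x) = α x := by
  rw [chartRep, pullback_eq, mder_chart_symm_self, extChartAt_to_inv]
  rfl

theorem rep_mem_cliff [FiniteDimensional ℝ E] {x₀ : X} {y : E}
    (hy : y ∈ (extChartAt 𝓘(ℝ, E) x₀).target)
    (α Φ : FormTuple E X l) (k : ℕ) : rep x₀ α y ∈ cliff (rep x₀ Φ y) k ↔
      α ((extChartAt 𝓘(ℝ, E) x₀).symm y) ∈ cliff (Φ ((extChartAt 𝓘(ℝ, E) x₀).symm y)) k := by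
  obtain ⟨L, hL, -⟩ := exists_equiv_chart hy
  rw [rep, rep, ← hL]
  refine ⟨fun h => ?_, fun h => pullSpinor_mem_cliff L h⟩
  have := pullSpinor_mem_cliff L.symm h
  rwa [pullSpinor_symm_pullSpinor, pullSpinor_symm_pullSpinor] at this

theorem rep_mem_orbit {V : Type*} [NormedAddCommGroup V] [NormedSpace ℝ V]
    {ΦV : Fin l → Spinor V} {x₀ : X} {y : E} (hy : y ∈ (extChartAt 𝓘(ℝ, E) x₀).target)
    (α : FormTuple E X l) : rep x₀ α y ∈ orbit ΦV E ↔
      α ((extChartAt 𝓘(ℝ, E) x₀).symm y) ∈ orbit ΦV E := by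
  obtain ⟨L, hL, -⟩ := exists_equiv_chart hy
  rw [rep, ← hL]
  refine ⟨fun h => ?_, fun h => pullSpinor_mem_orbit L h⟩
  have := pullSpinor_mem_orbit L.symm h
  rwa [pullSpinor_symm_pullSpinor] at this

/-- The expression of a pull-back in charts. -/
theorem chartRep_pullback {f : X → X} {x₀ x₁ : X} {y : E}
    (hy : y ∈ (extChartAt 𝓘(ℝ, E) x₀).target)
    (hf : MDifferentiableAt 𝓘(ℝ, E) 𝓘(ℝ, E) f ((extChartAt 𝓘(ℝ, E) x₀).symm y))
    (hfy : f ((extChartAt 𝓘(ℝ, E) x₀).symm y) ∈ (extChartAt 𝓘(ℝ, E) x₁).source)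
    {p : ℕ} (α : X → E [⋀^Fin p]→L[ℝ] ℝ) :
    chartRep x₀ (pullback f α) y =
      (chartRep x₁ α
        (extChartAt 𝓘(ℝ, E) x₁ (f ((extChartAt 𝓘(ℝ, E) x₀).symm y)))).compContinuousLinearMap
        (fderiv ℝ (fun z => extChartAt 𝓘(ℝ, E) x₁ (f ((extChartAt 𝓘(ℝ, E) x₀).symm z))) y) := by
  set F : E → E := fun z => extChartAt 𝓘(ℝ, E) x₁ (f ((extChartAt 𝓘(ℝ, E) x₀).symm z)) with hF
  have hs := mdifferentiableAt_chart_symm hy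
  have hfs : MDifferentiableAt 𝓘(ℝ, E) 𝓘(ℝ, E) (f ∘ (extChartAt 𝓘(ℝ, E) x₀).symm) y :=
    hf.comp y hs
  have hFd : MDifferentiableAt 𝓘(ℝ, E) 𝓘(ℝ, E) F y :=
    MDifferentiableAt.comp y (mdifferentiableAt_chart hfy) hfs
  have hs1 := mdifferentiableAt_chart_symm ((extChartAt 𝓘(ℝ, E) x₁).map_source hfy)
  -- The chain rule is applied to both sides of this local identity, which says that `F` expresses
  -- `f` in the two charts.
  have h3 : (extChartAt 𝓘(ℝ, E) x₁).symm ∘ F =ᶠ[𝓝 y] f ∘ (extChartAt 𝓘(ℝ, E) x₀).symm := by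
    have := hfs.continuousAt.preimage_mem_nhds ((isOpen_extChartAt_source x₁).mem_nhds hfy)
    filter_upwards [this] with z hz
    exact (extChartAt 𝓘(ℝ, E) x₁).left_inv hz
  have h4 : mder E ((extChartAt 𝓘(ℝ, E) x₁).symm ∘ F) y = mder E (f ∘ (extChartAt 𝓘(ℝ, E) x₀).symm) y :=
    h3.mfderiv_eq (I := 𝓘(ℝ, E)) (I' := 𝓘(ℝ, E))
  rw [mder_comp y hs1 hFd, mder_comp y hf hs, mder_eq_fderiv] at h4
  have h5 : (extChartAt 𝓘(ℝ, E) x₁).symm (F y) = f ((extChartAt 𝓘(ℝ, E) x₀).symm y) := h3.eq_of_nhds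
  change (α (f ((extChartAt 𝓘(ℝ, E) x₀).symm y))).compContinuousLinearMap
    (mder E f ((extChartAt 𝓘(ℝ, E) x₀).symm y) ∘L mder E (extChartAt 𝓘(ℝ, E) x₀).symm y) =
    (α ((extChartAt 𝓘(ℝ, E) x₁).symm (F y))).compContinuousLinearMap
    (mder E (extChartAt 𝓘(ℝ, E) x₁).symm (F y) ∘L fderiv ℝ F y)
  rw [h4, h5]

end Charts

end

section

open Filter Set

/-! ### Smooth forms and the exterior derivative in arbitrary charts. -/

section Smoothness

variable {E : Type*} [NormedAddCommGroup E] [NormedSpace ℝ E]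
  {X : Type*} [TopologicalSpace X] [ChartedSpace E X] {l p : ℕ}

theorem IsSmoothFamily.contDiffAt {α : ℝ → X → E [⋀^Fin p]→L[ℝ] ℝ} (h : IsSmoothFamily α)
    {x₀ : X} {y : E} (hy : y ∈ (extChartAt 𝓘(ℝ, E) x₀).target) (t : ℝ) :
    ContDiffAt ℝ ∞ (fun q : ℝ × E => chartRep x₀ (α q.1) q.2) (t, y) :=
  (h x₀).contDiffAt ((isOpen_univ.prod (isOpen_extChartAt_target x₀)).mem_nhds ⟨mem_univ _, hy⟩)

theorem IsSmooth.contDiffAt {α : X → E [⋀^Fin p]→L[ℝ] ℝ} (h : IsSmooth α)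
    {x₀ : X} {y : E} (hy : y ∈ (extChartAt 𝓘(ℝ, E) x₀).target) :
    ContDiffAt ℝ ∞ (chartRep x₀ α) y :=
  (h x₀).contDiffAt ((isOpen_extChartAt_target x₀).mem_nhds hy)

theorem IsSmooth.family {α : X → E [⋀^Fin p]→L[ℝ] ℝ} (h : IsSmooth α) :
    IsSmoothFamily fun _ => α := fun x₀ =>
  (h x₀).comp contDiff_snd.contDiffOn fun _ hq => hq.2

theorem IsSmoothFamily.smooth {α : ℝ → X → E [⋀^Fin p]→L[ℝ] ℝ} (h : IsSmoothFamily α) (t : ℝ) :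
    IsSmooth (α t) := fun x₀ =>
  (h x₀).comp (f := fun y => (t, y)) (by fun_prop) fun _ hy => ⟨mem_univ _, hy⟩

theorem pullback_id (α : X → E [⋀^Fin p]→L[ℝ] ℝ) : pullback id α = α := by
  funext x
  rw [pullback_eq, mder, mfderiv_id]
  rfl

variable [IsManifold 𝓘(ℝ, E) ∞ X]

theorem contMDiffAt_chart {x₀ x : X} (hx : x ∈ (extChartAt 𝓘(ℝ, E) x₀).source) :
    ContMDiffAt 𝓘(ℝ, E) 𝓘(ℝ, E) ∞ (extChartAt 𝓘(ℝ, E) x₀) x :=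
  contMDiffAt_extChartAt' (by simpa using hx)

theorem contMDiffAt_chart_symm {x₀ : X} {y : E} (hy : y ∈ (extChartAt 𝓘(ℝ, E) x₀).target) :
    ContMDiffAt 𝓘(ℝ, E) 𝓘(ℝ, E) ∞ (extChartAt 𝓘(ℝ, E) x₀).symm y :=
  (contMDiffOn_extChartAt_symm x₀).contMDiffAt ((isOpen_extChartAt_target x₀).mem_nhds hy)

theorem contDiffAt_transition {x₀ x₁ : X} {y : E} (hy : y ∈ (extChartAt 𝓘(ℝ, E) x₀).target)
    (hy' : (extChartAt 𝓘(ℝ, E) x₀).symm y ∈ (extChartAt 𝓘(ℝ, E) x₁).source) :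
    ContDiffAt ℝ ∞ (fun z => extChartAt 𝓘(ℝ, E) x₁ ((extChartAt 𝓘(ℝ, E) x₀).symm z)) y :=
  contMDiffAt_iff_contDiffAt.1 ((contMDiffAt_chart hy').comp y (contMDiffAt_chart_symm hy))

theorem eventually_symm_mem {x₀ x₁ : X} {y : E} (hy : y ∈ (extChartAt 𝓘(ℝ, E) x₀).target)
    (hy' : (extChartAt 𝓘(ℝ, E) x₀).symm y ∈ (extChartAt 𝓘(ℝ, E) x₁).source) :
    ∀ᶠ z in 𝓝 y, z ∈ (extChartAt 𝓘(ℝ, E) x₀).target ∧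
      (extChartAt 𝓘(ℝ, E) x₀).symm z ∈ (extChartAt 𝓘(ℝ, E) x₁).source :=
  Filter.inter_mem ((isOpen_extChartAt_target x₀).mem_nhds hy)
    ((contMDiffAt_chart_symm hy).continuousAt.preimage_mem_nhds
      ((isOpen_extChartAt_source x₁).mem_nhds hy'))

theorem chartRep_change {x₀ x₁ : X} {y : E} (hy : y ∈ (extChartAt 𝓘(ℝ, E) x₀).target)
    (hy' : (extChartAt 𝓘(ℝ, E) x₀).symm y ∈ (extChartAt 𝓘(ℝ, E) x₁).source)
    (α : X → E [⋀^Fin p]→L[ℝ] ℝ) :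
    chartRep x₀ α y =
      (chartRep x₁ α
        (extChartAt 𝓘(ℝ, E) x₁ ((extChartAt 𝓘(ℝ, E) x₀).symm y))).compContinuousLinearMap
        (fderiv ℝ (fun z => extChartAt 𝓘(ℝ, E) x₁ ((extChartAt 𝓘(ℝ, E) x₀).symm z)) y) := by
  have := chartRep_pullback hy (f := id) mdifferentiableAt_id hy' α
  rwa [pullback_id] at this

theorem contDiffAt_chartRep_change [FiniteDimensional ℝ E] {x₀ x₁ : X} {y : E}
    (hy : y ∈ (extChartAt 𝓘(ℝ, E) x₀).target)
    (hy' : (extChartAt 𝓘(ℝ, E) x₀).symm y ∈ (extChartAt 𝓘(ℝ, E) x₁).source)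
    {α : ℝ → X → E [⋀^Fin p]→L[ℝ] ℝ} {t : ℝ}
    (h : ContDiffAt ℝ ∞ (fun q : ℝ × E => chartRep x₁ (α q.1) q.2)
      (t, extChartAt 𝓘(ℝ, E) x₁ ((extChartAt 𝓘(ℝ, E) x₀).symm y))) :
    ContDiffAt ℝ ∞ (fun q : ℝ × E => chartRep x₀ (α q.1) q.2) (t, y) := by
  have hτ := contDiffAt_transition hy hy'
  have h1 : ContDiffAt ℝ ∞ (fun q : ℝ × E => chartRep x₁ (α q.1)
      (extChartAt 𝓘(ℝ, E) x₁ ((extChartAt 𝓘(ℝ, E) x₀).symm q.2))) (t, y) :=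
    ContDiffAt.comp (t, y) (f := fun q : ℝ × E => (q.1, extChartAt 𝓘(ℝ, E) x₁
      ((extChartAt 𝓘(ℝ, E) x₀).symm q.2))) h
      (contDiffAt_fst.prodMk (ContDiffAt.comp (t, y) (f := Prod.snd) hτ contDiffAt_snd))
  have h2 : ContDiffAt ℝ ∞ (fun q : ℝ × E => fderiv ℝ (fun z => extChartAt 𝓘(ℝ, E) x₁
      ((extChartAt 𝓘(ℝ, E) x₀).symm z)) q.2) (t, y) :=
    (hτ.fderiv_right (m := ∞) (by simp)).comp (t, y) contDiffAt_snd
  have h3 := ContDiffWithinAt.form_comp (s := univ) h1 h2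
  refine (contDiffWithinAt_univ.1 h3).congr_of_eventuallyEq ?_
  have := (continuous_snd.continuousAt (x := (t, y))).eventually (eventually_symm_mem hy hy')
  filter_upwards [this] with q hq
  exact chartRep_change hq.1 hq.2 _

/-- Smoothness can be tested in one chart around each point. -/
theorem isSmoothFamily_of_charts [FiniteDimensional ℝ E] {α : ℝ → X → E [⋀^Fin p]→L[ℝ] ℝ}
    (h : ∀ x : X, ∃ x₀ : X, x ∈ (extChartAt 𝓘(ℝ, E) x₀).source ∧ ∀ t,
      ContDiffAt ℝ ∞ (fun q : ℝ × E => chartRep x₀ (α q.1) q.2) (t, extChartAt 𝓘(ℝ, E) x₀ x)) :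
    IsSmoothFamily α := by
  rintro x₀ ⟨t, y⟩ ⟨-, hy⟩
  obtain ⟨x₁, hx₁, h1⟩ := h ((extChartAt 𝓘(ℝ, E) x₀).symm y)
  exact (contDiffAt_chartRep_change hy hx₁ (h1 t)).contDiffWithinAt

theorem extD_eq (α : X → E [⋀^Fin p]→L[ℝ] ℝ) (x : X) :
    extD α x = extDeriv (chartRep x α) (extChartAt 𝓘(ℝ, E) x x) := by
  rw [extD]
  change (extDeriv (chartRep x α) (extChartAt 𝓘(ℝ, E) x x)).compContinuousLinearMap
    (mder E (extChartAt 𝓘(ℝ, E) x) x) = _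
  rw [mder_chart_self]
  rfl

theorem minSmoothness_le : minSmoothness ℝ 2 ≤ (∞ : WithTop ℕ∞) := by
  rw [minSmoothness_of_isRCLikeNormedField]
  exact WithTop.coe_le_coe.2 le_top

/-- The exterior derivative can be computed in any chart. -/
theorem chartRep_extD {α : X → E [⋀^Fin p]→L[ℝ] ℝ} (hα : IsSmooth α) {x₀ : X} {y : E}
    (hy : y ∈ (extChartAt 𝓘(ℝ, E) x₀).target) :
    chartRep x₀ (extD α) y = extDeriv (chartRep x₀ α) y := by
  set x := (extChartAt 𝓘(ℝ, E) x₀).symm y with hx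
  have hy' : (extChartAt 𝓘(ℝ, E) x₀).symm y ∈ (extChartAt 𝓘(ℝ, E) x).source :=
    mem_extChartAt_source x
  -- Locally the two chart expressions differ by pull-back along the transition map, with which
  -- `extDeriv` commutes.
  have h1 : chartRep x₀ α =ᶠ[𝓝 y] fun z => (chartRep x α
        (extChartAt 𝓘(ℝ, E) x ((extChartAt 𝓘(ℝ, E) x₀).symm z))).compContinuousLinearMap
        (fderiv ℝ (fun z => extChartAt 𝓘(ℝ, E) x ((extChartAt 𝓘(ℝ, E) x₀).symm z)) z) := by
    filter_upwards [eventually_symm_mem hy hy'] with z hz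
    exact chartRep_change hz.1 hz.2 α
  have h2 := mder_comp y (mdifferentiableAt_chart hy') (mdifferentiableAt_chart_symm hy)
  rw [mder_eq_fderiv] at h2
  have h3 : mder E (extChartAt 𝓘(ℝ, E) x) ((extChartAt 𝓘(ℝ, E) x₀).symm y) =
    ContinuousLinearMap.id ℝ E := mder_chart_self x
  rw [h3, ContinuousLinearMap.id_comp] at h2
  rw [h1.extDeriv_eq, extDeriv_pullback
    (f := fun z => extChartAt 𝓘(ℝ, E) x ((extChartAt 𝓘(ℝ, E) x₀).symm z)) (hα.differentiableAt x)
    (contDiffAt_transition hy hy') minSmoothness_le]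
  change (extD α x).compContinuousLinearMap (mder E (extChartAt 𝓘(ℝ, E) x₀).symm y) = _
  rw [← h2, extD_eq]
  rfl

theorem IsSmooth.extD {α : X → E [⋀^Fin p]→L[ℝ] ℝ} (hα : IsSmooth α) :
    IsSmooth (CliffordDeformation.extD α) := by
  intro x₀
  have h1 : ContDiffOn ℝ ∞ (extDeriv (chartRep x₀ α)) (extChartAt 𝓘(ℝ, E) x₀).target :=
    (ContinuousAlternatingMap.alternatizeUncurryFinCLM ℝ E ℝ).contDiff.comp_contDiffOn
      ((hα x₀).fderiv_of_isOpen (isOpen_extChartAt_target x₀) (by simp))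
  exact h1.congr fun y hy => chartRep_extD hα hy

theorem extD_extD {α : X → E [⋀^Fin p]→L[ℝ] ℝ} (hα : IsSmooth α) :
    CliffordDeformation.extD (CliffordDeformation.extD α) = 0 := by
  funext x
  have h : chartRep x (CliffordDeformation.extD α) =ᶠ[𝓝 (extChartAt 𝓘(ℝ, E) x x)]
      extDeriv (chartRep x α) := by
    filter_upwards [(isOpen_extChartAt_target x).mem_nhds (mem_extChartAt_target x)] with y hy
    exact chartRep_extD hα hy
  rw [extD_eq, h.extDeriv_eq, extDeriv_extDeriv_apply (hα.contDiffAt (mem_extChartAt_target x))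
    minSmoothness_le]
  rfl

theorem d_mem_smoothForms {α : FormTuple E X l} (hα : α ∈ smoothForms E X l) :
    d α ∈ smoothForms E X l := by
  intro i p
  cases p with
  | zero => exact (smoothForms E X l).zero_mem i 0
  | succ p => exact (hα i p).extD

theorem d_d {α : FormTuple E X l} (hα : α ∈ smoothForms E X l) : d (d α) = 0 := by
  funext x i p
  match p with
  | 0 => rfl
  | 1 =>
    have := extD_smul (X := X) (0 : ℝ) (0 : X → E [⋀^Fin 0]→L[ℝ] ℝ)
    rw [zero_smul, zero_smul] at this
    exact congrFun this x
  | p + 2 => exact congrFun (extD_extD (hα i p)) x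

/-- The componentwise derivative of a tuple of forms on a vector space. -/
def tupleDeriv (c : E → Fin l → Spinor E) (y : E) : E →ₗ[ℝ] Fin l → Spinor E where
  toFun v i p := fderiv ℝ (fun z => c z i p) y v
  map_add' v w := by funext i p; simp
  map_smul' r v := by funext i p; simp

theorem tupleDeriv_apply (c : E → Fin l → Spinor E) (y v : E) (i : Fin l) (p : ℕ) :
    tupleDeriv c y v i p = fderiv ℝ (fun z => c z i p) y v := rfl

/-- The bridge between analysis and Clifford algebra: in coordinates `d` is Clifford multiplication
of the partial derivatives by the dual basis. -/
theorem rep_d [FiniteDimensional ℝ E] {α : FormTuple E X l} (hα : α ∈ smoothForms E X l)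
    {x₀ : X} {y : E} (hy : y ∈ (extChartAt 𝓘(ℝ, E) x₀).target) :
    rep x₀ (d α) y = altT (tupleDeriv (rep x₀ α) y) := by
  funext i p
  cases p with
  | zero =>
    rw [altT_zero_apply]
    rfl
  | succ p =>
    rw [altT_succ_apply _ _ _ (fderiv ℝ (fun z => rep x₀ α z i p) y) fun v => rfl]
    exact chartRep_extD (hα i p) hy

end Smoothness

end

section

open Filter Set

/-! ### Time derivatives of families of forms. -/

section Velocity

variable {E : Type*} [NormedAddCommGroup E] [NormedSpace ℝ E] [FiniteDimensional ℝ E]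
  {X : Type*} [TopologicalSpace X] [ChartedSpace E X] {l p : ℕ}

/-- Presents a pointwise velocity as a partial derivative of a jointly smooth function, from which
its smoothness in space follows. -/
theorem chartRep_velocity {α : ℝ → X → E [⋀^Fin p]→L[ℝ] ℝ} (hα : IsSmoothFamily α)
    {β : X → E [⋀^Fin p]→L[ℝ] ℝ} {t₀ : ℝ} (hβ : ∀ x, HasDerivAt (fun t => α t x) (β x) t₀)
    {x₀ : X} {y : E} (hy : y ∈ (extChartAt 𝓘(ℝ, E) x₀).target) :
    chartRep x₀ β y = fderiv ℝ (fun q : ℝ × E => chartRep x₀ (α q.1) q.2) (t₀, y) (1, 0) := by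
  let T : (E [⋀^Fin p]→L[ℝ] ℝ) →L[ℝ] E [⋀^Fin p]→L[ℝ] ℝ :=
    ContinuousAlternatingMap.compContinuousLinearMapCLM (mder E (extChartAt 𝓘(ℝ, E) x₀).symm y)
  have h1 : HasDerivAt (fun t => chartRep x₀ (α t) y) (chartRep x₀ β y) t₀ :=
    T.hasFDerivAt.comp_hasDerivAt t₀ (hβ ((extChartAt 𝓘(ℝ, E) x₀).symm y))
  let G : ℝ × E → E [⋀^Fin p]→L[ℝ] ℝ := fun q => chartRep x₀ (α q.1) q.2
  have h2 : HasFDerivAt G (fderiv ℝ G (t₀, y)) (t₀, y) :=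
    ((hα.contDiffAt hy t₀).differentiableAt (by simp)).hasFDerivAt
  have h3 : HasDerivAt (fun t : ℝ => (t, y)) ((1 : ℝ), (0 : E)) t₀ :=
    (hasDerivAt_id t₀).prodMk (hasDerivAt_const t₀ y)
  have h4 : HasDerivAt (G ∘ fun t => (t, y)) (fderiv ℝ G (t₀, y) (1, 0)) t₀ :=
    h2.comp_hasDerivAt t₀ h3
  exact h1.unique h4

theorem isSmooth_velocity {α : ℝ → X → E [⋀^Fin p]→L[ℝ] ℝ} (hα : IsSmoothFamily α)
    {β : X → E [⋀^Fin p]→L[ℝ] ℝ} {t₀ : ℝ} (hβ : ∀ x, HasDerivAt (fun t => α t x) (β x) t₀) :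
    IsSmooth β := by
  intro x₀ y hy
  refine ContDiffAt.contDiffWithinAt ?_
  have h1 : ContDiffAt ℝ ∞
      (fun y => fderiv ℝ (fun q : ℝ × E => chartRep x₀ (α q.1) q.2) (t₀, y) (1, 0)) y :=
    (((hα.contDiffAt hy t₀).fderiv_right (m := ∞) (by simp)).comp y
      (f := fun y => (t₀, y)) (by fun_prop)).clm_apply contDiffAt_const
  refine h1.congr_of_eventuallyEq ?_
  filter_upwards [(isOpen_extChartAt_target x₀).mem_nhds hy] with z hz
  exact chartRep_velocity hα hβ hz

omit [FiniteDimensional ℝ E] in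
/-- Derivatives in time and space commute. -/
theorem hasDerivAt_fderiv_slice {F : Type*} [NormedAddCommGroup F] [NormedSpace ℝ F]
    {G : ℝ × E → F} {t₀ : ℝ} {y : E} (hG : ContDiffAt ℝ ∞ G (t₀, y)) :
    HasDerivAt (fun t => fderiv ℝ (fun z => G (t, z)) y)
      (fderiv ℝ (fun z => fderiv ℝ G (t₀, z) (1, 0)) y) t₀ := by
  have hG2 : DifferentiableAt ℝ (fderiv ℝ G) (t₀, y) :=
    (hG.fderiv_right (m := ∞) (by simp)).differentiableAt (by simp)
  have h1 : ∀ᶠ q in 𝓝 (t₀, y), DifferentiableAt ℝ G q := by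
    have h2 : ContDiffAt ℝ 1 G (t₀, y) := hG.of_le (by simp)
    filter_upwards [h2.eventually (by simp)] with q hq
    exact hq.differentiableAt (by simp)
  have hd : (fun t => fderiv ℝ (fun z => G (t, z)) y) =ᶠ[𝓝 t₀]
      fun t => (fderiv ℝ G (t, y)) ∘L (ContinuousLinearMap.inr ℝ ℝ E) := by
    have h2 : Tendsto (fun t : ℝ => (t, y)) (𝓝 t₀) (𝓝 (t₀, y)) :=
      Continuous.tendsto (f := fun t : ℝ => (t, y)) (by fun_prop) t₀
    filter_upwards [h2.eventually h1] with t ht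
    exact (ht.hasFDerivAt.comp y (hasFDerivAt_prodMk_right t y)).fderiv
  have h3 : HasDerivAt (fun t : ℝ => (t, y)) ((1 : ℝ), (0 : E)) t₀ :=
    (hasDerivAt_id t₀).prodMk (hasDerivAt_const t₀ y)
  have h4 := hG2.hasFDerivAt.comp_hasDerivAt t₀ h3
  have h5 : fderiv ℝ (fun z => fderiv ℝ G (t₀, z) (1, 0)) y =
      (fderiv ℝ (fderiv ℝ G) (t₀, y) (1, 0)) ∘L (ContinuousLinearMap.inr ℝ ℝ E) := by
    have e2 : HasFDerivAt (fun z => fderiv ℝ G (t₀, z))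
        ((fderiv ℝ (fderiv ℝ G) (t₀, y)) ∘L ContinuousLinearMap.inr ℝ ℝ E) y :=
      hG2.hasFDerivAt.comp y (hasFDerivAt_prodMk_right t₀ y)
    have e3 := (ContinuousLinearMap.apply ℝ F ((1 : ℝ), (0 : E))).hasFDerivAt.comp y e2
    refine (HasFDerivAt.fderiv e3).trans ?_
    -- Exchanging the two derivatives is the symmetry of the second derivative of `G`.
    have hs : IsSymmSndFDerivAt ℝ G (t₀, y) := hG.isSymmSndFDerivAt minSmoothness_le
    ext1 v
    exact hs.eq _ _
  have h6 := ((ContinuousLinearMap.compL ℝ E (ℝ × E) F).flip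
    (ContinuousLinearMap.inr ℝ ℝ E)).hasFDerivAt.comp_hasDerivAt t₀ h4
  rw [h5]
  exact HasDerivAt.congr_of_eventuallyEq h6 hd

theorem hasDerivAt_extD [IsManifold 𝓘(ℝ, E) ∞ X]
    {α : ℝ → X → E [⋀^Fin p]→L[ℝ] ℝ} (hα : IsSmoothFamily α)
    {β : X → E [⋀^Fin p]→L[ℝ] ℝ} {t₀ : ℝ} (hβ : ∀ x, HasDerivAt (fun t => α t x) (β x) t₀) (x : X) :
    HasDerivAt (fun t => extD (α t) x) (extD β x) t₀ := by
  have hy := mem_extChartAt_target (I := 𝓘(ℝ, E)) x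
  have e1 : chartRep x β =ᶠ[𝓝 (extChartAt 𝓘(ℝ, E) x x)]
      fun z => fderiv ℝ (fun q : ℝ × E => chartRep x (α q.1) q.2) (t₀, z) (1, 0) := by
    filter_upwards [(isOpen_extChartAt_target x).mem_nhds hy] with z hz
    exact chartRep_velocity hα hβ hz
  have h1 := hasDerivAt_fderiv_slice (hα.contDiffAt hy t₀)
  rw [← e1.fderiv_eq] at h1
  simp only [extD_eq]
  exact (ContinuousAlternatingMap.alternatizeUncurryFinCLM ℝ E ℝ
    (n := p)).hasFDerivAt.comp_hasDerivAt t₀ h1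

end Velocity

/-! ### Transporting cut-off tuples from a chart to the manifold. -/

section Glue

variable {E : Type*} [NormedAddCommGroup E] [NormedSpace ℝ E]
  {X : Type*} [TopologicalSpace X] [ChartedSpace E X] {l p : ℕ}

open Classical in
/-- The tuple of forms `u • c` on `X`, where `c` is a tuple of forms in the chart at `x₀` and `u` is
a function with support in the chart domain. -/
def glue (x₀ : X) (u : X → ℝ) (c : E → Fin l → Spinor E) : FormTuple E X l := fun x =>
  if x ∈ (extChartAt 𝓘(ℝ, E) x₀).source then
    u x • pullSpinor (mder E (extChartAt 𝓘(ℝ, E) x₀) x) (c (extChartAt 𝓘(ℝ, E) x₀ x)) else 0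

theorem glue_of_mem {x₀ x : X} (hx : x ∈ (extChartAt 𝓘(ℝ, E) x₀).source) (u : X → ℝ)
    (c : E → Fin l → Spinor E) : glue x₀ u c x =
      u x • pullSpinor (mder E (extChartAt 𝓘(ℝ, E) x₀) x) (c (extChartAt 𝓘(ℝ, E) x₀ x)) :=
  if_pos hx

theorem glue_eq_zero {x₀ x : X} {u : X → ℝ} (hx : u x = 0) (c : E → Fin l → Spinor E) :
    glue x₀ u c x = 0 := by
  by_cases h : x ∈ (extChartAt 𝓘(ℝ, E) x₀).source
  · rw [glue_of_mem h, hx, zero_smul]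
  · exact if_neg h

theorem contDiffAt_rep {α : FormTuple E X l} (hα : α ∈ smoothForms E X l) {x₀ : X} {y : E}
    (hy : y ∈ (extChartAt 𝓘(ℝ, E) x₀).target) (i : Fin l) (p : ℕ) :
    ContDiffAt ℝ ∞ (fun y => rep x₀ α y i p) y := (hα i p).contDiffAt hy

theorem contDiffAt_word_rep [FiniteDimensional ℝ E] {α : FormTuple E X l}
    (hα : α ∈ smoothForms E X l) {x₀ : X} {y : E}
    (hy : y ∈ (extChartAt 𝓘(ℝ, E) x₀).target) (ws : List (E × (E →L[ℝ] ℝ))) (i : Fin l) (p : ℕ) :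
    ContDiffAt ℝ ∞ (fun y => word ws (rep x₀ α y) i p) y :=
  contDiffWithinAt_univ.1 (ContDiffWithinAt.linear_tuple
    (fun i p => (contDiffAt_rep hα hy i p).contDiffWithinAt) (word ws) i p)

theorem glue_smul (x₀ : X) (u : X → ℝ) (r : E → ℝ) (c : E → Fin l → Spinor E) (x : X) :
    glue x₀ u (fun y => r y • c y) x = r (extChartAt 𝓘(ℝ, E) x₀ x) • glue x₀ u c x := by
  by_cases h : x ∈ (extChartAt 𝓘(ℝ, E) x₀).source
  · rw [glue_of_mem h, glue_of_mem h, ← pullT_apply, map_smul, smul_comm]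
    rfl
  · rw [glue, glue, if_neg h, if_neg h, smul_zero]

variable [IsManifold 𝓘(ℝ, E) ∞ X]

theorem rep_glue {x₀ : X} {y : E} (hy : y ∈ (extChartAt 𝓘(ℝ, E) x₀).target) (u : X → ℝ)
    (c : E → Fin l → Spinor E) :
    rep x₀ (glue x₀ u c) y = u ((extChartAt 𝓘(ℝ, E) x₀).symm y) • c y := by
  obtain ⟨L, hL, hL'⟩ := exists_equiv_chart hy
  rw [rep, glue_of_mem ((extChartAt 𝓘(ℝ, E) x₀).map_target hy), (extChartAt 𝓘(ℝ, E) x₀).right_inv hy,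
    ← hL, ← hL', ← pullT_apply, map_smul, pullT_apply, pullSpinor_pullSpinor_symm]

theorem glue_rep {x₀ : X} {u : X → ℝ} (hu : tsupport u ⊆ (extChartAt 𝓘(ℝ, E) x₀).source)
    (α : FormTuple E X l) (x : X) : glue x₀ u (rep x₀ α) x = u x • α x := by
  by_cases h : x ∈ (extChartAt 𝓘(ℝ, E) x₀).source
  · have hy := (extChartAt 𝓘(ℝ, E) x₀).map_source h
    obtain ⟨L, hL, hL'⟩ := exists_equiv_chart hy
    rw [(extChartAt 𝓘(ℝ, E) x₀).left_inv h] at hL'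
    rw [glue_of_mem h, rep, (extChartAt 𝓘(ℝ, E) x₀).left_inv h, ← hL, ← hL',
      pullSpinor_symm_pullSpinor]
  · have : u x = 0 := image_eq_zero_of_notMem_tsupport fun h' => h (hu h')
    rw [glue_eq_zero this, this, zero_smul]

theorem contDiffAt_comp_chart_symm {u : X → ℝ} (hu : ContMDiff 𝓘(ℝ, E) 𝓘(ℝ, ℝ) ∞ u) {x₀ : X} {y : E}
    (hy : y ∈ (extChartAt 𝓘(ℝ, E) x₀).target) :
    ContDiffAt ℝ ∞ (fun z => u ((extChartAt 𝓘(ℝ, E) x₀).symm z)) y :=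
  contMDiffAt_iff_contDiffAt.1 (hu.contMDiffAt.comp y (contMDiffAt_chart_symm hy))

theorem isSmoothFamily_glue [FiniteDimensional ℝ E] {x₀ : X} {u : X → ℝ}
    (hu : ContMDiff 𝓘(ℝ, E) 𝓘(ℝ, ℝ) ∞ u)
    (hu' : tsupport u ⊆ (extChartAt 𝓘(ℝ, E) x₀).source) {c : ℝ → E → Fin l → Spinor E}
    {i : Fin l} {p : ℕ}
    (hc : ∀ t, ∀ y ∈ (extChartAt 𝓘(ℝ, E) x₀).target,
      ContDiffAt ℝ ∞ (fun q : ℝ × E => c q.1 q.2 i p) (t, y)) :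
    IsSmoothFamily fun t x => glue x₀ u (c t) x i p := by
  refine isSmoothFamily_of_charts fun x => ?_
  by_cases h : x ∈ (extChartAt 𝓘(ℝ, E) x₀).source
  · refine ⟨x₀, h, fun t => ?_⟩
    have hy := (extChartAt 𝓘(ℝ, E) x₀).map_source h
    have h1 : ContDiffAt ℝ ∞ (fun q : ℝ × E =>
        u ((extChartAt 𝓘(ℝ, E) x₀).symm q.2) • c q.1 q.2 i p) (t, extChartAt 𝓘(ℝ, E) x₀ x) :=
      (ContDiffAt.comp (t, extChartAt 𝓘(ℝ, E) x₀ x) (f := Prod.snd)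
        (contDiffAt_comp_chart_symm hu hy) contDiffAt_snd).smul (hc t _ hy)
    refine h1.congr_of_eventuallyEq ?_
    filter_upwards [(continuous_snd.continuousAt (x := (t, extChartAt 𝓘(ℝ, E) x₀ x))).eventually
      ((isOpen_extChartAt_target x₀).mem_nhds hy)] with q hq
    exact congrFun (congrFun (rep_glue hq u (c q.1)) i) p
  · refine ⟨x, mem_extChartAt_source x, fun t => ?_⟩
    have hx : x ∉ tsupport u := fun h' => h (hu' h')
    have h1 : ∀ᶠ z in 𝓝 x, u z = 0 := by
      filter_upwards [(isClosed_tsupport u).isOpen_compl.mem_nhds hx] with z hz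
      exact image_eq_zero_of_notMem_tsupport hz
    have h2 := (contMDiffAt_chart_symm (mem_extChartAt_target (I := 𝓘(ℝ, E)) x)).continuousAt
    rw [ContinuousAt, extChartAt_to_inv] at h2
    have h3 := h2.eventually h1
    refine (contDiffAt_const (c := 0)).congr_of_eventuallyEq ?_
    filter_upwards [(continuous_snd.continuousAt (x := (t, extChartAt 𝓘(ℝ, E) x x))).eventually h3]
      with q hq
    rw [chartRep, pullback_eq, glue_eq_zero hq]
    rfl

theorem glue_mem_smoothForms [FiniteDimensional ℝ E] {x₀ : X} {u : X → ℝ}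
    (hu : ContMDiff 𝓘(ℝ, E) 𝓘(ℝ, ℝ) ∞ u)
    (hu' : tsupport u ⊆ (extChartAt 𝓘(ℝ, E) x₀).source) {c : E → Fin l → Spinor E}
    (hc : ∀ y ∈ (extChartAt 𝓘(ℝ, E) x₀).target, ∀ i p, ContDiffAt ℝ ∞ (fun y => c y i p) y) :
    glue x₀ u c ∈ smoothForms E X l := fun i p =>
  (isSmoothFamily_glue hu hu' (c := fun _ => c) fun t y hy =>
    ContDiffAt.comp (t, y) (f := Prod.snd) (hc y hy i p) contDiffAt_snd).smooth 0

theorem d_glue_of_notMem {x₀ x : X} {u : X → ℝ}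
    (hu' : tsupport u ⊆ (extChartAt 𝓘(ℝ, E) x₀).source) (c : E → Fin l → Spinor E)
    (h : x ∉ (extChartAt 𝓘(ℝ, E) x₀).source) : d (glue x₀ u c) x = 0 := by
  have hx : x ∉ tsupport u := fun h' => h (hu' h')
  have h1 : ∀ᶠ z in 𝓝 x, u z = 0 := by
    filter_upwards [(isClosed_tsupport u).isOpen_compl.mem_nhds hx] with z hz
    exact image_eq_zero_of_notMem_tsupport hz
  have h2 := (contMDiffAt_chart_symm (mem_extChartAt_target (I := 𝓘(ℝ, E)) x)).continuousAt
  rw [ContinuousAt, extChartAt_to_inv] at h2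
  have h3 := h2.eventually h1
  funext i p
  cases p with
  | zero => rfl
  | succ p =>
    have h4 : chartRep x (fun y => glue x₀ u c y i p) =ᶠ[𝓝 (extChartAt 𝓘(ℝ, E) x x)] fun _ => 0 := by
      filter_upwards [h3] with z hz
      rw [chartRep, pullback_eq, glue_eq_zero hz]
      rfl
    change extD (fun y => glue x₀ u c y i p) x = 0
    rw [extD_eq, h4.extDeriv_eq, extDeriv]
    ext w
    simp [ContinuousAlternatingMap.alternatizeUncurryFin_apply]

/-- A word with constant letters in the chart becomes at `x` a word whose letters are moved by the
derivative of the chart. The same isomorphism serves for all tuples, cut-offs and words. -/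
theorem exists_glue_word {x₀ x : X} (hx : x ∈ (extChartAt 𝓘(ℝ, E) x₀).source) :
    ∃ M : E ≃L[ℝ] E,
      (M : E →L[ℝ] E) = mder E (extChartAt 𝓘(ℝ, E) x₀).symm (extChartAt 𝓘(ℝ, E) x₀ x) ∧
      (M.symm : E →L[ℝ] E) = mder E (extChartAt 𝓘(ℝ, E) x₀) x ∧
      ∀ {l : ℕ} (Φ : FormTuple E X l) (u : X → ℝ) (ws : List (E × (E →L[ℝ] ℝ))),
        glue x₀ u (fun y => word ws (rep x₀ Φ y)) x = u x • word (ws.map (pullW M.symm)) (Φ x) := by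
  have hy := (extChartAt 𝓘(ℝ, E) x₀).map_source hx
  obtain ⟨L, hL, hL'⟩ := exists_equiv_chart hy
  rw [(extChartAt 𝓘(ℝ, E) x₀).left_inv hx] at hL'
  refine ⟨L, hL, hL', fun Φ u ws => ?_⟩
  rw [glue_of_mem hx, rep, (extChartAt 𝓘(ℝ, E) x₀).left_inv hx, ← hL, ← hL', pullSpinor_word,
    pullSpinor_symm_pullSpinor]

theorem glue_word {x₀ x : X} (hx : x ∈ (extChartAt 𝓘(ℝ, E) x₀).source) :
    ∃ L : E ≃L[ℝ] E, ∀ {l : ℕ} (Φ : FormTuple E X l) (u : X → ℝ) (ws : List (E × (E →L[ℝ] ℝ))),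
      glue x₀ u (fun y => word ws (rep x₀ Φ y)) x = u x • word (ws.map (pullW L)) (Φ x) := by
  obtain ⟨M, -, -, hM⟩ := exists_glue_word hx
  exact ⟨M.symm, hM⟩

end Glue

end

section

open Filter Set

/-! ### Local frames of words and global sections. -/

section Frames

/-- The coefficients of a smooth map with respect to smooth linearly independent maps are smooth. -/
theorem exists_contDiffAt_coeff {T H : Type*} [NormedAddCommGroup T] [NormedSpace ℝ T]
    [FiniteDimensional ℝ T] [NormedAddCommGroup H] [NormedSpace ℝ H] {r : ℕ} {S : Set H}
    (hS : IsOpen S) {w : Fin r → H → T}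
    (hw : ∀ j, ∀ y ∈ S, ContDiffAt ℝ ∞ (w j) y) {y₀ : H} (hy₀ : y₀ ∈ S)
    (hli : LinearIndependent ℝ fun j => w j y₀) :
    ∃ U : Set H, IsOpen U ∧ y₀ ∈ U ∧ U ⊆ S ∧ (∀ y ∈ U, LinearIndependent ℝ fun j => w j y) ∧
      ∀ a : H → T, (∀ y ∈ S, ContDiffAt ℝ ∞ a y) → ∃ f : Fin r → H → ℝ,
        (∀ j, ∀ y ∈ U, ContDiffAt ℝ ∞ (f j) y) ∧
        ∀ y ∈ U, a y ∈ Submodule.span ℝ (range fun j => w j y) → a y = ∑ j, f j y • w j y := by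
  let W : H → (Fin r → ℝ) →L[ℝ] T := fun y =>
    ∑ j, (ContinuousLinearMap.proj (R := ℝ) (φ := fun _ : Fin r => ℝ) j).smulRight (w j y)
  have hW : ∀ y c, W y c = ∑ j, c j • w j y := fun y c => by simp [W]
  have hWs : ∀ y ∈ S, ContDiffAt ℝ ∞ W y := fun y hy => by
    refine ContDiffAt.sum fun j _ => ?_
    exact (ContinuousLinearMap.smulRightL ℝ (Fin r → ℝ) T
      (ContinuousLinearMap.proj j)).contDiff.contDiffAt.comp y (hw j y hy)
  have hinj : LinearMap.ker (W y₀ : (Fin r → ℝ) →ₗ[ℝ] T) = ⊥ := by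
    rw [LinearMap.ker_eq_bot']
    intro c hc
    have := Fintype.linearIndependent_iff.1 hli c (by rw [← hW]; exact hc)
    exact funext this
  -- A left inverse `L` of `W y₀` makes `L ∘ W y` invertible near `y₀`; the coefficients of `a y`
  -- are then `(L ∘ W y)⁻¹ (L (a y))`.
  obtain ⟨lam, hlam⟩ := LinearMap.exists_leftInverse_of_injective _ hinj
  let L : T →L[ℝ] (Fin r → ℝ) := LinearMap.toContinuousLinearMap lam
  let A : H → (Fin r → ℝ) →L[ℝ] (Fin r → ℝ) := fun y => L ∘L W y
  have hA : ∀ y ∈ S, ContDiffAt ℝ ∞ A y := fun y hy =>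
    contDiffAt_const.clm_comp (hWs y hy)
  have hA₀ : A y₀ = ContinuousLinearMap.id ℝ _ := by
    ext1 c
    exact LinearMap.congr_fun hlam c
  have hU : ∀ᶠ y in 𝓝 y₀, (A y).IsInvertible := by
    have h1 := (hA y₀ hy₀).continuousAt
    have h2 : (A y₀).IsInvertible := by
      rw [hA₀]
      exact ⟨ContinuousLinearEquiv.refl ℝ _, rfl⟩
    obtain ⟨e, he⟩ := h2
    have h3 := ContinuousLinearEquiv.nhds e
    rw [he] at h3
    exact h1.eventually h3
  obtain ⟨U, hUA, hUo, hyU⟩ := eventually_nhds_iff.1 (hU.and (hS.mem_nhds hy₀))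
  refine ⟨U, hUo, hyU, fun y hy => (hUA y hy).2, fun y hy => ?_, fun a ha => ?_⟩
  · rw [Fintype.linearIndependent_iff]
    intro c hc
    have h1 : A y c = 0 := by
      change L (W y c) = 0
      rw [hW, hc, map_zero]
    obtain ⟨e, he⟩ := (hUA y hy).1
    rw [← he] at h1
    have : c = 0 := by simpa using h1
    exact fun j => congrFun this j
  · refine ⟨fun j y => (A y).inverse (L (a y)) j, fun j y hy => ?_, fun y hy hspan => ?_⟩
    · obtain ⟨e, he⟩ := (hUA y hy).1
      have h1 : ContDiffAt ℝ ∞ (fun y => (A y).inverse) y := by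
        have := contDiffAt_map_inverse (𝕜 := ℝ) (n := ∞) e
        rw [he] at this
        exact this.comp y (hA y (hUA y hy).2)
      have h2 : ContDiffAt ℝ ∞ (fun y => L (a y)) y :=
        L.contDiff.contDiffAt.comp y (ha y (hUA y hy).2)
      exact contDiffAt_pi.1 (h1.clm_apply h2) j
    · obtain ⟨c, hc⟩ := (Submodule.mem_span_range_iff_exists_fun ℝ).1 hspan
      rw [← hW] at hc
      have h1 : (A y).inverse (L (a y)) = c := by
        obtain ⟨e, he⟩ := (hUA y hy).1
        have : L (a y) = A y c := by rw [← hc]; rfl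
        rw [this, ← he]
        simp
      simp only [h1]
      rw [← hW, hc]

variable {E : Type*} [NormedAddCommGroup E] [NormedSpace ℝ E] [FiniteDimensional ℝ E]
  {X : Type*} [TopologicalSpace X] [ChartedSpace E X] [IsManifold 𝓘(ℝ, E) ∞ X] {l : ℕ}
  {V : Type*} [NormedAddCommGroup V] [NormedSpace ℝ V] {ΦV : Fin l → Spinor V}

omit [TopologicalSpace X] [ChartedSpace E X] [IsManifold 𝓘(ℝ, E) ∞ X] in
theorem mem_fibre (Φ : FormTuple E X l) (k : ℕ) (x : X) (φ : Fin l → Spinor E) :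
    φ ∈ fibre Φ k x ↔ φ ∈ cliff (Φ x) k := by
  rw [fibre, map_cliffordFiltration]

theorem mem_sections {Φ α : FormTuple E X l} {k : ℕ} :
    α ∈ sections Φ k ↔ α ∈ smoothForms E X l ∧ ∀ x, α x ∈ cliff (Φ x) k := by
  simp [sections, mem_fibre]

theorem glue_word_mem_sections {Φ : FormTuple E X l} (hΦ : Φ ∈ smoothForms E X l) {x₀ : X}
    {u : X → ℝ} (hu : ContMDiff 𝓘(ℝ, E) 𝓘(ℝ, ℝ) ∞ u)
    (hu' : tsupport u ⊆ (extChartAt 𝓘(ℝ, E) x₀).source) {k : ℕ} {ws : List (E × (E →L[ℝ] ℝ))}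
    (hk : ws.length ≤ k) (hk' : ws.length % 2 = k % 2) :
    glue x₀ u (fun y => word ws (rep x₀ Φ y)) ∈ sections Φ k := by
  refine mem_sections.2 ⟨glue_mem_smoothForms hu hu' fun y hy => contDiffAt_word_rep hΦ hy ws,
    fun x => ?_⟩
  by_cases hx : x ∈ (extChartAt 𝓘(ℝ, E) x₀).source
  · obtain ⟨L, hL⟩ := glue_word hx
    rw [hL]
    exact Submodule.smul_mem _ _ (word_mem_cliff _ (by simpa) (by simpa))
  · rw [glue, if_neg hx]
    exact zero_mem _

/-- Local frames of `CLᵏ · Φ` by words. -/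
theorem exists_local_frame {Φ : FormTuple E X l} (hΦ : Φ ∈ orbitSections E X ΦV) (k : ℕ) (x₀ : X)
    {r : ℕ} (hr : Module.finrank ℝ (cliff (Φ x₀) k) = r) :
    ∃ (ws : Fin r → List (E × (E →L[ℝ] ℝ))) (U : Set X),
      (∀ j, (ws j).length ≤ k ∧ (ws j).length % 2 = k % 2) ∧ IsOpen U ∧ x₀ ∈ U ∧
      U ⊆ (extChartAt 𝓘(ℝ, E) x₀).source ∧
      (∀ x ∈ U, LinearIndependent ℝ fun j => word (ws j) (rep x₀ Φ (extChartAt 𝓘(ℝ, E) x₀ x))) ∧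
      ∀ α ∈ sections Φ k, ∃ f : Fin r → X → ℝ,
        (∀ j, ∀ x ∈ U, ContMDiffAt 𝓘(ℝ, E) 𝓘(ℝ, ℝ) ∞ (f j) x) ∧
        ∀ x ∈ U, rep x₀ α (extChartAt 𝓘(ℝ, E) x₀ x) =
          ∑ j, f j x • word (ws j) (rep x₀ Φ (extChartAt 𝓘(ℝ, E) x₀ x)) := by
  subst hr
  obtain ⟨ws, hws, hli⟩ := exists_word_basis (Φ x₀) k
  have hy₀ := mem_extChartAt_target (I := 𝓘(ℝ, E)) x₀
  have htr : ∀ {ι : Type} (v : ι → Fin l → Spinor E),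
      LinearIndependent ℝ v ↔ LinearIndependent ℝ fun j => truncT E l (v j) := fun v =>
    ((truncT E l).toLinearMap.linearIndependent_iff (LinearEquiv.ker _)).symm
  have hli' : LinearIndependent ℝ fun j => truncT E l (word (ws j)
      (rep x₀ Φ (extChartAt 𝓘(ℝ, E) x₀ x₀))) := by
    rw [← htr, rep_self]
    exact hli
  obtain ⟨U, hUo, hyU, hUS, hUli, hUa⟩ := exists_contDiffAt_coeff
    (w := fun j y => truncT E l (word (ws j) (rep x₀ Φ y)))
    (isOpen_extChartAt_target (I := 𝓘(ℝ, E)) x₀)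
    (fun j y hy => contDiffAt_truncT.2 (contDiffAt_word_rep hΦ.1 hy (ws j))) hy₀ hli'
  refine ⟨ws, (extChartAt 𝓘(ℝ, E) x₀).source ∩ extChartAt 𝓘(ℝ, E) x₀ ⁻¹' U, hws,
    (continuousOn_extChartAt x₀).isOpen_inter_preimage (isOpen_extChartAt_source x₀) hUo,
    ⟨mem_extChartAt_source x₀, hyU⟩, inter_subset_left, fun x hx => (htr _).2 (hUli _ hx.2),
    fun α hα => ?_⟩
  rw [mem_sections] at hα
  obtain ⟨f, hf, hfa⟩ := hUa (fun y => truncT E l (rep x₀ α y))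
    (fun y hy => contDiffAt_truncT.2 (contDiffAt_rep hα.1 hy))
  refine ⟨fun j x => f j (extChartAt 𝓘(ℝ, E) x₀ x), fun j x hx => ?_, fun x hx => ?_⟩
  · exact (hf j _ hx.2).contMDiffAt.comp x (contMDiffAt_chart hx.1)
  · set y := extChartAt 𝓘(ℝ, E) x₀ x
    have hy : y ∈ (extChartAt 𝓘(ℝ, E) x₀).target := hUS hx.2
    have horb : rep x₀ Φ y ∈ orbit ΦV E := (rep_mem_orbit hy Φ).2 (hΦ.2 _)
    have hmem : rep x₀ α y ∈ cliff (rep x₀ Φ y) k := (rep_mem_cliff hy α Φ k).2 (hα.2 _)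
    -- Constancy of the rank along the orbit turns words that are merely independent at `y` into a
    -- spanning set there.
    rw [← span_word_basis (finrank_cliff_eq horb (hΦ.2 x₀) k) hws ((htr _).2 (hUli _ hx.2))] at hmem
    have h1 := hfa y hx.2 (by
      have := Submodule.mem_map_of_mem (f := (truncT E l).toLinearMap) hmem
      rw [Submodule.map_span, ← range_comp] at this
      exact this)
    apply (truncT E l).injective
    rw [map_sum]
    simpa only [map_smul] using h1

theorem contMDiff_mul_of_tsupport {ρ f : X → ℝ} (hρ : ContMDiff 𝓘(ℝ, E) 𝓘(ℝ, ℝ) ∞ ρ)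
    (hf : ∀ x ∈ tsupport ρ, ContMDiffAt 𝓘(ℝ, E) 𝓘(ℝ, ℝ) ∞ f x) :
    ContMDiff 𝓘(ℝ, E) 𝓘(ℝ, ℝ) ∞ (ρ * f) := by
  intro x
  by_cases hx : x ∈ tsupport ρ
  · exact hρ.contMDiffAt.mul (hf x hx)
  · refine (contMDiffAt_const (c := (0 : ℝ))).congr_of_eventuallyEq ?_
    filter_upwards [(isClosed_tsupport ρ).isOpen_compl.mem_nhds hx] with z hz
    simp [image_eq_zero_of_notMem_tsupport hz]

variable [T2Space X] [CompactSpace X]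

/-- Words forming a basis at `x₀` remain one nearby because the rank is constant. A bump function
makes them global sections without changing them where it equals `1`. -/
theorem isVectorBundle {Φ : FormTuple E X l} (hΦ : Φ ∈ orbitSections E X ΦV) (k : ℕ) :
    IsVectorBundle Φ k := by
  rcases isEmpty_or_nonempty X with h | ⟨⟨x₁⟩⟩
  · exact ⟨0, fun x => h.elim x⟩
  refine ⟨Module.finrank ℝ (cliff (Φ x₁) k), fun x₀ => ?_⟩
  obtain ⟨ws, U, hws, hUo, hxU, hUs, hUli, -⟩ := exists_local_frame hΦ k x₀
    (finrank_cliff_eq (hΦ.2 x₀) (hΦ.2 x₁) k)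
  obtain ⟨ρ, -, hρ⟩ := (SmoothBumpFunction.nhds_basis_tsupport (I := 𝓘(ℝ, E)) x₀).mem_iff.1
    (hUo.mem_nhds hxU)
  have h1 : ∀ᶠ x in 𝓝 x₀, ρ x = 1 ∧ x ∈ U := ρ.eventuallyEq_one.and (hUo.mem_nhds hxU)
  refine ⟨{x | ρ x = 1 ∧ x ∈ U}, h1, fun j => glue x₀ ρ fun y => word (ws j) (rep x₀ Φ y),
    fun j => glue_word_mem_sections hΦ.1 ρ.contMDiff (hρ.trans hUs) (hws j).1 (hws j).2, ?_⟩
  rintro x ⟨hx1, hx2⟩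
  have hli := hUli x hx2
  have hy := (extChartAt 𝓘(ℝ, E) x₀).map_source (hUs hx2)
  obtain ⟨L, hL⟩ := glue_word (hUs hx2)
  have h2 : ∀ j, glue x₀ ρ (fun y => word (ws j) (rep x₀ Φ y)) x =
      word ((ws j).map (pullW L)) (Φ x) := fun j => by rw [hL, hx1, one_smul]
  have h3 : LinearIndependent ℝ fun j => word ((ws j).map (pullW L)) (Φ x) := by
    obtain ⟨M, hM, hM'⟩ := exists_equiv_chart hy
    rw [(extChartAt 𝓘(ℝ, E) x₀).left_inv (hUs hx2)] at hM'
    have h4 : ∀ φ : Fin l → Spinor E, pullT l (M.symm : E →L[ℝ] E) φ = 0 → φ = 0 := fun φ hφ => by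
      have := congrArg (pullSpinor (M : E →L[ℝ] E)) hφ
      rw [pullT_apply, pullSpinor_pullSpinor_symm] at this
      exact this
    have h5 := hli.map' (pullT l (M.symm : E →L[ℝ] E)) (LinearMap.ker_eq_bot'.2 h4)
    have h6 : (fun j => word ((ws j).map (pullW L)) (Φ x)) = pullT l (M.symm : E →L[ℝ] E) ∘
        fun j => word (ws j) (rep x₀ Φ (extChartAt 𝓘(ℝ, E) x₀ x)) := by
      funext j
      rw [← h2 j, glue_of_mem (hUs hx2), hx1, one_smul, ← hM']
      rfl
    exact h6 ▸ h5
  simp only [h2]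
  refine ⟨h3, ?_⟩
  rw [span_word_basis (finrank_cliff_eq (hΦ.2 x) (hΦ.2 x₁) k) (fun j => by simpa using hws j) h3]
  exact (map_cliffordFiltration _ _).symm

/-- A property of sections of `CLᵏ · Φ` which is additive holds if it holds for words in charts. -/
theorem sections_induction {Φ : FormTuple E X l} (hΦ : Φ ∈ orbitSections E X ΦV) {k : ℕ}
    {P : FormTuple E X l → Prop} (h0 : P 0) (hadd : ∀ α β, P α → P β → P (α + β))
    (hw : ∀ (x₀ : X) (u : X → ℝ) (ws : List (E × (E →L[ℝ] ℝ))),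
      ContMDiff 𝓘(ℝ, E) 𝓘(ℝ, ℝ) ∞ u → tsupport u ⊆ (extChartAt 𝓘(ℝ, E) x₀).source →
      ws.length ≤ k → ws.length % 2 = k % 2 → P (glue x₀ u fun y => word ws (rep x₀ Φ y)))
    {α : FormTuple E X l} (hα : α ∈ sections Φ k) : P α := by
  rcases isEmpty_or_nonempty X with h | ⟨⟨x₁⟩⟩
  · rwa [show α = 0 from funext fun x => h.elim x]
  choose ws U hws hUo hxU hUs _ hUf using fun x₀ : X => exists_local_frame hΦ k x₀
    (finrank_cliff_eq (hΦ.2 x₀) (hΦ.2 x₁) k)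
  choose f hf hfα using fun x₀ => hUf x₀ α hα
  obtain ⟨S, hS⟩ := isCompact_univ.elim_finite_subcover U hUo
    fun x _ => mem_iUnion.2 ⟨x, hxU x⟩
  obtain ⟨ρ, hρ⟩ := SmoothPartitionOfUnity.exists_isSubordinate 𝓘(ℝ, E)
    (isClosed_univ (X := X)) (fun i : S => U i) (fun i => hUo i) (by
      intro x hx
      obtain ⟨i, hi, hxi⟩ := mem_iUnion₂.1 (hS hx)
      exact mem_iUnion.2 ⟨⟨i, hi⟩, hxi⟩)
  -- The local coefficients are smooth only on `U i`; multiplied by a partition function supported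
  -- there they become globally smooth cut-offs.
  have hu : ∀ (i : S) j, ContMDiff 𝓘(ℝ, E) 𝓘(ℝ, ℝ) ∞ ((ρ i : X → ℝ) * f i j) := fun i j =>
    contMDiff_mul_of_tsupport (ρ i).contMDiff fun x hx => hf i j x (hρ i hx)
  have hts : ∀ (i : S) j, tsupport ((ρ i : X → ℝ) * f i j) ⊆ (extChartAt 𝓘(ℝ, E) (i : X)).source := fun i j =>
    (tsupport_mul_subset_left).trans ((hρ i).trans (hUs i))
  have hsum : α = ∑ i : S, ∑ j, glue (i : X) ((ρ i : X → ℝ) * f i j)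
      (fun y => word (ws i j) (rep (i : X) Φ y)) := by
    funext x
    have h1 : ∑ i : S, ρ i x = 1 := by
      rw [← finsum_eq_sum_of_fintype]
      exact ρ.sum_eq_one (mem_univ x)
    conv_lhs => rw [← one_smul ℝ (α x), ← h1, Finset.sum_smul]
    rw [Finset.sum_apply]
    refine Finset.sum_congr rfl fun i _ => ?_
    rw [Finset.sum_apply]
    by_cases hx : x ∈ tsupport (ρ i)
    · have hxi := hρ i hx
      rw [← glue_rep ((hρ i).trans (hUs i)), glue_of_mem (hUs i hxi), hfα i x hxi, ← pullT_apply,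
        map_sum, Finset.smul_sum]
      refine Finset.sum_congr rfl fun j _ => ?_
      rw [glue_of_mem (hUs i hxi), map_smul, smul_smul]
      rfl
    · have h0 : ρ i x = 0 := image_eq_zero_of_notMem_tsupport hx
      rw [h0, zero_smul]
      refine (Finset.sum_eq_zero fun j _ => ?_).symm
      rw [glue_eq_zero]
      simp [h0]
  rw [hsum]
  refine Finset.sum_induction _ P hadd h0 fun i _ => Finset.sum_induction _ P hadd h0 fun j _ => ?_
  exact hw _ _ _ (hu i j) (hts i j) (hws i j).1 (hws i j).2

end Frames

end

section

open Filter Set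

/-! ### Linear and Leibniz rules for derivatives of tuples. -/

section TupleCalculus

variable {E : Type*} [NormedAddCommGroup E] [NormedSpace ℝ E] [FiniteDimensional ℝ E] {l : ℕ}

theorem HasDerivAt.linear_tuple {c : ℝ → Fin l → Spinor E} {c' : Fin l → Spinor E} {t : ℝ}
    (h : ∀ i p, HasDerivAt (fun s => c s i p) (c' i p) t)
    (T : Module.End ℝ (Fin l → Spinor E)) (i : Fin l) (p : ℕ) :
    HasDerivAt (fun s => T (c s) i p) (T c' i p) t := by
  let L := LinearMap.toContinuousLinearMap ((truncT E l).toLinearMap ∘ₗ T ∘ₗ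
    (truncT E l).symm.toLinearMap)
  have h1 : HasDerivAt (fun s => L (truncT E l (c s))) (L (truncT E l c')) t :=
    L.hasFDerivAt.comp_hasDerivAt t (hasDerivAt_truncT h)
  have h2 : ∀ φ, L (truncT E l φ) = truncT E l (T φ) := fun φ => by simp [L]
  simp only [h2] at h1
  by_cases hp : p < Module.finrank ℝ E + 1
  · exact hasDerivAt_pi.1 (hasDerivAt_pi.1 h1 i) ⟨p, hp⟩
  · have h3 : ∀ φ : Fin l → Spinor E, φ i p = 0 := fun φ => form_eq_zero (by omega) _
    simp only [h3]
    exact hasDerivAt_const t _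

omit [FiniteDimensional ℝ E] in
theorem hasDerivAt_line {F : Type*} [NormedAddCommGroup F] [NormedSpace ℝ F] {f : E → F} {y v : E}
    {t : ℝ} (hf : DifferentiableAt ℝ f (y + t • v)) :
    HasDerivAt (fun t : ℝ => f (y + t • v)) (fderiv ℝ f (y + t • v) v) t := by
  have hl : HasDerivAt (fun t : ℝ => y + t • v) v t := by
    simpa using ((hasDerivAt_id t).smul_const v).const_add y
  exact hf.hasFDerivAt.comp_hasDerivAt t hl

theorem tupleDeriv_linear {c : E → Fin l → Spinor E} {y : E}
    (h : ∀ i p, ContDiffAt ℝ ∞ (fun z => c z i p) y) (T : Module.End ℝ (Fin l → Spinor E)) :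
    tupleDeriv (fun z => T (c z)) y = T ∘ₗ tupleDeriv c y := by
  ext1 v
  funext i p
  have h1 : ContDiffAt ℝ ∞ (fun z => T (c z) i p) y :=
    contDiffWithinAt_univ.1 (ContDiffWithinAt.linear_tuple (fun i p => (h i p).contDiffWithinAt) T i p)
  have h0 : y + (0 : ℝ) • v = y := by simp
  have key : ∀ {F : Type _} [NormedAddCommGroup F] [NormedSpace ℝ F] {f : E → F},
      ContDiffAt ℝ ∞ f y → HasDerivAt (fun t : ℝ => f (y + t • v)) (fderiv ℝ f y v) 0 := by
    intro F _ _ f hf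
    have h2 := hasDerivAt_line (v := v) (t := 0) (f := f) (y := y)
      (by rw [h0]; exact hf.differentiableAt (by simp))
    rwa [h0] at h2
  exact (key h1).unique (HasDerivAt.linear_tuple (c' := tupleDeriv c y v)
    (fun i p => key (h i p)) T i p)

theorem tupleDeriv_smul {c : E → Fin l → Spinor E} {f : E → ℝ} {y : E}
    (h : ∀ i p, ContDiffAt ℝ ∞ (fun z => c z i p) y) (hf : ContDiffAt ℝ ∞ f y) :
    tupleDeriv (fun z => f z • c z) y =
      f y • tupleDeriv c y + ((fderiv ℝ f y : E →L[ℝ] ℝ) : E →ₗ[ℝ] ℝ).smulRight (c y) := by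
  ext1 v
  funext i p
  have := ((hf.differentiableAt (by simp)).hasFDerivAt.smul
    ((h i p).differentiableAt (by simp)).hasFDerivAt).fderiv
  have h2 := congrArg (fun g => g v) this
  simpa using! h2

end TupleCalculus

/-! ### The derivative raises the filtration by one. -/

section Complex

variable {E : Type*} [NormedAddCommGroup E] [NormedSpace ℝ E] [FiniteDimensional ℝ E]
  {X : Type*} [TopologicalSpace X] [ChartedSpace E X] [IsManifold 𝓘(ℝ, E) ∞ X] {l : ℕ}
  {V : Type*} [NormedAddCommGroup V] [NormedSpace ℝ V] {ΦV : Fin l → Spinor V}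

/-- The restriction of `Φ` to the line `y + t v` is a smooth curve in the orbit, so its velocity at
`t = 0` lies in `CL²`. -/
theorem tupleDeriv_mem_cliff {Φ : FormTuple E X l} (hΦ : Φ ∈ orbitSections E X ΦV) {x₀ : X} {y : E}
    (hy : y ∈ (extChartAt 𝓘(ℝ, E) x₀).target) (v : E) :
    tupleDeriv (rep x₀ Φ) y v ∈ cliff (rep x₀ Φ y) 2 := by
  have hlc : Continuous fun t : ℝ => y + t • v := by fun_prop
  have h0 : y + (0 : ℝ) • v = y := by simp
  have := deriv_mem_cliff_two (ΦV := ΦV)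
    ((isOpen_extChartAt_target (I := 𝓘(ℝ, E)) x₀).preimage hlc)
    (c := fun t => rep x₀ Φ (y + t • v)) (c' := fun t => tupleDeriv (rep x₀ Φ) (y + t • v) v)
    (fun t ht => (rep_mem_orbit ht Φ).2 (hΦ.2 _))
    (fun t ht i p => hasDerivAt_line (f := fun z => rep x₀ Φ z i p)
      ((contDiffAt_rep hΦ.1 ht i p).differentiableAt (by simp)))
    (t₀ := 0) (by simpa [mem_preimage] using hy) (fun i p => by
      have h1 : ContDiffAt ℝ ∞ (fun z => fderiv ℝ (fun z => rep x₀ Φ z i p) z v) (y + (0 : ℝ) • v) := by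
        rw [h0]
        exact ((contDiffAt_rep hΦ.1 hy i p).fderiv_right (m := ∞) (by simp)).clm_apply
          contDiffAt_const
      exact ContinuousAt.comp (f := fun t : ℝ => y + t • v) h1.continuousAt hlc.continuousAt)
  simpa only [h0] using this

theorem rep_zero (x₀ : X) (y : E) : rep x₀ (0 : FormTuple E X l) y = 0 := rfl

theorem altT_tupleDeriv_eq_zero {Φ : FormTuple E X l} (hΦ : Φ ∈ structures E X ΦV) {x₀ : X} {y : E}
    (hy : y ∈ (extChartAt 𝓘(ℝ, E) x₀).target) : altT (tupleDeriv (rep x₀ Φ) y) = 0 := by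
  rw [← rep_d hΦ.1.1 hy, hΦ.2, rep_zero]

variable [T2Space X] [CompactSpace X]

theorem d_mem_sections {Φ : FormTuple E X l} (hΦ : Φ ∈ structures E X ΦV) {k : ℕ}
    {α : FormTuple E X l} (hα : α ∈ sections Φ k) : d α ∈ sections Φ (k + 1) := by
  suffices h : α ∈ smoothForms E X l ∧ d α ∈ sections Φ (k + 1) from h.2
  -- Smoothness is carried along in the induction, since additivity of `d` requires it.
  refine sections_induction hΦ.1 (P := fun α => α ∈ smoothForms E X l ∧ d α ∈ sections Φ (k + 1))
    ⟨zero_mem _, by rw [d_zero]; exact zero_mem _⟩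
    (fun α β h1 h2 => ⟨add_mem h1.1 h2.1, by rw [d_add h1.1 h2.1]; exact add_mem h1.2 h2.2⟩)
    (fun x₀ u ws hu hu' hk hk' => ?_) hα
  have hs := (mem_sections.1 (glue_word_mem_sections hΦ.1.1 hu hu' hk hk')).1
  refine ⟨hs, mem_sections.2 ⟨d_mem_smoothForms hs, fun x => ?_⟩⟩
  by_cases hx : x ∈ (extChartAt 𝓘(ℝ, E) x₀).source
  · have hy := (extChartAt 𝓘(ℝ, E) x₀).map_source hx
    set y := extChartAt 𝓘(ℝ, E) x₀ x with hyx
    have hxy : (extChartAt 𝓘(ℝ, E) x₀).symm y = x := (extChartAt 𝓘(ℝ, E) x₀).left_inv hx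
    have key := (rep_mem_cliff hy (d (glue x₀ u fun y => word ws (rep x₀ Φ y))) Φ (k + 1)).1
    rw [hxy] at key
    apply key
    rw [rep_d hs hy]
    let f : E → ℝ := fun z => u ((extChartAt 𝓘(ℝ, E) x₀).symm z)
    have h1 : tupleDeriv (rep x₀ (glue x₀ u fun y => word ws (rep x₀ Φ y))) y =
        tupleDeriv (fun z => f z • word ws (rep x₀ Φ z)) y := by
      ext1 v
      funext i p
      rw [tupleDeriv_apply, tupleDeriv_apply]
      congr 1
      refine Filter.EventuallyEq.fderiv_eq ?_
      filter_upwards [(isOpen_extChartAt_target x₀).mem_nhds hy] with z hz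
      rw [rep_glue hz]
    rw [h1, tupleDeriv_smul (contDiffAt_word_rep hΦ.1.1 hy ws) (contDiffAt_comp_chart_symm hu hy),
      tupleDeriv_linear (contDiffAt_rep hΦ.1.1 hy), map_add, map_smul, altT_smulRight]
    refine add_mem (Submodule.smul_mem _ _ ?_) ?_
    · have h2 := altT_word_mem_cliff (fun v => tupleDeriv_mem_cliff hΦ.1 hy v)
        (altT_tupleDeriv_eq_zero hΦ hy) ws
      -- Words may be shorter than `k` by an even number of letters; the bound for their own length
      -- is raised by `cliff_mono`.
      obtain ⟨m, rfl⟩ : ∃ m, k = ws.length + 2 * m := ⟨(k - ws.length) / 2, by omega⟩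
      clear * - h2
      induction m with
      | zero => exact h2
      | succ m ih => exact cliff_mono _ _ ih
    · exact tact_mem_cliff _ (word_mem_cliff _ hk hk')
  · rw [d_glue_of_notMem hu' _ hx]
    exact zero_mem _

end Complex

/-! ### Sections of `CL² · Φ` as velocities of curves in the orbit. -/

section Tangent

variable {E : Type*} [NormedAddCommGroup E] [NormedSpace ℝ E] [FiniteDimensional ℝ E]
  {X : Type*} [TopologicalSpace X] [ChartedSpace E X] [IsManifold 𝓘(ℝ, E) ∞ X] {l : ℕ}
  {V : Type*} [NormedAddCommGroup V] [NormedSpace ℝ V] {ΦV : Fin l → Spinor V}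

theorem mem_sections_of_velocity {Φ : FormTuple E X l} {Ψ : ℝ → FormTuple E X l}
    (hΨ : IsCurveInOrbit ΦV Φ Ψ) {α : FormTuple E X l} (hα : HasVelocity Ψ α) :
    α ∈ sections Φ 2 := by
  refine mem_sections.2 ⟨fun i p => isSmooth_velocity (hΨ.1 i p) fun x => hα x i p, fun x => ?_⟩
  have hs : ∀ i p, ContDiff ℝ ∞ fun t => Ψ t x i p := fun i p => contDiff_iff_contDiffAt.2 fun t => by
    have h1 : ContDiffAt ℝ ∞ (fun t : ℝ => chartRep x (fun x => Ψ t x i p)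
        (extChartAt 𝓘(ℝ, E) x x)) t :=
      ContDiffAt.comp t (f := fun t : ℝ => (t, extChartAt 𝓘(ℝ, E) x x))
        ((hΨ.1 i p).contDiffAt (mem_extChartAt_target x) t) (by fun_prop)
    simpa only [chartRep_self] using h1
  have h1 := deriv_mem_cliff_two (ΦV := ΦV) isOpen_univ (c := fun t => Ψ t x)
    (c' := fun t i p => deriv (fun t => Ψ t x i p) t) (fun t _ => (hΨ.2.1 t).2 x)
    (fun t _ i p => ((hs i p).differentiable (by simp) t).hasDerivAt) (mem_univ 0)
    (fun i p => ((hs i p).continuous_deriv (by simp)).continuousAt)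
  have h2 : (fun i p => deriv (fun t => Ψ t x i p) 0) = α x := by
    funext i p
    exact (hα x i p).deriv
  rwa [h2, hΨ.2.2] at h1

/-- Small multiples of even words of length at most two exponentiate to the group. -/
theorem exists_cpin_one_add_word {ws : List (E × (E →L[ℝ] ℝ))} (hk : ws.length ≤ 2)
    (hk' : ws.length % 2 = 0) :
    ∃ K : ℝ, 0 < K ∧ ∀ (L : E ≃L[ℝ] E) (s : ℝ), 4 * K * s ^ 2 ≤ 1 → ∃ g ∈ cpin E,
      ∀ {l : ℕ} (φ : Fin l → Spinor E),
        act (g : CL E) φ = φ + s • word (ws.map (pullW L)) φ := by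
  match ws, hk, hk' with
  | [], _, _ =>
    -- With `K = 1` the condition gives `|s| ≤ 1/2`, so the scalar `1 + s` is invertible.
    refine ⟨1, one_pos, fun L s hs => ?_⟩
    obtain ⟨g, hg, h⟩ := exists_cpin_smul (V := E) (1 + s) (by nlinarith)
    exact ⟨g, hg, fun φ => by rw [h, add_smul, one_smul]; rfl⟩
  | [a, b], _, _ =>
    set σ := a.2 b.1 + b.2 a.1 with hσ
    set q := a.2 a.1 * b.2 b.1 with hq
    -- This `K` gives `|s σ| ≤ 1/2` and `s² q ≥ -1/4`, hence norm `1 + s σ + s² q ≥ 1/4`. It is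
    -- independent of `L` because `pullW L` preserves the pairing.
    refine ⟨1 + σ ^ 2 + q ^ 2, by positivity, fun L s hs => ?_⟩
    obtain ⟨g, hg, h⟩ := exists_cpin_one_add_smul (pullW L a) (pullW L b) s (by
      have e1 : (pullW L a).2 (pullW L b).1 + (pullW L b).2 (pullW L a).1 = σ := by simp [pullW, hσ]
      have e2 : (pullW L a).2 (pullW L a).1 * (pullW L b).2 (pullW L b).1 = q := by simp [pullW, hq]
      rw [e1, e2]
      have h1 : (s * σ) ^ 2 ≤ 1 / 4 := by nlinarith [sq_nonneg s, sq_nonneg (s * q)]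
      have h2 : -(1 / 2) ≤ s * σ := by nlinarith
      have h3 : -(1 / 4) ≤ s ^ 2 * q := by
        nlinarith [mul_nonneg (sq_nonneg s) (sq_nonneg (q + 1)), sq_nonneg (s * σ),
          mul_nonneg (sq_nonneg s) (sq_nonneg q)]
      nlinarith)
    exact ⟨g, hg, fun φ => by rw [h]; simp⟩

variable [T2Space X] [CompactSpace X]

/-- The sections of `CL² · Φ` are velocities of curves. -/
theorem exists_curve_of_mem_sections {Φ : FormTuple E X l} (hΦ : Φ ∈ orbitSections E X ΦV)
    {α : FormTuple E X l} (hα : α ∈ sections Φ 2) :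
    ∃ Ψ, IsCurveInOrbit ΦV Φ Ψ ∧ HasVelocity Ψ α := by
  -- Curves in the orbit cannot be added, so a new summand is realized by modifying an arbitrary
  -- curve which already has velocity `β`.
  suffices h : ∀ Ψ β, IsCurveInOrbit ΦV Φ Ψ → HasVelocity Ψ β →
      ∃ Ψ', IsCurveInOrbit ΦV Φ Ψ' ∧ HasVelocity Ψ' (β + α) by
    have := h (fun _ => Φ) 0 ⟨fun i p => (hΦ.1 i p).family, fun _ => hΦ, rfl⟩
      fun x i p => hasDerivAt_const _ _
    rwa [zero_add] at this
  refine sections_induction hΦ (P := fun α => ∀ Ψ β, IsCurveInOrbit ΦV Φ Ψ → HasVelocity Ψ β →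
      ∃ Ψ', IsCurveInOrbit ΦV Φ Ψ' ∧ HasVelocity Ψ' (β + α)) (fun Ψ β h1 h2 => ?_)
      (fun α α' h h' Ψ β h1 h2 => ?_) (fun x₀ u ws hu hu' hk hk' Ψ β h1 h2 => ?_) hα
  · exact ⟨Ψ, h1, by rwa [add_zero]⟩
  · obtain ⟨Ψ', h3, h4⟩ := h Ψ β h1 h2
    rw [← add_assoc]
    exact h' Ψ' _ h3 h4
  obtain ⟨K, hK, hKg⟩ := exists_cpin_one_add_word hk hk'
  -- For `x = t u`, the multiplier `x / (1 + K x²)` satisfies `4 K s² ≤ 1` for every real `x`, so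
  -- the group element exists for all times; the factor `r` has derivative `1` at `t = 0`.
  let r : ℝ → E → ℝ := fun t y => t / (1 + K * (t * u ((extChartAt 𝓘(ℝ, E) x₀).symm y)) ^ 2)
  have hpos : ∀ a : ℝ, 0 < 1 + K * a ^ 2 := fun a => by positivity
  let Θ : ℝ → FormTuple E X l := fun t => glue x₀ u fun y => r t y • word ws (rep x₀ (Ψ t) y)
  have hΘs : ∀ i p, IsSmoothFamily fun t x => Θ t x i p := fun i p => by
    refine isSmoothFamily_glue hu hu' fun t y hy => ?_
    have h3 : ContDiffAt ℝ ∞ (fun q : ℝ × E => r q.1 q.2) (t, y) := by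
      refine contDiffAt_fst.div (contDiffAt_const.add (contDiffAt_const.mul
        ((contDiffAt_fst.mul ?_).pow 2))) (hpos _).ne'
      exact ContDiffAt.comp (t, y) (f := Prod.snd) (contDiffAt_comp_chart_symm hu hy) contDiffAt_snd
    exact h3.smul (contDiffWithinAt_univ.1 (ContDiffWithinAt.linear_tuple
      (c := fun q : ℝ × E => rep x₀ (Ψ q.1) q.2) (fun i p =>
        ((h1.1 i p).contDiffAt hy t).contDiffWithinAt) (word ws) i p))
  have hΘx : ∀ x, x ∈ (extChartAt 𝓘(ℝ, E) x₀).source → ∃ L : E ≃L[ℝ] E, ∀ t, Θ t x =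
      (t / (1 + K * (t * u x) ^ 2)) • u x • word (ws.map (pullW L)) (Ψ t x) ∧
      glue x₀ u (fun y => word ws (rep x₀ Φ y)) x = u x • word (ws.map (pullW L)) (Φ x) := by
    intro x hx
    obtain ⟨L, hL⟩ := glue_word hx
    refine ⟨L, fun t => ⟨?_, hL Φ u ws⟩⟩
    simp only [Θ]
    rw [glue_smul, hL]
    simp only [r]
    rw [(extChartAt 𝓘(ℝ, E) x₀).left_inv hx]
  have hΘ0 : ∀ t x, x ∉ (extChartAt 𝓘(ℝ, E) x₀).source → Θ t x = 0 := fun t x hx => if_neg hx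
  refine ⟨fun t => Ψ t + Θ t, ⟨fun i p x => (h1.1 i p x).add (hΘs i p x), fun t =>
    ⟨add_mem (h1.2.1 t).1 fun i p => (hΘs i p).smooth t, fun x => ?_⟩, ?_⟩, fun x i p => ?_⟩
  · by_cases hx : x ∈ (extChartAt 𝓘(ℝ, E) x₀).source
    · obtain ⟨L, hL⟩ := hΘx x hx
      obtain ⟨g, hg, hgφ⟩ := hKg L (t / (1 + K * (t * u x) ^ 2) * u x) (by
        have hp := hpos (t * u x)
        rw [show t / (1 + K * (t * u x) ^ 2) * u x = (t * u x) / (1 + K * (t * u x) ^ 2) by ring,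
          div_pow, ← mul_div_assoc, div_le_one (by positivity)]
        nlinarith [sq_nonneg (1 - K * (t * u x) ^ 2)])
      change Ψ t x + Θ t x ∈ _
      rw [(hL t).1, smul_smul, ← hgφ]
      exact act_mem_orbit ((h1.2.1 t).2 x) hg
    · change Ψ t x + Θ t x ∈ _
      rw [hΘ0 t x hx, add_zero]
      exact (h1.2.1 t).2 x
  · funext x
    change Ψ 0 x + Θ 0 x = Φ x
    rw [h1.2.2]
    by_cases hx : x ∈ (extChartAt 𝓘(ℝ, E) x₀).source
    · obtain ⟨L, hL⟩ := hΘx x hx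
      rw [(hL 0).1, zero_div, zero_smul, add_zero]
    · rw [hΘ0 0 x hx, add_zero]
  · refine (h2 x i p).add ?_
    by_cases hx : x ∈ (extChartAt 𝓘(ℝ, E) x₀).source
    · obtain ⟨L, hL⟩ := hΘx x hx
      have e1 : (fun t => Θ t x i p) = fun t => (t / (1 + K * (t * u x) ^ 2)) •
          (u x • word (ws.map (pullW L))) (Ψ t x) i p := by
        funext t
        rw [(hL t).1]
        rfl
      have e2 : HasDerivAt (fun t : ℝ => t / (1 + K * (t * u x) ^ 2)) 1 0 := by
        have h3 : HasDerivAt (fun t : ℝ => 1 + K * (t * u x) ^ 2)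
            (K * (2 * (0 * u x) * u x)) 0 := by
          have := ((((hasDerivAt_id (0 : ℝ)).mul_const (u x)).pow 2).const_mul K).const_add 1
          simpa using this
        have := (hasDerivAt_id (0 : ℝ)).div h3 (hpos _).ne'
        simpa using! this
      have e3 := e2.smul (HasDerivAt.linear_tuple (h2 x) (u x • word (ws.map (pullW L))) i p)
      rw [e1, (hL 0).2]
      refine e3.congr_deriv ?_
      rw [h1.2.2]
      simp
    · simp only [hΘ0 _ x hx]
      rw [glue, if_neg hx]
      exact hasDerivAt_const _ _

end Tangent

end

section

open Filter Set

/-! ### One-forms, two-forms and vector fields acting on spinors; Cartan's formula. -/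

section OneForms

variable {E : Type*} [NormedAddCommGroup E] [NormedSpace ℝ E]

variable (E) in
/-- Covectors as 1-forms. -/
def oneForm : (E →L[ℝ] ℝ) ≃L[ℝ] E [⋀^Fin 1]→L[ℝ] ℝ :=
  (ContinuousAlternatingMap.ofSubsingletonLIE (𝕜 := ℝ) (E := E) (F := ℝ)
    (0 : Fin 1)).toContinuousLinearEquiv

theorem oneForm_apply (η : E →L[ℝ] ℝ) (w : Fin 1 → E) : oneForm E η w = η (w 0) := rfl

theorem oneForm_symm_apply (γ : E [⋀^Fin 1]→L[ℝ] ℝ) (v : E) :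
    (oneForm E).symm γ v = γ fun _ => v := by
  obtain ⟨η, rfl⟩ := (oneForm E).surjective γ
  rw [ContinuousLinearEquiv.symm_apply_apply, oneForm_apply]

theorem oneForm_comp (η : E →L[ℝ] ℝ) (L : E →L[ℝ] E) :
    (oneForm E η).compContinuousLinearMap L = oneForm E (η ∘L L) := rfl

/-- The interior product of a 2-form as a covector. -/
def insertTwo (b : E [⋀^Fin 2]→L[ℝ] ℝ) : E →L[ℝ] E →L[ℝ] ℝ :=
  ((oneForm E).symm : (E [⋀^Fin 1]→L[ℝ] ℝ) →L[ℝ] (E →L[ℝ] ℝ)) ∘L b.curryLeft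

theorem insertTwo_apply (b : E [⋀^Fin 2]→L[ℝ] ℝ) (v w : E) : insertTwo b v w = b ![v, w] := by
  rw [insertTwo, ContinuousLinearMap.comp_apply, ContinuousLinearEquiv.coe_coe, oneForm_symm_apply,
    ContinuousAlternatingMap.curryLeft_apply_apply]
  congr 1
  ext i
  fin_cases i <;> rfl

/-- The exterior derivative of a 1-form, contracted with two vectors. -/
theorem insertTwo_alternatize (N : E →L[ℝ] E [⋀^Fin 1]→L[ℝ] ℝ) (v w : E) :
    insertTwo (ContinuousAlternatingMap.alternatizeUncurryFin N) v w =
      (oneForm E).symm (N v) w - (oneForm E).symm (N w) v := by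
  rw [insertTwo_apply, ContinuousAlternatingMap.alternatizeUncurryFin_apply, Fin.sum_univ_two,
    oneForm_symm_apply, oneForm_symm_apply]
  have h0 : (0 : Fin 2).removeNth ![v, w] = fun _ => w := by ext i; fin_cases i; rfl
  have h1 : (1 : Fin 2).removeNth ![v, w] = fun _ => v := by ext i; fin_cases i; rfl
  rw [h0, h1]
  simp [sub_eq_add_neg]

variable [FiniteDimensional ℝ E] {l : ℕ}

/-- The linear map `v ↦ m(v) · φ`. -/
def tactMap (φ : Fin l → Spinor E) : (E →ₗ[ℝ] E × (E →L[ℝ] ℝ)) →ₗ[ℝ] E →ₗ[ℝ] Fin l → Spinor E where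
  toFun m := (LinearMap.flip tact φ) ∘ₗ m
  map_add' _ _ := LinearMap.comp_add _ _ _
  map_smul' _ _ := LinearMap.comp_smul _ _ _

theorem tactMap_apply (φ : Fin l → Spinor E) (m : E →ₗ[ℝ] E × (E →L[ℝ] ℝ)) (v : E) :
    tactMap φ m v = tact (m v) φ := rfl

theorem tact_covector (η : E →L[ℝ] ℝ) (φ : Fin l → Spinor E) (i : Fin l) :
    tact ((0 : E), η) φ i = wedge η (φ i) := by
  rw [tact_apply, vectorAction_apply, contract_zero_left, zero_add]

theorem tact_vector (v : E) (φ : Fin l → Spinor E) (i : Fin l) :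
    tact (v, (0 : E →L[ℝ] ℝ)) φ i = contract v (φ i) := by
  rw [tact_apply, vectorAction_apply]
  have : wedge (0 : E →L[ℝ] ℝ) (φ i) = 0 := by
    funext p
    cases p with
    | zero => rfl
    | succ p =>
      ext w
      simp [wedge_succ_apply]
  rw [this, add_zero]

theorem wedgeTwo_eq_altT (b : E [⋀^Fin 2]→L[ℝ] ℝ) (φ : Fin l → Spinor E) :
    (fun i => wedgeTwo b (φ i)) = (1 / 2 : ℝ) • altT (tactMap φ
      (LinearMap.inr ℝ E (E →L[ℝ] ℝ) ∘ₗ (insertTwo b : E →ₗ[ℝ] E →L[ℝ] ℝ))) := by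
  funext i p
  rw [Pi.smul_apply, Pi.smul_apply]
  match p with
  | 0 =>
    rw [altT_zero_apply, smul_zero]
    rfl
  | 1 =>
    rw [altT_succ_apply _ i 0 0 fun v => ?_]
    · ext w
      simp [wedgeTwo, ContinuousAlternatingMap.alternatizeUncurryFin_apply]
    · rw [tactMap_apply]
      change tact ((0 : E), insertTwo b v) φ i 0 = 0
      rw [tact_covector]
      rfl
  | p + 2 =>
    rw [altT_succ_apply _ i (p + 1) _ fun v => ?_]
    · rfl
    · rw [tactMap_apply]
      change tact ((0 : E), insertTwo b v) φ i (p + 1) = _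
      rw [tact_covector]
      rfl

/-- The square of a covector field: only the antisymmetric part of `N` contributes. -/
theorem altT_covector (N : E →L[ℝ] E [⋀^Fin 1]→L[ℝ] ℝ) (φ : Fin l → Spinor E) :
    altT (tactMap φ (LinearMap.inr ℝ E (E →L[ℝ] ℝ) ∘ₗ
      (((oneForm E).symm : (E [⋀^Fin 1]→L[ℝ] ℝ) →L[ℝ] (E →L[ℝ] ℝ)) ∘L N : E →ₗ[ℝ] E →L[ℝ] ℝ))) =
      fun i => wedgeTwo (ContinuousAlternatingMap.alternatizeUncurryFin N) (φ i) := by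
  rw [wedgeTwo_eq_altT]
  set θ : E → E →L[ℝ] ℝ := fun v => (oneForm E).symm (N v) with hθ
  have hcov : ∀ η : E →L[ℝ] ℝ, ((0 : E), η) = ∑ j, η (bas E j) • ((0 : E), dbas (V := E) j) := by
    intro η
    conv_lhs => rw [← sum_dbas_smul η]
    simp [Prod.ext_iff, Prod.fst_sum, Prod.snd_sum]
  let e : Fin (Module.finrank ℝ E) → Module.End ℝ (Fin l → Spinor E) :=
    fun i => tact ((0 : E), dbas i)
  have hexp : ∀ (g : E → E →L[ℝ] ℝ), ∑ i, tact ((0 : E), dbas i) (tact ((0 : E), g (bas E i)) φ) =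
      ∑ i, ∑ j, g (bas E i) (bas E j) • e i (e j φ) := by
    intro g
    refine Finset.sum_congr rfl fun i _ => ?_
    rw [hcov (g (bas E i)), map_sum, LinearMap.sum_apply, map_sum]
    refine Finset.sum_congr rfl fun j _ => ?_
    rw [map_smul, LinearMap.smul_apply, map_smul]
  have hanti : ∀ i j, e i (e j φ) = - e j (e i φ) := by
    intro i j
    rw [eq_neg_iff_add_eq_zero]
    simp only [e]
    rw [tact_anticomm]
    simp
  rw [altT_apply, altT_apply]
  change ∑ i, tact ((0 : E), dbas i) (tact ((0 : E), θ (bas E i)) φ) = (1 / 2 : ℝ) • ∑ i,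
    tact ((0 : E), dbas i) (tact ((0 : E),
      insertTwo (ContinuousAlternatingMap.alternatizeUncurryFin N) (bas E i)) φ)
  rw [hexp, hexp]
  simp only [insertTwo_alternatize, sub_smul, Finset.sum_sub_distrib]
  -- Since `eⁱ eʲ` is antisymmetric, transposing the coefficients changes the sign; the two terms of
  -- the antisymmetrization agree and cancel the factor `1/2` in `wedgeTwo`.
  have hswap : ∑ i, ∑ j, (oneForm E).symm (N (bas E j)) (bas E i) • e i (e j φ) =
      - ∑ i, ∑ j, θ (bas E i) (bas E j) • e i (e j φ) := by
    rw [Finset.sum_comm, ← Finset.sum_neg_distrib]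
    refine Finset.sum_congr rfl fun i _ => ?_
    rw [← Finset.sum_neg_distrib]
    refine Finset.sum_congr rfl fun j _ => ?_
    rw [hanti, smul_neg]
  rw [hswap, sub_neg_eq_add, ← two_smul ℝ, smul_smul]
  simp [hθ]

/-- The infinitesimal action of `M ∈ End(E)` on forms by pull-back. -/
theorem altT_vector (M : E →L[ℝ] E) (φ : Fin l → Spinor E) (i : Fin l) (p : ℕ) :
    altT (tactMap φ (LinearMap.inl ℝ E (E →L[ℝ] ℝ) ∘ₗ (M : E →ₗ[ℝ] E))) i p =
      (φ i p).fderivCompContinuousLinearMap (ContinuousLinearMap.id ℝ E) M := by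
  cases p with
  | zero =>
    rw [altT_zero_apply]
    ext w
    simp
  | succ p =>
    rw [altT_succ_apply _ i p ((φ i (p + 1)).curryLeft ∘L M) fun v => ?_]
    · rw [ContinuousAlternatingMap.fderivCompContinuousLinearMap_eq_alternatizeUncurryFin]
      rfl
    · rw [tactMap_apply]
      change tact (M v, (0 : E →L[ℝ] ℝ)) φ i p = _
      rw [tact_vector]
      rfl

/-- Expanding the letter in a fixed basis reduces variable letters to scalar functions times fixed
operators. -/
theorem tact_eq_sum (a : E × (E →L[ℝ] ℝ)) (φ : Fin l → Spinor E) (i : Fin l) (p : ℕ) :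
    tact a φ i p = ∑ j, LinearMap.toContinuousLinearMap
      ((Module.finBasis ℝ (E × (E →L[ℝ] ℝ))).coord j) a •
        tact (Module.finBasis ℝ (E × (E →L[ℝ] ℝ)) j) φ i p := by
  conv_lhs => rw [← (Module.finBasis ℝ (E × (E →L[ℝ] ℝ))).sum_repr a]
  rw [map_sum, LinearMap.sum_apply, Finset.sum_apply, Finset.sum_apply]
  refine Finset.sum_congr rfl fun j _ => ?_
  rw [map_smul]
  rfl

theorem contDiffAt_tact {H : Type*} [NormedAddCommGroup H] [NormedSpace ℝ H]
    {a : H → E × (E →L[ℝ] ℝ)} {c : H → Fin l → Spinor E} {y : H}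
    (ha : ContDiffAt ℝ ∞ a y) (hc : ∀ i p, ContDiffAt ℝ ∞ (fun z => c z i p) y) (i : Fin l) (p : ℕ) :
    ContDiffAt ℝ ∞ (fun z => tact (a z) (c z) i p) y := by
  simp only [tact_eq_sum (a _)]
  refine ContDiffAt.sum fun j _ => ?_
  exact ((LinearMap.toContinuousLinearMap
    ((Module.finBasis ℝ (E × (E →L[ℝ] ℝ))).coord j)).contDiff.contDiffAt.comp y ha).smul (contDiffWithinAt_univ.1
    (ContDiffWithinAt.linear_tuple (fun i p => (hc i p).contDiffWithinAt) (tact _) i p))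

theorem hasDerivAt_tact {a : ℝ → E × (E →L[ℝ] ℝ)} {a' : E × (E →L[ℝ] ℝ)}
    {c : ℝ → Fin l → Spinor E} {c' : Fin l → Spinor E} {t : ℝ}
    (ha : HasDerivAt a a' t) (hc : ∀ i p, HasDerivAt (fun z => c z i p) (c' i p) t) (i : Fin l)
    (p : ℕ) : HasDerivAt (fun z => tact (a z) (c z) i p) ((tact a' (c t) + tact (a t) c') i p) t := by
  rw [Pi.add_apply, Pi.add_apply, tact_eq_sum a', tact_eq_sum (a t), ← Finset.sum_add_distrib]
  simp only [tact_eq_sum (a _)]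
  refine HasDerivAt.fun_sum fun j _ => ?_
  have h1 := ((LinearMap.toContinuousLinearMap
      ((Module.finBasis ℝ (E × (E →L[ℝ] ℝ))).coord j)).hasFDerivAt.comp_hasDerivAt t ha).smul
    (HasDerivAt.linear_tuple hc (tact (Module.finBasis ℝ (E × (E →L[ℝ] ℝ)) j)) i p)
  rw [add_comm] at h1
  exact h1

/-- The derivative of `z ↦ a(z) · c(z)`. -/
theorem tupleDeriv_tact {a : E → E × (E →L[ℝ] ℝ)} {c : E → Fin l → Spinor E} {y : E}
    (ha : ContDiffAt ℝ ∞ a y) (hc : ∀ i p, ContDiffAt ℝ ∞ (fun z => c z i p) y) :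
    tupleDeriv (fun z => tact (a z) (c z)) y =
      tactMap (c y) (fderiv ℝ a y : E →ₗ[ℝ] E × (E →L[ℝ] ℝ)) + tact (a y) ∘ₗ tupleDeriv c y := by
  ext1 v
  funext i p
  have h0 : y + (0 : ℝ) • v = y := by simp
  have key : ∀ {F : Type _} [NormedAddCommGroup F] [NormedSpace ℝ F] {f : E → F},
      ContDiffAt ℝ ∞ f y → HasDerivAt (fun t : ℝ => f (y + t • v)) (fderiv ℝ f y v) 0 := by
    intro F _ _ f hf
    have h2 := hasDerivAt_line (v := v) (t := 0) (f := f) (y := y)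
      (by rw [h0]; exact hf.differentiableAt (by simp))
    rwa [h0] at h2
  have h1 := hasDerivAt_tact (c := fun t : ℝ => c (y + t • v)) (c' := tupleDeriv c y v) (key ha)
    (fun i p => key (hc i p)) i p
  rw [h0] at h1
  exact (key (contDiffAt_tact ha hc i p)).unique h1

/-- Cartan's formula in coordinates. -/
theorem altT_tupleDeriv_tact {a : E → E × (E →L[ℝ] ℝ)} {c : E → Fin l → Spinor E} {y : E}
    (ha : ContDiffAt ℝ ∞ a y) (hc : ∀ i p, ContDiffAt ℝ ∞ (fun z => c z i p) y)
    (h0 : altT (tupleDeriv c y) = 0) :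
    altT (tupleDeriv (fun z => tact (a z) (c z)) y) =
      altT (tactMap (c y) (fderiv ℝ a y : E →ₗ[ℝ] E × (E →L[ℝ] ℝ))) + tupleDeriv c y (a y).1 := by
  rw [tupleDeriv_tact ha hc, map_add, altT_tact, h0, map_zero, sub_zero]

end OneForms

end

section

open Filter Set

/-! ### The derivative of the exponential of a `b`-field. -/

section ExpWedge

variable {E : Type*} [NormedAddCommGroup E] [NormedSpace ℝ E] [FiniteDimensional ℝ E] {l : ℕ}

theorem wedgeTwo_zero_left (φ : Spinor E) : wedgeTwo 0 φ = 0 := by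
  have h := congrFun (wedgeTwo_eq_altT (0 : E [⋀^Fin 2]→L[ℝ] ℝ) (fun _ : Fin 1 => φ)) 0
  have h0 : insertTwo (0 : E [⋀^Fin 2]→L[ℝ] ℝ) = 0 := by
    ext v w
    simp [insertTwo_apply]
  refine h.trans ?_
  rw [h0]
  simp

theorem wedgeTwo_zero_right (b : E [⋀^Fin 2]→L[ℝ] ℝ) : wedgeTwo b (0 : Spinor E) = 0 := by
  have h := congrFun (wedgeTwo_eq_altT b (0 : Fin 1 → Spinor E)) 0
  refine h.trans ?_
  have h0 : ∀ m, tactMap (0 : Fin 1 → Spinor E) m = 0 := fun m => by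
    ext1 v
    rw [tactMap_apply, map_zero]
    rfl
  rw [h0]
  simp

/-- The map `b ↦ i_v b`. -/
def insertAt (v : E) : (E [⋀^Fin 2]→L[ℝ] ℝ) →ₗ[ℝ] E × (E →L[ℝ] ℝ) where
  toFun b := ((0 : E), insertTwo b v)
  map_add' b b' := by
    refine Prod.ext (by simp) ?_
    ext w
    simp [insertTwo_apply]
  map_smul' r b := by
    refine Prod.ext (by simp) ?_
    ext w
    simp [insertTwo_apply]

theorem hasDerivAt_wedgeTwo {b : ℝ → E [⋀^Fin 2]→L[ℝ] ℝ} {b' : E [⋀^Fin 2]→L[ℝ] ℝ}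
    {c : ℝ → Fin l → Spinor E} {c' : Fin l → Spinor E} {t : ℝ}
    (hb : HasDerivAt b b' t) (hc : ∀ i p, HasDerivAt (fun z => c z i p) (c' i p) t) (i : Fin l)
    (p : ℕ) : HasDerivAt (fun z => wedgeTwo (b z) (c z i) p)
      ((wedgeTwo b' (c t i) + wedgeTwo (b t) (c' i)) p) t := by
  have hsum : ∀ (b : E [⋀^Fin 2]→L[ℝ] ℝ) (φ : Fin l → Spinor E), wedgeTwo b (φ i) =
      ((1 / 2 : ℝ) • ∑ j, tact ((0 : E), dbas j) (tact (insertAt (bas E j) b) φ)) i := fun b φ => by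
    have := congrFun (wedgeTwo_eq_altT b φ) i
    rw [altT_apply] at this
    exact this
  have h1 : ∀ j, ∀ i p, HasDerivAt (fun z => tact ((0 : E), dbas j)
      (tact (insertAt (bas E j) (b z)) (c z)) i p) (tact ((0 : E), dbas j)
      (tact (insertAt (bas E j) b') (c t) + tact (insertAt (bas E j) (b t)) c') i p) t := fun j =>
    HasDerivAt.linear_tuple (fun i p => hasDerivAt_tact
      ((LinearMap.toContinuousLinearMap (insertAt (bas E j))).hasFDerivAt.comp_hasDerivAt t hb)
      hc i p) _
  have h2 : HasDerivAt (fun z => (1 / 2 : ℝ) • ∑ j, tact ((0 : E), dbas j)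
      (tact (insertAt (bas E j) (b z)) (c z)) i p) ((1 / 2 : ℝ) • ∑ j, tact ((0 : E), dbas j)
      (tact (insertAt (bas E j) b') (c t) + tact (insertAt (bas E j) (b t)) c') i p) t :=
    (HasDerivAt.fun_sum fun j _ => h1 j i p).fun_const_smul _
  rw [hsum b', hsum (b t) c']
  simp only [hsum]
  convert! h2 using 1
  · funext z
    simp [Finset.sum_apply]
  · simp [Finset.sum_apply, Finset.sum_add_distrib, smul_add]

/-- The derivative of `e^b ∧ φ` at `b = 0`. -/
theorem hasDerivAt_expWedge {b : ℝ → E [⋀^Fin 2]→L[ℝ] ℝ} {b' : E [⋀^Fin 2]→L[ℝ] ℝ}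
    {c : ℝ → Fin l → Spinor E} {c' : Fin l → Spinor E} {t : ℝ}
    (hb : HasDerivAt b b' t) (hb0 : b t = 0) (hc : ∀ i p, HasDerivAt (fun z => c z i p) (c' i p) t)
    (i : Fin l) (p : ℕ) :
    HasDerivAt (fun z => expWedge (b z) (c z i) p) ((c' i + wedgeTwo b' (c t i)) p) t := by
  -- `D k` is the derivative of the `k`-th power. As `b t = 0`, powers with `k ≥ 2` vanish to second
  -- order and only `k = 0, 1` contribute.
  let D : ℕ → Fin l → Spinor E := fun k =>
    match k with
    | 0 => c'
    | 1 => fun i => wedgeTwo b' (c t i)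
    | _ + 2 => 0
  have hD : ∀ k i p, HasDerivAt (fun z => (wedgeTwo (b z))^[k] (c z i) p) (D k i p) t := by
    intro k
    induction k with
    | zero => exact hc
    | succ k ih =>
      intro i p
      have h1 := hasDerivAt_wedgeTwo (c := fun z i => (wedgeTwo (b z))^[k] (c z i)) hb ih i p
      simp only [Function.iterate_succ_apply']
      refine h1.congr_deriv ?_
      rw [hb0, wedgeTwo_zero_left, add_zero]
      cases k with
      | zero => rfl
      | succ k =>
        rw [Function.iterate_succ_apply', wedgeTwo_zero_left, wedgeTwo_zero_right]
        rfl
  have h2 : HasDerivAt (fun z => expWedge (b z) (c z i) p)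
      (∑ k ∈ Finset.range (p + 1), ((k.factorial : ℝ)⁻¹) • D k i p) t :=
    HasDerivAt.fun_sum fun k _ => (hD k i p).fun_const_smul _
  refine h2.congr_deriv ?_
  cases p with
  | zero =>
    rw [Finset.sum_range_one]
    change (((0 : ℕ).factorial : ℝ)⁻¹) • c' i 0 = c' i 0 + 0
    simp
  | succ p =>
    rw [Finset.sum_range_succ', Finset.sum_range_succ']
    have h3 : ∑ k ∈ Finset.range p, (((k + 1 + 1).factorial : ℝ)⁻¹) • D (k + 1 + 1) i (p + 1) = 0 :=
      Finset.sum_eq_zero fun k _ => smul_zero _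
    rw [h3]
    change 0 + (((0 + 1 : ℕ).factorial : ℝ)⁻¹) • wedgeTwo b' (c t i) (p + 1) +
      (((0 : ℕ).factorial : ℝ)⁻¹) • c' i (p + 1) = c' i (p + 1) + wedgeTwo b' (c t i) (p + 1)
    simp [add_comm]

end ExpWedge

/-! ### The velocity of diffeomorphisms and exact `b`-fields acting on a closed tuple. -/

section GaugeVelocity

variable {E : Type*} [NormedAddCommGroup E] [NormedSpace ℝ E]
  {X : Type*} [TopologicalSpace X] [ChartedSpace E X] {l : ℕ}

/-- Smooth families of 1-forms and diffeomorphisms through the identity. -/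
structure IsGaugeFamily (γ : ℝ → X → E [⋀^Fin 1]→L[ℝ] ℝ)
    (f : ℝ → X ≃ₘ^∞⟮𝓘(ℝ, E), 𝓘(ℝ, E)⟯ X) : Prop where
  smooth_form : IsSmoothFamily γ
  extD_zero : extD (γ 0) = 0
  smooth_diffeo : ContMDiff (𝓘(ℝ, ℝ).prod 𝓘(ℝ, E)) 𝓘(ℝ, E) ∞ (fun q : ℝ × X => f q.1 q.2)
  diffeo_zero : ∀ x, f 0 x = x

/-- The velocity of a family of 1-forms. -/
def formVelocity (γ : ℝ → X → E [⋀^Fin 1]→L[ℝ] ℝ) (x : X) : E [⋀^Fin 1]→L[ℝ] ℝ :=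
  deriv (fun t => γ t x) 0

variable (E) in
/-- The velocity of a family of maps. -/
def mapVelocity (f : ℝ → X → X) (x : X) : E :=
  (mfderiv 𝓘(ℝ, ℝ) 𝓘(ℝ, E) (fun t : ℝ => f t x) 0 : ℝ →L[ℝ] E) 1

/-- The section `v + θ` of `TX ⊕ T*X` which belongs to families of 1-forms and maps. -/
def gaugeField (γ : ℝ → X → E [⋀^Fin 1]→L[ℝ] ℝ) (f : ℝ → X → X) (x : X) : E × (E →L[ℝ] ℝ) :=
  (mapVelocity E f x, (oneForm E).symm (formVelocity γ x))

variable [IsManifold 𝓘(ℝ, E) ∞ X]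

theorem hasDerivAt_formVelocity {γ : ℝ → X → E [⋀^Fin 1]→L[ℝ] ℝ} (hγ : IsSmoothFamily γ) (x : X) :
    HasDerivAt (fun t => γ t x) (formVelocity γ x) 0 := by
  have h1 : ContDiffAt ℝ ∞ (fun t : ℝ => chartRep x (γ t) (extChartAt 𝓘(ℝ, E) x x)) 0 :=
    ContDiffAt.comp (0 : ℝ) (f := fun t : ℝ => (t, extChartAt 𝓘(ℝ, E) x x))
      (hγ.contDiffAt (mem_extChartAt_target x) 0) (by fun_prop)
  simp only [chartRep_self] at h1
  exact (h1.differentiableAt (by simp)).hasDerivAt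

/-- The expression of a family of maps in a chart is smooth. -/
theorem contDiffAt_family {f : ℝ → X → X}
    (hf : ContMDiff (𝓘(ℝ, ℝ).prod 𝓘(ℝ, E)) 𝓘(ℝ, E) ∞ (fun q : ℝ × X => f q.1 q.2))
    {x₀ : X} {t : ℝ} {y : E} (hy : y ∈ (extChartAt 𝓘(ℝ, E) x₀).target)
    (hfy : f t ((extChartAt 𝓘(ℝ, E) x₀).symm y) ∈ (extChartAt 𝓘(ℝ, E) x₀).source) :
    ContDiffAt ℝ ∞ (fun q : ℝ × E =>
      extChartAt 𝓘(ℝ, E) x₀ (f q.1 ((extChartAt 𝓘(ℝ, E) x₀).symm q.2))) (t, y) := by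
  have h1 : ContMDiffAt (𝓘(ℝ, ℝ).prod 𝓘(ℝ, E)) (𝓘(ℝ, ℝ).prod 𝓘(ℝ, E)) ∞
      (fun q : ℝ × E => (q.1, (extChartAt 𝓘(ℝ, E) x₀).symm q.2)) (t, y) :=
    contMDiffAt_fst.prodMk
      (ContMDiffAt.comp (t, y) (g := (extChartAt 𝓘(ℝ, E) x₀).symm) (contMDiffAt_chart_symm hy)
        contMDiffAt_snd)
  have h2 : ContMDiffAt (𝓘(ℝ, ℝ).prod 𝓘(ℝ, E)) 𝓘(ℝ, E) ∞ (fun q : ℝ × E =>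
      f q.1 ((extChartAt 𝓘(ℝ, E) x₀).symm q.2)) (t, y) :=
    ContMDiffAt.comp (t, y) (g := fun q : ℝ × X => f q.1 q.2) hf.contMDiffAt h1
  have h3 : ContMDiffAt (𝓘(ℝ, ℝ).prod 𝓘(ℝ, E)) 𝓘(ℝ, E) ∞ (fun q : ℝ × E =>
      extChartAt 𝓘(ℝ, E) x₀ (f q.1 ((extChartAt 𝓘(ℝ, E) x₀).symm q.2))) (t, y) :=
    ContMDiffAt.comp (t, y) (g := extChartAt 𝓘(ℝ, E) x₀) (contMDiffAt_chart hfy) h2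
  rw [← modelWithCornersSelf_prod] at h3
  exact contMDiffAt_iff_contDiffAt.1 (chartedSpaceSelf_prod (H := ℝ) (H' := E) ▸ h3)

theorem hasDerivAt_chart_family {f : ℝ → X → X}
    (hf : ContMDiff (𝓘(ℝ, ℝ).prod 𝓘(ℝ, E)) 𝓘(ℝ, E) ∞ (fun q : ℝ × X => f q.1 q.2))
    (hf0 : ∀ x, f 0 x = x) {x₀ x : X} (hx : x ∈ (extChartAt 𝓘(ℝ, E) x₀).source) :
    HasDerivAt (fun t => extChartAt 𝓘(ℝ, E) x₀ (f t x))
      (mder E (extChartAt 𝓘(ℝ, E) x₀) x (mapVelocity E f x)) 0 := by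
  have h1 : ContMDiffAt 𝓘(ℝ, ℝ) 𝓘(ℝ, E) ∞ (fun t : ℝ => f t x) 0 :=
    ContMDiffAt.comp (0 : ℝ) (f := fun t : ℝ => (t, x)) (g := fun q : ℝ × X => f q.1 q.2)
      hf.contMDiffAt (contMDiffAt_id.prodMk contMDiffAt_const)
  have h2 := (h1.mdifferentiableAt (by simp)).hasMFDerivAt
  have h3 := (mdifferentiableAt_chart hx).hasMFDerivAt
  have h4 : HasMFDerivAt 𝓘(ℝ, E) 𝓘(ℝ, E) (extChartAt 𝓘(ℝ, E) x₀) (f 0 x)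
      (mder E (extChartAt 𝓘(ℝ, E) x₀) x) := by
    rw [hf0]
    exact h3
  have h5 := (h4.comp (0 : ℝ) h2)
  have h6 : HasFDerivAt (fun t => extChartAt 𝓘(ℝ, E) x₀ (f t x))
      (mder E (extChartAt 𝓘(ℝ, E) x₀) x ∘L
        (mfderiv 𝓘(ℝ, ℝ) 𝓘(ℝ, E) (fun t : ℝ => f t x) 0 : ℝ →L[ℝ] E)) 0 :=
    hasMFDerivAt_iff_hasFDerivAt.1 h5
  exact h6.hasDerivAt

/-- The field `v + θ` in a chart. -/
def chartField (γ : ℝ → X → E [⋀^Fin 1]→L[ℝ] ℝ) (f : ℝ → X → X) (x₀ : X) (y : E) :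
    E × (E →L[ℝ] ℝ) :=
  (fderiv ℝ (fun q : ℝ × E =>
      extChartAt 𝓘(ℝ, E) x₀ (f q.1 ((extChartAt 𝓘(ℝ, E) x₀).symm q.2))) (0, y) (1, 0),
    (oneForm E).symm (chartRep x₀ (formVelocity γ) y))

theorem contDiffAt_chartField [FiniteDimensional ℝ E] {γ : ℝ → X → E [⋀^Fin 1]→L[ℝ] ℝ}
    {f : ℝ → X ≃ₘ^∞⟮𝓘(ℝ, E), 𝓘(ℝ, E)⟯ X} (h : IsGaugeFamily γ f) {x₀ : X} {y : E}
    (hy : y ∈ (extChartAt 𝓘(ℝ, E) x₀).target) :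
    ContDiffAt ℝ ∞ (chartField γ (fun t => f t) x₀) y := by
  refine ContDiffAt.prodMk ?_ ?_
  · have h1 := contDiffAt_family (f := fun t => f t) h.smooth_diffeo (t := 0) hy (by
      rw [h.diffeo_zero]
      exact (extChartAt 𝓘(ℝ, E) x₀).map_target hy)
    exact ((h1.fderiv_right (m := ∞) (by simp)).comp y
      (f := fun y => ((0 : ℝ), y)) (by fun_prop)).clm_apply contDiffAt_const
  · exact (oneForm E).symm.contDiff.contDiffAt.comp y
      ((isSmooth_velocity h.smooth_form (hasDerivAt_formVelocity h.smooth_form)).contDiffAt hy)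

theorem rep_gaugeField [FiniteDimensional ℝ E] {γ : ℝ → X → E [⋀^Fin 1]→L[ℝ] ℝ}
    {f : ℝ → X ≃ₘ^∞⟮𝓘(ℝ, E), 𝓘(ℝ, E)⟯ X} (h : IsGaugeFamily γ f) (Φ : FormTuple E X l)
    {x₀ : X} {y : E} (hy : y ∈ (extChartAt 𝓘(ℝ, E) x₀).target) :
    rep x₀ (fun x => tact (gaugeField γ (fun t => f t) x) (Φ x)) y =
      tact (chartField γ (fun t => f t) x₀ y) (rep x₀ Φ y) := by
  obtain ⟨L, hL, hL'⟩ := exists_equiv_chart hy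
  rw [rep, rep, ← hL, pullSpinor_tact]
  congr 2
  have hx := (extChartAt 𝓘(ℝ, E) x₀).map_target hy
  refine Prod.ext ?_ ?_
  · change (L.symm : E →L[ℝ] E) _ = _
    rw [hL']
    have h1 := hasDerivAt_chart_family (f := fun t => f t) h.smooth_diffeo h.diffeo_zero hx
    have h2 := contDiffAt_family (f := fun t => f t) h.smooth_diffeo (t := 0) hy (by
      rwa [h.diffeo_zero])
    have h3 : HasDerivAt (fun t : ℝ => (t, y)) ((1 : ℝ), (0 : E)) 0 :=
      (hasDerivAt_id (0 : ℝ)).prodMk (hasDerivAt_const 0 y)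
    let F : ℝ × E → E := fun q => extChartAt 𝓘(ℝ, E) x₀ (f q.1 ((extChartAt 𝓘(ℝ, E) x₀).symm q.2))
    have h4 : HasDerivAt (F ∘ fun t => (t, y)) (fderiv ℝ F (0, y) (1, 0)) 0 :=
      HasFDerivAt.comp_hasDerivAt (0 : ℝ) (h2.differentiableAt (by simp)).hasFDerivAt h3
    exact h1.unique h4
  · change _ ∘L (L : E →L[ℝ] E) = (oneForm E).symm (chartRep x₀ (formVelocity γ) y)
    rw [ContinuousLinearEquiv.eq_symm_apply, ← oneForm_comp, hL]
    change ((oneForm E) ((oneForm E).symm _)).compContinuousLinearMap _ = _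
    rw [ContinuousLinearEquiv.apply_symm_apply]
    rfl

theorem gaugeField_mem_sections [FiniteDimensional ℝ E] {γ : ℝ → X → E [⋀^Fin 1]→L[ℝ] ℝ}
    {f : ℝ → X ≃ₘ^∞⟮𝓘(ℝ, E), 𝓘(ℝ, E)⟯ X} (h : IsGaugeFamily γ f) {Φ : FormTuple E X l}
    (hΦ : Φ ∈ smoothForms E X l) :
    (fun x => tact (gaugeField γ (fun t => f t) x) (Φ x)) ∈ sections Φ 1 := by
  refine mem_sections.2 ⟨fun i p x₀ y hy => ?_, fun x => ?_⟩
  · have h1 := contDiffAt_tact (contDiffAt_chartField h hy) (contDiffAt_rep hΦ hy) i p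
    refine (h1.congr_of_eventuallyEq ?_).contDiffWithinAt
    filter_upwards [(isOpen_extChartAt_target x₀).mem_nhds hy] with z hz
    exact congrFun (congrFun (rep_gaugeField h Φ hz) i) p
  · exact tact_mem_cliff _ (self_mem_cliff_zero _)

/-- The Lie derivative of the components in the chart at `x`. -/
theorem hasDerivAt_pullback [FiniteDimensional ℝ E] {γ : ℝ → X → E [⋀^Fin 1]→L[ℝ] ℝ}
    {f : ℝ → X ≃ₘ^∞⟮𝓘(ℝ, E), 𝓘(ℝ, E)⟯ X} (h : IsGaugeFamily γ f) {Φ : FormTuple E X l}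
    (hΦ : Φ ∈ smoothForms E X l) (x : X) (i : Fin l) (p : ℕ) :
    HasDerivAt (fun t => pullback (f t) (fun y => Φ y i p) x)
      ((altT (tactMap (Φ x) (LinearMap.inl ℝ E (E →L[ℝ] ℝ) ∘ₗ
          (fderiv ℝ (fun z => (chartField γ (fun t => f t) x z).1)
            (extChartAt 𝓘(ℝ, E) x x) : E →ₗ[ℝ] E))) +
        tupleDeriv (rep x Φ) (extChartAt 𝓘(ℝ, E) x x)
          (chartField γ (fun t => f t) x (extChartAt 𝓘(ℝ, E) x x)).1) i p) 0 := by
  set y := extChartAt 𝓘(ℝ, E) x x with hyx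
  have hy : y ∈ (extChartAt 𝓘(ℝ, E) x).target := mem_extChartAt_target x
  have hxy : (extChartAt 𝓘(ℝ, E) x).symm y = x := extChartAt_to_inv x
  let F : ℝ × E → E := fun q => extChartAt 𝓘(ℝ, E) x (f q.1 ((extChartAt 𝓘(ℝ, E) x).symm q.2))
  have hF : ContDiffAt ℝ ∞ F (0, y) := contDiffAt_family (f := fun t => f t) h.smooth_diffeo hy (by
    rw [h.diffeo_zero, hxy]
    exact mem_extChartAt_source x)
  have hF0 : ∀ z ∈ (extChartAt 𝓘(ℝ, E) x).target, F (0, z) = z := fun z hz => by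
    simp only [F, h.diffeo_zero]
    exact (extChartAt 𝓘(ℝ, E) x).right_inv hz
  have hfd0 : fderiv ℝ (fun z => F (0, z)) y = ContinuousLinearMap.id ℝ E := by
    have : (fun z => F (0, z)) =ᶠ[𝓝 y] id := by
      filter_upwards [(isOpen_extChartAt_target x).mem_nhds hy] with z hz
      exact hF0 z hz
    rw [this.fderiv_eq, fderiv_id]
  -- In the chart the pull-back is a value of `Φ` at the moved point composed with the spatial
  -- derivative of `F`. The product rule gives the two terms of the Lie derivative, along `v` and
  -- through the derivative of `v`.
  have hev : (fun t => pullback (f t) (fun y => Φ y i p) x) =ᶠ[𝓝 0] fun t =>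
      (rep x Φ (F (t, y)) i p).compContinuousLinearMap (fderiv ℝ (fun z => F (t, z)) y) := by
    have hc : ContinuousAt (fun t : ℝ => f t x) 0 := 
      ContinuousAt.comp (f := fun t : ℝ => (t, x)) (g := fun q : ℝ × X => f q.1 q.2)
        h.smooth_diffeo.continuous.continuousAt (by fun_prop)
    have h1 := hc.preimage_mem_nhds ((isOpen_extChartAt_source (I := 𝓘(ℝ, E)) x).mem_nhds (by
      rw [h.diffeo_zero]
      exact mem_extChartAt_source x))
    filter_upwards [h1] with t ht
    have h2 := chartRep_pullback (f := f t) (x₀ := x) (x₁ := x) hy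
      ((f t).contMDiff.mdifferentiableAt (by simp)) (by rw [hxy]; exact ht) (fun y => Φ y i p)
    rw [chartRep_self] at h2
    exact h2
  have h1 : HasDerivAt (F ∘ fun t => (t, y)) (fderiv ℝ F (0, y) (1, 0)) 0 :=
    HasFDerivAt.comp_hasDerivAt (0 : ℝ) (hF.differentiableAt (by simp)).hasFDerivAt
      ((hasDerivAt_id (0 : ℝ)).prodMk (hasDerivAt_const 0 y))
  replace h1 : HasDerivAt (fun t => F (t, y)) (chartField γ (fun t => f t) x y).1 0 := h1
  have h2 := hasDerivAt_fderiv_slice hF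
  have h3 : HasDerivAt (fun t => rep x Φ (F (t, y)) i p)
      (fderiv ℝ (fun z => rep x Φ z i p) y (chartField γ (fun t => f t) x y).1) 0 := by
    have h4 := ((contDiffAt_rep hΦ hy i p).differentiableAt (by simp)).hasFDerivAt
    rw [← hF0 y hy] at h4
    have h5 := h4.comp_hasDerivAt (0 : ℝ) h1
    rwa [hF0 y hy] at h5
  have h6 := (ContinuousAlternatingMap.hasStrictFDerivAt_compContinuousLinearMap
    (rep x Φ (F (0, y)) i p, fderiv ℝ (fun z => F (0, z)) y)).hasFDerivAt.comp_hasDerivAt (0 : ℝ)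
    (h3.prodMk h2)
  refine (h6.congr_of_eventuallyEq hev).congr_deriv ?_
  rw [hF0 y hy, hfd0, rep_self, Pi.add_apply, Pi.add_apply, altT_vector, add_comm]
  rfl

/-- The velocity of the action of a family of diffeomorphisms and exact `b`-fields. -/
theorem hasVelocity_gaugeAct [FiniteDimensional ℝ E] {γ : ℝ → X → E [⋀^Fin 1]→L[ℝ] ℝ}
    {f : ℝ → X ≃ₘ^∞⟮𝓘(ℝ, E), 𝓘(ℝ, E)⟯ X} (h : IsGaugeFamily γ f) {Φ : FormTuple E X l}
    (hΦ : Φ ∈ smoothForms E X l) (hd : d Φ = 0) :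
    HasVelocity (fun t => gaugeAct (γ t) (f t) Φ)
      (d fun x => tact (gaugeField γ (fun t => f t) x) (Φ x)) := by
  intro x i p
  set y := extChartAt 𝓘(ℝ, E) x x with hyx
  have hy : y ∈ (extChartAt 𝓘(ℝ, E) x).target := mem_extChartAt_target x
  have hβ := (mem_sections.1 (gaugeField_mem_sections h hΦ)).1
  have h0 : altT (tupleDeriv (rep x Φ) y) = 0 := by rw [← rep_d hΦ hy, hd, rep_zero]
  have hγ := isSmooth_velocity h.smooth_form (hasDerivAt_formVelocity h.smooth_form)
  have h1 : d (fun x => tact (gaugeField γ (fun t => f t) x) (Φ x)) x =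
      altT (tactMap (Φ x) (fderiv ℝ (chartField γ (fun t => f t) x) y : E →ₗ[ℝ] E × (E →L[ℝ] ℝ))) +
        tupleDeriv (rep x Φ) y (chartField γ (fun t => f t) x y).1 := by
    rw [← rep_self x (d _), rep_d hβ hy]
    have h2 : tupleDeriv (rep x fun x => tact (gaugeField γ (fun t => f t) x) (Φ x)) y =
        tupleDeriv (fun z => tact (chartField γ (fun t => f t) x z) (rep x Φ z)) y := by
      ext1 v
      funext i p
      rw [tupleDeriv_apply, tupleDeriv_apply]
      congr 1
      refine Filter.EventuallyEq.fderiv_eq ?_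
      filter_upwards [(isOpen_extChartAt_target x).mem_nhds hy] with z hz
      rw [rep_gaugeField h Φ hz]
    rw [h2, altT_tupleDeriv_tact (contDiffAt_chartField h hy) (contDiffAt_rep hΦ hy) h0, rep_self]
  have ha := contDiffAt_chartField h hy
  -- The derivative of the field splits into that of `v`, matching the Lie derivative of `Φ`, and
  -- that of `θ`, whose antisymmetrization gives `dθ ∧ Φ`.
  have h3 : (fderiv ℝ (chartField γ (fun t => f t) x) y : E →ₗ[ℝ] E × (E →L[ℝ] ℝ)) =
      LinearMap.inl ℝ E (E →L[ℝ] ℝ) ∘ₗ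
          (fderiv ℝ (fun z => (chartField γ (fun t => f t) x z).1) y : E →ₗ[ℝ] E) +
        LinearMap.inr ℝ E (E →L[ℝ] ℝ) ∘ₗ
      (((oneForm E).symm : (E [⋀^Fin 1]→L[ℝ] ℝ) →L[ℝ] (E →L[ℝ] ℝ)) ∘L
        fderiv ℝ (chartRep x (formVelocity γ)) y : E →ₗ[ℝ] E →L[ℝ] ℝ) := by
    have e1 := (ha.differentiableAt (by simp)).hasFDerivAt
    have e2 := ((oneForm E).symm : (E [⋀^Fin 1]→L[ℝ] ℝ) →L[ℝ] (E →L[ℝ] ℝ)).hasFDerivAt.comp y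
      ((hγ.contDiffAt hy).differentiableAt (by simp)).hasFDerivAt
    have e3 : HasFDerivAt (chartField γ (fun t => f t) x)
        ((fderiv ℝ (fun z => (chartField γ (fun t => f t) x z).1) y).prod
          (((oneForm E).symm : (E [⋀^Fin 1]→L[ℝ] ℝ) →L[ℝ] (E →L[ℝ] ℝ)) ∘L
            fderiv ℝ (chartRep x (formVelocity γ)) y)) y :=
      HasFDerivAt.prodMk e1.differentiableAt.fst.hasFDerivAt e2
    rw [e3.fderiv]
    refine LinearMap.ext fun v => Prod.ext ?_ ?_
    · exact (add_zero _).symm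
    · exact (zero_add _).symm
  have hb : HasDerivAt (fun t => extD (γ t) x) (extD (formVelocity γ) x) 0 :=
    hasDerivAt_extD h.smooth_form (hasDerivAt_formVelocity h.smooth_form) x
  have h4 := hasDerivAt_expWedge (c := fun t i p => pullback (f t) (fun y => Φ y i p) x) hb
    (congrFun h.extD_zero x) (hasDerivAt_pullback h hΦ x) i p
  refine h4.congr_deriv ?_
  have hc0 : (fun i p => pullback (f 0) (fun y => Φ y i p) x) = Φ x := by
    have : (f 0 : X → X) = id := funext h.diffeo_zero
    funext i p
    rw [this, pullback_id]
  have h5 := congrFun (altT_covector (fderiv ℝ (chartRep x (formVelocity γ)) y) (Φ x)) i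
  have h6 : extD (formVelocity γ) x = ContinuousAlternatingMap.alternatizeUncurryFin
      (fderiv ℝ (chartRep x (formVelocity γ)) y) := extD_eq _ _
  have hc0' := congrFun hc0 i
  rw [h1, h3, map_add, map_add]
  simp only [Pi.add_apply] at *
  rw [hc0', h6, ← h5]
  abel

end GaugeVelocity

end

section

open Filter Set

/-! ### Composition of families adds their velocities. -/

section Compose

variable {E : Type*} [NormedAddCommGroup E] [NormedSpace ℝ E]
  {X : Type*} [TopologicalSpace X] [ChartedSpace E X] {l : ℕ}

theorem mapVelocity_of_forall_eq {f : ℝ → X → X} {x : X} (h : ∀ t, f t x = x) :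
    mapVelocity E f x = 0 := by
  have h1 : (fun t => f t x) = fun _ => x := funext h
  rw [mapVelocity, h1, mfderiv_const]
  rfl

theorem contMDiff_family_comp {f g : ℝ → X → X}
    (hf : ContMDiff (𝓘(ℝ, ℝ).prod 𝓘(ℝ, E)) 𝓘(ℝ, E) ∞ (fun q : ℝ × X => f q.1 q.2))
    (hg : ContMDiff (𝓘(ℝ, ℝ).prod 𝓘(ℝ, E)) 𝓘(ℝ, E) ∞ (fun q : ℝ × X => g q.1 q.2)) :
    ContMDiff (𝓘(ℝ, ℝ).prod 𝓘(ℝ, E)) 𝓘(ℝ, E) ∞ (fun q : ℝ × X => f q.1 (g q.1 q.2)) :=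
  ContMDiff.comp (g := fun q : ℝ × X => f q.1 q.2) (f := fun q : ℝ × X => (q.1, g q.1 q.2)) hf
    (contMDiff_fst.prodMk hg)

variable [IsManifold 𝓘(ℝ, E) ∞ X]

/-- The velocity at the identity of a composition of families of maps. -/
theorem mapVelocity_comp {f g : ℝ → X → X}
    (hf : ContMDiff (𝓘(ℝ, ℝ).prod 𝓘(ℝ, E)) 𝓘(ℝ, E) ∞ (fun q : ℝ × X => f q.1 q.2))
    (hg : ContMDiff (𝓘(ℝ, ℝ).prod 𝓘(ℝ, E)) 𝓘(ℝ, E) ∞ (fun q : ℝ × X => g q.1 q.2))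
    (hf0 : ∀ x, f 0 x = x) (hg0 : ∀ x, g 0 x = x) (x : X) :
    mapVelocity E (fun t x => f t (g t x)) x = mapVelocity E f x + mapVelocity E g x := by
  set y := extChartAt 𝓘(ℝ, E) x x with hyx
  have hx : x ∈ (extChartAt 𝓘(ℝ, E) x).source := mem_extChartAt_source x
  have hy : y ∈ (extChartAt 𝓘(ℝ, E) x).target := mem_extChartAt_target x
  have hxy : (extChartAt 𝓘(ℝ, E) x).symm y = x := extChartAt_to_inv x
  let F : ℝ × E → E := fun q => extChartAt 𝓘(ℝ, E) x (f q.1 ((extChartAt 𝓘(ℝ, E) x).symm q.2))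
  have hF : HasFDerivAt F (fderiv ℝ F (0, y)) (0, y) :=
    ((contDiffAt_family hf hy (by rwa [hf0, hxy])).differentiableAt (by simp)).hasFDerivAt
  have h1 := hasDerivAt_chart_family (f := fun t x => f t (g t x)) (contMDiff_family_comp hf hg)
    (fun x => by rw [hg0, hf0]) hx
  have h2 := hasDerivAt_chart_family hf hf0 hx
  have h3 := hasDerivAt_chart_family hg hg0 hx
  rw [mder_chart_self, ContinuousLinearMap.id_apply] at h1 h2 h3
  have h4 : HasDerivAt (F ∘ fun t => (t, y)) (fderiv ℝ F (0, y) (1, 0)) 0 :=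
    HasFDerivAt.comp_hasDerivAt (0 : ℝ) hF
      ((hasDerivAt_id (0 : ℝ)).prodMk (hasDerivAt_const 0 y))
  have h5 : HasDerivAt (F ∘ fun t => (t, extChartAt 𝓘(ℝ, E) x (g t x)))
      (fderiv ℝ F (0, y) (1, mapVelocity E g x)) 0 := by
    have h6 : HasFDerivAt F (fderiv ℝ F (0, y)) (0, extChartAt 𝓘(ℝ, E) x (g 0 x)) := by
      rwa [hg0]
    exact HasFDerivAt.comp_hasDerivAt (0 : ℝ) h6 ((hasDerivAt_id (0 : ℝ)).prodMk h3)
  -- `F (0, ·)` is the identity near `y`, so the spatial part of the derivative of `F` passes the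
  -- velocity of `g` on unchanged.
  have h6 : fderiv ℝ F (0, y) (0, mapVelocity E g x) = mapVelocity E g x := by
    have h7 : HasFDerivAt (F ∘ fun z => ((0 : ℝ), z))
        (fderiv ℝ F (0, y) ∘L ContinuousLinearMap.inr ℝ ℝ E) y :=
      HasFDerivAt.comp y hF (hasFDerivAt_prodMk_right (𝕜 := ℝ) (0 : ℝ) y)
    have h8 : (F ∘ fun z => ((0 : ℝ), z)) =ᶠ[𝓝 y] id := by
      filter_upwards [(isOpen_extChartAt_target x).mem_nhds hy] with z hz
      simp only [F, Function.comp_apply, hf0, id]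
      exact (extChartAt 𝓘(ℝ, E) x).right_inv hz
    have h9 := (h7.congr_of_eventuallyEq h8.symm).unique (hasFDerivAt_id y)
    exact DFunLike.congr_fun h9 (mapVelocity E g x)
  have h7 : (fun t => extChartAt 𝓘(ℝ, E) x (f t (g t x))) =ᶠ[𝓝 0]
      F ∘ fun t => (t, extChartAt 𝓘(ℝ, E) x (g t x)) := by
    have hc : ContinuousAt (fun t : ℝ => g t x) 0 :=
      ContinuousAt.comp (f := fun t : ℝ => (t, x)) (g := fun q : ℝ × X => g q.1 q.2)
        hg.continuous.continuousAt (by fun_prop)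
    filter_upwards [hc.preimage_mem_nhds ((isOpen_extChartAt_source (I := 𝓘(ℝ, E)) x).mem_nhds (by
      rwa [hg0]))] with t ht
    simp only [F, Function.comp_apply]
    rw [(extChartAt 𝓘(ℝ, E) x).left_inv ht]
  have h8 : (F ∘ fun t => (t, y)) = fun t => extChartAt 𝓘(ℝ, E) x (f t x) := by
    funext t
    simp only [F, Function.comp_apply, hxy]
  rw [h8] at h4
  rw [h1.unique (h5.congr_of_eventuallyEq h7), h2.unique h4]
  nth_rewrite 2 [← h6]
  rw [← map_add]
  simp

theorem formVelocity_add {γ γ' : ℝ → X → E [⋀^Fin 1]→L[ℝ] ℝ} (h : IsSmoothFamily γ)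
    (h' : IsSmoothFamily γ') (x : X) :
    formVelocity (fun t => γ t + γ' t) x = formVelocity γ x + formVelocity γ' x :=
  ((hasDerivAt_formVelocity h x).add (hasDerivAt_formVelocity h' x)).deriv

theorem IsGaugeFamily.comp {γ γ' : ℝ → X → E [⋀^Fin 1]→L[ℝ] ℝ}
    {f f' : ℝ → X ≃ₘ^∞⟮𝓘(ℝ, E), 𝓘(ℝ, E)⟯ X} (h : IsGaugeFamily γ f) (h' : IsGaugeFamily γ' f') :
    IsGaugeFamily (fun t => γ t + γ' t) (fun t => (f' t).trans (f t)) where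
  smooth_form x := (h.smooth_form x).add (h'.smooth_form x)
  extD_zero := by
    rw [extD_add (h.smooth_form.smooth 0) (h'.smooth_form.smooth 0), h.extD_zero, h'.extD_zero,
      add_zero]
  smooth_diffeo := contMDiff_family_comp (f := fun t => f t) (g := fun t => f' t) h.smooth_diffeo
    h'.smooth_diffeo
  diffeo_zero x := (congrArg (f 0) (h'.diffeo_zero x)).trans (h.diffeo_zero x)

theorem gaugeField_comp {γ γ' : ℝ → X → E [⋀^Fin 1]→L[ℝ] ℝ}
    {f f' : ℝ → X ≃ₘ^∞⟮𝓘(ℝ, E), 𝓘(ℝ, E)⟯ X} (h : IsGaugeFamily γ f) (h' : IsGaugeFamily γ' f')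
    (x : X) : gaugeField (fun t => γ t + γ' t) (fun t => (f' t).trans (f t)) x =
      gaugeField γ (fun t => f t) x + gaugeField γ' (fun t => f' t) x := by
  refine Prod.ext ?_ ?_
  · exact mapVelocity_comp (f := fun t => f t) (g := fun t => f' t) h.smooth_diffeo
      h'.smooth_diffeo h.diffeo_zero h'.diffeo_zero x
  · change (oneForm E).symm (formVelocity (fun t => γ t + γ' t) x) = _
    rw [formVelocity_add h.smooth_form h'.smooth_form, map_add]
    rfl

end Compose

/-! ### Diffeomorphisms supported in a chart. -/

section ChartMap

variable {E : Type*} [NormedAddCommGroup E] [NormedSpace ℝ E]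
  {X : Type*} [TopologicalSpace X] [ChartedSpace E X]

open Classical in
/-- The self-map of `X` which is given by `h` in the chart at `x₀` and the identity elsewhere. -/
def chartMap (x₀ : X) (h : E → E) (x : X) : X :=
  if x ∈ (extChartAt 𝓘(ℝ, E) x₀).source then
    (extChartAt 𝓘(ℝ, E) x₀).symm (h (extChartAt 𝓘(ℝ, E) x₀ x)) else x

theorem chartMap_of_mem {x₀ x : X} (hx : x ∈ (extChartAt 𝓘(ℝ, E) x₀).source) (h : E → E) :
    chartMap x₀ h x = (extChartAt 𝓘(ℝ, E) x₀).symm (h (extChartAt 𝓘(ℝ, E) x₀ x)) :=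
  if_pos hx

theorem chartMap_of_notMem {x₀ x : X} (hx : x ∉ (extChartAt 𝓘(ℝ, E) x₀).source) (h : E → E) :
    chartMap x₀ h x = x :=
  if_neg hx

theorem chartMap_of_eq {x₀ x : X} {h : E → E}
    (hx : x ∈ (extChartAt 𝓘(ℝ, E) x₀).source →
      h (extChartAt 𝓘(ℝ, E) x₀ x) = extChartAt 𝓘(ℝ, E) x₀ x) : chartMap x₀ h x = x := by
  by_cases h' : x ∈ (extChartAt 𝓘(ℝ, E) x₀).source
  · rw [chartMap_of_mem h', hx h', (extChartAt 𝓘(ℝ, E) x₀).left_inv h']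
  · exact chartMap_of_notMem h' h

theorem chartMap_chartMap {x₀ : X} {g h : E → E} (hgh : ∀ y, g (h y) = y)
    (hh : MapsTo h (extChartAt 𝓘(ℝ, E) x₀).target (extChartAt 𝓘(ℝ, E) x₀).target) (x : X) :
    chartMap x₀ g (chartMap x₀ h x) = x := by
  by_cases h' : x ∈ (extChartAt 𝓘(ℝ, E) x₀).source
  · have h1 := hh ((extChartAt 𝓘(ℝ, E) x₀).map_source h')
    rw [chartMap_of_mem h', chartMap_of_mem ((extChartAt 𝓘(ℝ, E) x₀).map_target h1),
      (extChartAt 𝓘(ℝ, E) x₀).right_inv h1, hgh, (extChartAt 𝓘(ℝ, E) x₀).left_inv h']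
  · rw [chartMap_of_notMem h', chartMap_of_notMem h']

variable [IsManifold 𝓘(ℝ, E) ∞ X]

/-- A point outside the chart domain has a neighbourhood that misses `K`, where all the maps are the
identity; hence nothing has to be checked at the boundary of the chart. -/
theorem contMDiff_chartMap {x₀ : X} {K : Set X} (hK : IsClosed K)
    (hK' : K ⊆ (extChartAt 𝓘(ℝ, E) x₀).source) {h : ℝ → E → E}
    (hh : ContDiff ℝ ∞ fun q : ℝ × E => h q.1 q.2)
    (hm : ∀ t, MapsTo (h t) (extChartAt 𝓘(ℝ, E) x₀).target (extChartAt 𝓘(ℝ, E) x₀).target)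
    (he : ∀ t, ∀ y ∉ extChartAt 𝓘(ℝ, E) x₀ '' K, h t y = y) :
    ContMDiff (𝓘(ℝ, ℝ).prod 𝓘(ℝ, E)) 𝓘(ℝ, E) ∞ fun q : ℝ × X => chartMap x₀ (h q.1) q.2 := by
  rintro ⟨t, x⟩
  by_cases hx : x ∈ (extChartAt 𝓘(ℝ, E) x₀).source
  · have hh' : ContMDiff (𝓘(ℝ, ℝ).prod 𝓘(ℝ, E)) 𝓘(ℝ, E) ∞ fun q : ℝ × E => h q.1 q.2 := by
      have h1 := hh.contMDiff
      rw [modelWithCornersSelf_prod] at h1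
      exact chartedSpaceSelf_prod (H := ℝ) (H' := E) ▸ h1
    have h1 : ContMDiffAt (𝓘(ℝ, ℝ).prod 𝓘(ℝ, E)) (𝓘(ℝ, ℝ).prod 𝓘(ℝ, E)) ∞
        (fun q : ℝ × X => (q.1, extChartAt 𝓘(ℝ, E) x₀ q.2)) (t, x) :=
      contMDiffAt_fst.prodMk
        (ContMDiffAt.comp (t, x) (g := extChartAt 𝓘(ℝ, E) x₀) (contMDiffAt_chart hx)
          contMDiffAt_snd)
    have h2 : ContMDiffAt (𝓘(ℝ, ℝ).prod 𝓘(ℝ, E)) 𝓘(ℝ, E) ∞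
        (fun q : ℝ × X => h q.1 (extChartAt 𝓘(ℝ, E) x₀ q.2)) (t, x) :=
      ContMDiffAt.comp (t, x) (g := fun q : ℝ × E => h q.1 q.2) hh'.contMDiffAt h1
    have h3 : ContMDiffAt (𝓘(ℝ, ℝ).prod 𝓘(ℝ, E)) 𝓘(ℝ, E) ∞ (fun q : ℝ × X =>
        (extChartAt 𝓘(ℝ, E) x₀).symm (h q.1 (extChartAt 𝓘(ℝ, E) x₀ q.2))) (t, x) :=
      ContMDiffAt.comp (t, x) (g := (extChartAt 𝓘(ℝ, E) x₀).symm)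
        (contMDiffAt_chart_symm (hm t ((extChartAt 𝓘(ℝ, E) x₀).map_source hx))) h2
    refine h3.congr_of_eventuallyEq ?_
    filter_upwards [(continuous_snd.continuousAt (x := (t, x))).eventually
      ((isOpen_extChartAt_source x₀).mem_nhds hx)] with q hq
    exact chartMap_of_mem hq _
  · have h1 : ContMDiffAt (𝓘(ℝ, ℝ).prod 𝓘(ℝ, E)) 𝓘(ℝ, E) ∞ (fun q : ℝ × X => q.2) (t, x) :=
      contMDiffAt_snd
    refine h1.congr_of_eventuallyEq ?_
    filter_upwards [(continuous_snd.continuousAt (x := (t, x))).eventually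
      (hK.isOpen_compl.mem_nhds fun h' => hx (hK' h'))] with q hq
    refine chartMap_of_eq fun hq' => he _ _ ?_
    rintro ⟨z, hz, hz'⟩
    exact hq ((extChartAt 𝓘(ℝ, E) x₀).injOn (hK' hz) hq' hz' ▸ hz)

/-- Diffeomorphisms of the model space which are supported in a chart give diffeomorphisms of the
manifold. -/
def chartDiffeo {x₀ : X} {K : Set X} (hK : IsClosed K)
    (hK' : K ⊆ (extChartAt 𝓘(ℝ, E) x₀).source) (h : E ≃ E) (hh : ContDiff ℝ ∞ h)
    (hh' : ContDiff ℝ ∞ h.symm)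
    (hm : MapsTo h (extChartAt 𝓘(ℝ, E) x₀).target (extChartAt 𝓘(ℝ, E) x₀).target)
    (hm' : MapsTo h.symm (extChartAt 𝓘(ℝ, E) x₀).target (extChartAt 𝓘(ℝ, E) x₀).target)
    (he : ∀ y ∉ extChartAt 𝓘(ℝ, E) x₀ '' K, h y = y) : X ≃ₘ^∞⟮𝓘(ℝ, E), 𝓘(ℝ, E)⟯ X where
  toFun := chartMap x₀ h
  invFun := chartMap x₀ h.symm
  left_inv := chartMap_chartMap h.symm_apply_apply hm
  right_inv := chartMap_chartMap h.apply_symm_apply hm'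
  contMDiff_toFun :=
    ContMDiff.comp (f := fun x : X => ((0 : ℝ), x)) (g := fun q : ℝ × X => chartMap x₀ h q.2)
      (contMDiff_chartMap hK hK' (h := fun _ => h) (hh.comp contDiff_snd) (fun _ => hm) fun _ => he)
      (contMDiff_const.prodMk contMDiff_id)
  contMDiff_invFun :=
    ContMDiff.comp (f := fun x : X => ((0 : ℝ), x)) (g := fun q : ℝ × X => chartMap x₀ h.symm q.2)
      (contMDiff_chartMap hK hK' (h := fun _ => h.symm) (hh'.comp contDiff_snd) (fun _ => hm')
        fun _ y hy => (Equiv.symm_apply_eq h).2 (he y hy).symm)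
      (contMDiff_const.prodMk contMDiff_id)

end ChartMap

/-! ### Small perturbations of the identity. -/

section Perturbation

variable {E : Type*} [NormedAddCommGroup E] [NormedSpace ℝ E] [FiniteDimensional ℝ E]

/-- A small smooth Lipschitz perturbation of the identity is a diffeomorphism. -/
theorem exists_equiv_id_add {φ : E → E} (hφ : ContDiff ℝ ∞ φ) (hφ' : LipschitzWith (1 / 2) φ) :
    ∃ h : E ≃ E, (∀ y, h y = y + φ y) ∧ ContDiff ℝ ∞ h ∧ ContDiff ℝ ∞ h.symm := by
  have := FiniteDimensional.complete ℝ E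
  have h1 : ApproximatesLinearOn (fun y => y + φ y)
      ((ContinuousLinearEquiv.refl ℝ E : E ≃L[ℝ] E) : E →L[ℝ] E) univ (1 / 2) := by
    intro y _ z _
    have := hφ'.norm_sub_le y z
    simpa [add_sub_add_comm] using this
  have h2 : Subsingleton E ∨ (1 / 2 : NNReal) <
      ‖((ContinuousLinearEquiv.refl ℝ E).symm : E →L[ℝ] E)‖₊⁻¹ := by
    rcases subsingleton_or_nontrivial E with h | h
    · exact Or.inl h
    · right
      have h3 : ‖((ContinuousLinearEquiv.refl ℝ E).symm : E →L[ℝ] E)‖₊ = 1 :=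
        NNReal.eq ContinuousLinearMap.norm_id
      rw [h3, inv_one]
      exact NNReal.half_lt_self one_ne_zero
  have hs : ContDiff ℝ ∞ fun y => y + φ y := contDiff_id.add hφ
  let H := h1.toHomeomorph _ h2
  have hu : ∀ y, IsUnit (1 + fderiv ℝ φ y) := fun y => by
    have h3 := norm_fderiv_le_of_lipschitz ℝ hφ' (x₀ := y)
    have h4 := isUnit_one_sub_of_norm_lt_one (x := -fderiv ℝ φ y) (by
      rw [norm_neg]
      refine h3.trans_lt ?_
      norm_num)
    rwa [sub_neg_eq_add] at h4
  have hd : ∀ y, HasFDerivAt H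
      ((ContinuousLinearEquiv.unitsEquiv ℝ E (hu y).unit : E ≃L[ℝ] E) : E →L[ℝ] E) y := fun y =>
    (hasFDerivAt_id y).add ((hφ.differentiable (by simp)) y).hasFDerivAt
  exact ⟨H.toEquiv, fun y => rfl, hs, H.contDiff_symm hd hs⟩

end Perturbation

end

section

open Filter Set

/-! ### Realizing vector fields and one-forms by families. -/

section Flow

variable {E : Type*} [NormedAddCommGroup E] [NormedSpace ℝ E] [FiniteDimensional ℝ E]

/-- A smooth family of diffeomorphisms of `E` through the identity with velocity a given compactly
supported vector field. -/
theorem exists_equiv_family {ψ : E → E} (hψ : ContDiff ℝ ∞ ψ) (hψ' : HasCompactSupport ψ) :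
    ∃ (s : ℝ → ℝ) (h : ℝ → E ≃ E), HasDerivAt s 1 0 ∧ s 0 = 0 ∧ ContDiff ℝ ∞ s ∧
      (∀ t y, h t y = y + s t • ψ y) ∧ (∀ t, ContDiff ℝ ∞ (h t)) ∧
      ∀ t, ContDiff ℝ ∞ (h t).symm := by
  obtain ⟨C, hC⟩ := hψ.lipschitzWith_of_hasCompactSupport hψ' (by simp)
  -- Only the velocity at `0` matters, so a reparametrized straight motion replaces the flow. The
  -- bound `2 |C t| ≤ 1 + (C t)²` gives `|s| C ≤ 1/2`, so that each `id + s t • ψ` is a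
  -- diffeomorphism, and `s` has derivative `1` at `0`.
  let s : ℝ → ℝ := fun t => t / (1 + (C * t) ^ 2)
  have hpos : ∀ t : ℝ, 0 < 1 + ((C : ℝ) * t) ^ 2 := fun t => by positivity
  have hs : ContDiff ℝ ∞ s := contDiff_id.div (by fun_prop) fun t => (hpos t).ne'
  have hs1 : HasDerivAt s 1 0 := by
    have h1 : HasDerivAt (fun t : ℝ => 1 + ((C : ℝ) * t) ^ 2) 0 0 := by
      have h2 := ((((hasDerivAt_id (0 : ℝ)).const_mul (C : ℝ)).fun_pow 2).const_add 1)
      simpa using h2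
    have h2 := (hasDerivAt_id (0 : ℝ)).fun_div h1 (hpos 0).ne'
    simpa [s] using h2
  have hb : ∀ t, ‖s t‖ * C ≤ 1 / 2 := fun t => by
    rw [Real.norm_eq_abs, abs_div, abs_of_pos (hpos t), div_mul_eq_mul_div, div_le_iff₀ (hpos t)]
    have h1 : ((C : ℝ) * t) ^ 2 = (C * |t|) ^ 2 := by rw [mul_pow, mul_pow, sq_abs]
    rw [h1]
    nlinarith [sq_nonneg ((C : ℝ) * |t| - 1)]
  have hL : ∀ t, LipschitzWith (1 / 2) fun y => s t • ψ y := fun t => by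
    refine LipschitzWith.of_dist_le_mul fun y z => ?_
    rw [dist_smul₀]
    calc ‖s t‖ * dist (ψ y) (ψ z) ≤ ‖s t‖ * (C * dist y z) := by
          gcongr
          exact hC.dist_le_mul y z
      _ = ‖s t‖ * C * dist y z := by ring
      _ ≤ _ := by
          gcongr
          exact hb t
  choose h h1 h2 h3 using fun t => exists_equiv_id_add (contDiff_const.smul hψ) (hL t)
  exact ⟨s, h, hs1, by simp [s], hs, h1, h2, h3⟩

variable {X : Type*} [TopologicalSpace X] [ChartedSpace E X] [IsManifold 𝓘(ℝ, E) ∞ X]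
  [T2Space X] [CompactSpace X]

open Classical in
/-- A function with support in a chart, transported to the model space. -/
def chartFun (x₀ : X) (u : X → ℝ) (y : E) : ℝ :=
  if y ∈ (extChartAt 𝓘(ℝ, E) x₀).target then u ((extChartAt 𝓘(ℝ, E) x₀).symm y) else 0

theorem chartFun_of_mem {x₀ : X} {y : E} (hy : y ∈ (extChartAt 𝓘(ℝ, E) x₀).target) (u : X → ℝ) :
    chartFun x₀ u y = u ((extChartAt 𝓘(ℝ, E) x₀).symm y) :=
  if_pos hy

theorem chartFun_eq_zero {x₀ : X} {y : E} {u : X → ℝ}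
    (hy : y ∉ extChartAt 𝓘(ℝ, E) x₀ '' tsupport u) : chartFun x₀ u y = 0 := by
  by_cases h : y ∈ (extChartAt 𝓘(ℝ, E) x₀).target
  · rw [chartFun_of_mem h]
    refine image_eq_zero_of_notMem_tsupport fun h' => hy ⟨_, h', ?_⟩
    exact (extChartAt 𝓘(ℝ, E) x₀).right_inv h
  · exact if_neg h

theorem isCompact_chart_image {x₀ : X} {K : Set X} (hK : IsClosed K)
    (hK' : K ⊆ (extChartAt 𝓘(ℝ, E) x₀).source) : IsCompact (extChartAt 𝓘(ℝ, E) x₀ '' K) :=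
  hK.isCompact.image_of_continuousOn ((continuousOn_extChartAt x₀).mono hK')

theorem hasCompactSupport_chartFun {x₀ : X} {u : X → ℝ}
    (hu' : tsupport u ⊆ (extChartAt 𝓘(ℝ, E) x₀).source) :
    HasCompactSupport (chartFun (E := E) x₀ u) :=
  HasCompactSupport.intro (isCompact_chart_image (isClosed_tsupport u) hu') fun _ hy =>
    chartFun_eq_zero hy

theorem contDiff_chartFun {x₀ : X} {u : X → ℝ} (hu : ContMDiff 𝓘(ℝ, E) 𝓘(ℝ, ℝ) ∞ u)
    (hu' : tsupport u ⊆ (extChartAt 𝓘(ℝ, E) x₀).source) :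
    ContDiff ℝ ∞ (chartFun (E := E) x₀ u) := by
  refine contDiff_iff_contDiffAt.2 fun y => ?_
  by_cases h : y ∈ (extChartAt 𝓘(ℝ, E) x₀).target
  · refine (contDiffAt_comp_chart_symm hu h).congr_of_eventuallyEq ?_
    filter_upwards [(isOpen_extChartAt_target x₀).mem_nhds h] with z hz
    exact chartFun_of_mem hz u
  · refine (contDiffAt_const (c := 0)).congr_of_eventuallyEq ?_
    have h1 : y ∉ extChartAt 𝓘(ℝ, E) x₀ '' tsupport u := by
      rintro ⟨x, hx, rfl⟩
      exact h ((extChartAt 𝓘(ℝ, E) x₀).map_source (hu' hx))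
    filter_upwards [(isCompact_chart_image (isClosed_tsupport u) hu').isClosed.isOpen_compl.mem_nhds
      h1] with z hz
    exact chartFun_eq_zero hz

/-- If `h y ∉ K`, then `h` fixes `h y`, and injectivity gives `h y = y`. -/
theorem mapsTo_of_forall_notMem_eq {h : E ≃ E} {K U : Set E} (hKU : K ⊆ U)
    (he : ∀ y ∉ K, h y = y) : MapsTo h U U := fun y hy => by
  by_cases h1 : h y ∈ K
  · exact hKU h1
  · rwa [h.injective (he _ h1)]

/-- Diffeomorphisms of `X` with velocity a given vector field, which is constant up to a cut-off in
a chart. -/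
theorem exists_diffeo_family {x₀ : X} {u : X → ℝ} (hu : ContMDiff 𝓘(ℝ, E) 𝓘(ℝ, ℝ) ∞ u)
    (hu' : tsupport u ⊆ (extChartAt 𝓘(ℝ, E) x₀).source) (w : E) :
    ∃ f : ℝ → X ≃ₘ^∞⟮𝓘(ℝ, E), 𝓘(ℝ, E)⟯ X,
      ContMDiff (𝓘(ℝ, ℝ).prod 𝓘(ℝ, E)) 𝓘(ℝ, E) ∞ (fun q : ℝ × X => f q.1 q.2) ∧
      (∀ x, f 0 x = x) ∧
      (∀ x ∈ (extChartAt 𝓘(ℝ, E) x₀).source, mder E (extChartAt 𝓘(ℝ, E) x₀) x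
        (mapVelocity E (fun t => f t) x) = u x • w) ∧
      ∀ x ∉ (extChartAt 𝓘(ℝ, E) x₀).source, mapVelocity E (fun t => f t) x = 0 := by
  obtain ⟨s, h, hs, hs0, hs', hh, h1, h2⟩ := exists_equiv_family
    ((contDiff_chartFun hu hu').smul (contDiff_const (c := w)))
    ((hasCompactSupport_chartFun hu').smul_right (f' := fun _ => w))
  have he : ∀ t, ∀ y ∉ extChartAt 𝓘(ℝ, E) x₀ '' tsupport u, h t y = y := fun t y hy => by
    simp [hh, chartFun_eq_zero hy]
  have hKU : extChartAt 𝓘(ℝ, E) x₀ '' tsupport u ⊆ (extChartAt 𝓘(ℝ, E) x₀).target := by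
    rintro _ ⟨x, hx, rfl⟩
    exact (extChartAt 𝓘(ℝ, E) x₀).map_source (hu' hx)
  have hm : ∀ t, MapsTo (h t) (extChartAt 𝓘(ℝ, E) x₀).target (extChartAt 𝓘(ℝ, E) x₀).target :=
    fun t => mapsTo_of_forall_notMem_eq hKU (he t)
  have hm' : ∀ t, MapsTo (h t).symm (extChartAt 𝓘(ℝ, E) x₀).target
      (extChartAt 𝓘(ℝ, E) x₀).target := fun t =>
    mapsTo_of_forall_notMem_eq hKU fun y hy => (Equiv.symm_apply_eq (h t)).2 (he t y hy).symm
  have hsm : ContMDiff (𝓘(ℝ, ℝ).prod 𝓘(ℝ, E)) 𝓘(ℝ, E) ∞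
      (fun q : ℝ × X => chartMap x₀ (h q.1) q.2) := by
    refine contMDiff_chartMap (isClosed_tsupport u) hu' (h := fun t => h t) ?_ hm he
    simp only [hh]
    exact contDiff_snd.add ((hs'.comp contDiff_fst).smul
      (((contDiff_chartFun hu hu').comp contDiff_snd).smul contDiff_const))
  have h0 : ∀ x, chartMap x₀ (h 0) x = x := fun x => chartMap_of_eq fun _ => by simp [hh, hs0]
  refine ⟨fun t => chartDiffeo (isClosed_tsupport u) hu' (h t) (h1 t) (h2 t) (hm t) (hm' t) (he t),
    hsm, h0, fun x hx => ?_, fun x hx => ?_⟩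
  · have e1 := hasDerivAt_chart_family (f := fun t => chartMap x₀ (h t)) hsm h0 hx
    have hy := (extChartAt 𝓘(ℝ, E) x₀).map_source hx
    have e2 : (fun t => extChartAt 𝓘(ℝ, E) x₀ (chartMap x₀ (h t) x)) = fun t =>
        extChartAt 𝓘(ℝ, E) x₀ x + s t • (u x • w) := by
      funext t
      rw [chartMap_of_mem hx, (extChartAt 𝓘(ℝ, E) x₀).right_inv (hm t hy), hh, Pi.smul_apply', chartFun_of_mem hy,
        (extChartAt 𝓘(ℝ, E) x₀).left_inv hx]
    rw [e2] at e1
    have e3 := (hs.smul_const (u x • w)).const_add (extChartAt 𝓘(ℝ, E) x₀ x)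
    rw [one_smul] at e3
    exact e1.unique e3
  · exact mapVelocity_of_forall_eq fun t => chartMap_of_notMem hx _

/-- Families of 1-forms with velocity a given 1-form, which is constant up to a cut-off in a
chart. -/
theorem exists_form_family {x₀ : X} {u : X → ℝ} (hu : ContMDiff 𝓘(ℝ, E) 𝓘(ℝ, ℝ) ∞ u)
    (hu' : tsupport u ⊆ (extChartAt 𝓘(ℝ, E) x₀).source) (w : E →L[ℝ] ℝ) :
    ∃ γ : ℝ → X → E [⋀^Fin 1]→L[ℝ] ℝ, IsSmoothFamily γ ∧ extD (γ 0) = 0 ∧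
      (∀ x ∈ (extChartAt 𝓘(ℝ, E) x₀).source, (oneForm E).symm (formVelocity γ x) =
        u x • (w ∘L mder E (extChartAt 𝓘(ℝ, E) x₀) x)) ∧
      ∀ x ∉ (extChartAt 𝓘(ℝ, E) x₀).source, formVelocity γ x = 0 := by
  -- The one-form is placed in degree `1` of a single spinor so that `glue` applies; the family is
  -- `t` times it.
  let c : Fin 1 → Spinor E := fun _ p => match p with
    | 1 => oneForm E w
    | _ => 0
  let γ : ℝ → X → E [⋀^Fin 1]→L[ℝ] ℝ := fun t x => glue x₀ u (fun _ => t • c) x 0 1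
  have hγ : ∀ t x, γ t x = t • glue x₀ u (fun _ => c) x 0 1 := fun t x =>
    congrFun (congrFun (glue_smul x₀ u (fun _ => t) (fun _ => c) x) 0) 1
  have hv : ∀ x, formVelocity γ x = glue x₀ u (fun _ => c) x 0 1 := fun x => by
    have h1 : HasDerivAt (fun t => γ t x) ((1 : ℝ) • glue x₀ u (fun _ => c) x 0 1) 0 := by
      simp only [hγ]
      exact (hasDerivAt_id (0 : ℝ)).smul_const _
    rw [formVelocity, h1.deriv, one_smul]
  refine ⟨γ, isSmoothFamily_glue hu hu' (c := fun t _ => t • c) fun t y _ => ?_, ?_,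
    fun x hx => ?_, fun x hx => ?_⟩
  · exact contDiff_fst.contDiffAt.smul contDiffAt_const
  · have h0 : γ 0 = (0 : ℝ) • γ 0 := by
      funext x
      rw [Pi.smul_apply, hγ, zero_smul, smul_zero]
    rw [h0, extD_smul, zero_smul]
  · rw [hv, glue_of_mem hx]
    change (oneForm E).symm (u x • (oneForm E w).compContinuousLinearMap _) = _
    rw [oneForm_comp, map_smul, ContinuousLinearEquiv.symm_apply_apply]
  · rw [hv, glue, if_neg hx]
    rfl

theorem isGaugeFamily_zero : IsGaugeFamily (fun _ => (0 : X → E [⋀^Fin 1]→L[ℝ] ℝ))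
    fun _ => Diffeomorph.refl 𝓘(ℝ, E) X ∞ where
  smooth_form _ := contDiffOn_const (c := (0 : E [⋀^Fin 1]→L[ℝ] ℝ))
  extD_zero := by
    have := extD_smul (0 : ℝ) (0 : X → E [⋀^Fin 1]→L[ℝ] ℝ)
    rwa [zero_smul, zero_smul] at this
  smooth_diffeo := contMDiff_snd
  diffeo_zero _ := rfl

theorem gaugeField_zero (x : X) : gaugeField (fun _ => (0 : X → E [⋀^Fin 1]→L[ℝ] ℝ))
    (fun _ => Diffeomorph.refl 𝓘(ℝ, E) X ∞) x = 0 := by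
  refine Prod.ext (mapVelocity_of_forall_eq fun _ => rfl) ?_
  have h1 : formVelocity (fun _ => (0 : X → E [⋀^Fin 1]→L[ℝ] ℝ)) x = 0 := deriv_const _ _
  change (oneForm E).symm (formVelocity (fun _ => (0 : X → E [⋀^Fin 1]→L[ℝ] ℝ)) x) = 0
  rw [h1, map_zero]

variable {V : Type*} [NormedAddCommGroup V] [NormedSpace ℝ V] [FiniteDimensional ℝ V] {l : ℕ}
  {ΦV : Fin l → Spinor V}

/-- The sections of `CL¹ · Φ` are the `(v + θ) · Φ` with `v + θ` the velocity of a family of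
diffeomorphisms and 1-forms. -/
theorem exists_gaugeFamily {Φ : FormTuple E X l} (hΦ : Φ ∈ orbitSections E X ΦV)
    {α : FormTuple E X l} (hα : α ∈ sections Φ 1) :
    ∃ (γ : ℝ → X → E [⋀^Fin 1]→L[ℝ] ℝ) (f : ℝ → X ≃ₘ^∞⟮𝓘(ℝ, E), 𝓘(ℝ, E)⟯ X),
      IsGaugeFamily γ f ∧ α = fun x => tact (gaugeField γ (fun t => f t) x) (Φ x) := by
  refine sections_induction (P := fun α => ∃ (γ : ℝ → X → E [⋀^Fin 1]→L[ℝ] ℝ)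
    (f : ℝ → X ≃ₘ^∞⟮𝓘(ℝ, E), 𝓘(ℝ, E)⟯ X), IsGaugeFamily γ f ∧
      α = fun x => tact (gaugeField γ (fun t => f t) x) (Φ x)) hΦ ?_ ?_ ?_ hα
  · refine ⟨_, _, isGaugeFamily_zero, funext fun x => ?_⟩
    rw [gaugeField_zero, map_zero]
    rfl
  · rintro _ _ ⟨γ, f, h, rfl⟩ ⟨γ', f', h', rfl⟩
    refine ⟨_, _, h.comp h', funext fun x => ?_⟩
    rw [gaugeField_comp h h', map_add]
    rfl
  · intro x₀ u ws hu hu' hk hk'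
    -- Words of odd length at most `1` are single letters, so the section is a cut-off constant
    -- field applied to `Φ`.
    obtain ⟨w, rfl⟩ : ∃ w, ws = [w] := List.length_eq_one_iff.1 (by omega)
    obtain ⟨f, hf, hf0, hf1, hf2⟩ := exists_diffeo_family hu hu' w.1
    obtain ⟨γ, hγ, hγ0, hγ1, hγ2⟩ := exists_form_family hu hu' w.2
    refine ⟨γ, f, ⟨hγ, hγ0, hf, hf0⟩, funext fun x => ?_⟩
    by_cases hx : x ∈ (extChartAt 𝓘(ℝ, E) x₀).source
    · obtain ⟨M, -, hM, hM'⟩ := exists_glue_word hx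
      have h1 : gaugeField γ (fun t => f t) x = u x • pullW M.symm w := by
        refine Prod.ext ?_ ?_
        · have h2 := hf1 x hx
          rw [← hM] at h2
          change mapVelocity E (fun t => f t) x = u x • M w.1
          rw [← map_smul, ← h2]
          exact (M.apply_symm_apply _).symm
        · refine (hγ1 x hx).trans ?_
          rw [← hM]
          rfl
      rw [hM', h1, map_smul]
      simp
    · have h1 : gaugeField γ (fun t => f t) x = 0 := by
        rw [gaugeField, hf2 x hx, hγ2 x hx, map_zero]
        rfl
      rw [glue, if_neg hx, h1, map_zero]
      rfl

end Flow

end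

section

/-! ### Identification of deformations and gauge directions with cocycles and coboundaries. -/

section Deformations

variable {V : Type*} [NormedAddCommGroup V] [NormedSpace ℝ V] [FiniteDimensional ℝ V]
  {E : Type*} [NormedAddCommGroup E] [NormedSpace ℝ E] [FiniteDimensional ℝ E]
  {X : Type*} [TopologicalSpace X] [ChartedSpace E X] [IsManifold 𝓘(ℝ, E) ∞ X] [T2Space X]
  [CompactSpace X] {l : ℕ} {ΦV : Fin l → Spinor V} {Φ : FormTuple E X l}

theorem HasVelocity.unique {Ψ : ℝ → FormTuple E X l} {α β : FormTuple E X l}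
    (hα : HasVelocity Ψ α) (hβ : HasVelocity Ψ β) : α = β :=
  funext fun x => funext fun i => funext fun p => (hα x i p).unique (hβ x i p)

theorem HasVelocity.d {Ψ : ℝ → FormTuple E X l} {α : FormTuple E X l}
    (hΨ : ∀ i p, IsSmoothFamily fun t x => Ψ t x i p) (hα : HasVelocity Ψ α) :
    HasVelocity (fun t => CliffordDeformation.d (Ψ t)) (CliffordDeformation.d α) := by
  intro x i p
  cases p with
  | zero => exact hasDerivAt_const _ _
  | succ p => exact hasDerivAt_extD (hΨ i p) (fun y => hα y i p) x

/-- Since `d` commutes with the time derivative, being closed to first order depends only on the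
velocity `α` and means `dα = 0`. Any curve with velocity `α` will do. -/
theorem coe_cocycles_two (hΦ : Φ ∈ orbitSections E X ΦV) :
    (cocycles Φ 2 : Set (FormTuple E X l)) = infinitesimalDeformations ΦV Φ := by
  ext α
  constructor
  · rintro ⟨hα, hd⟩
    obtain ⟨Ψ, hΨ, hv⟩ := exists_curve_of_mem_sections hΦ hα
    exact ⟨Ψ, hΨ, hv, hd ▸ hv.d hΨ.1⟩
  · rintro ⟨Ψ, hΨ, hv, hd⟩
    exact ⟨mem_sections_of_velocity hΨ hv, (hv.d hΨ.1).unique hd⟩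

/-- Both inclusions come from the formula of `hasVelocity_gaugeAct`, read with `exists_gaugeFamily`
in one direction and `gaugeField_mem_sections` in the other. -/
theorem coe_coboundaries_one (hΦ : Φ ∈ structures E X ΦV) :
    (coboundaries Φ 1 : Set (FormTuple E X l)) = tangentGaugeOrbit Φ := by
  ext α
  constructor
  · rintro ⟨β, hβ, rfl⟩
    obtain ⟨γ, f, h, rfl⟩ := exists_gaugeFamily hΦ.1 hβ
    exact ⟨γ, f, h.1, h.2, h.3, h.4, hasVelocity_gaugeAct h hΦ.1.1 hΦ.2⟩
  · rintro ⟨γ, f, h1, h2, h3, h4, hv⟩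
    have h : IsGaugeFamily γ f := ⟨h1, h2, h3, h4⟩
    exact ⟨_, gaugeField_mem_sections h hΦ.1.1, (hasVelocity_gaugeAct h hΦ.1.1 hΦ.2).unique hv⟩

theorem coboundaries_le_cocycles (hΦ : Φ ∈ structures E X ΦV) (k : ℕ) :
    coboundaries Φ k ≤ cocycles Φ (k + 1) := by
  rintro _ ⟨β, hβ, rfl⟩
  exact ⟨d_mem_sections hΦ hβ, d_d hβ.1⟩

theorem coe_sections_two (hΦ : Φ ∈ orbitSections E X ΦV) :
    (sections Φ 2 : Set (FormTuple E X l)) = tangentOrbitSections ΦV Φ :=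
  Set.Subset.antisymm (fun _ hα => exists_curve_of_mem_sections hΦ hα)
    fun _ ⟨_, hΨ, hv⟩ => mem_sections_of_velocity hΨ hv

end Deformations

end

end CliffordDeformation

end

theorem mainTheorem8 {n l : ℕ}
    {V : Type*} [NormedAddCommGroup V] [NormedSpace ℝ V] [FiniteDimensional ℝ V]
    (hV : Module.finrank ℝ V = n)
    {E : Type*} [NormedAddCommGroup E] [NormedSpace ℝ E] [FiniteDimensional ℝ E]
    (hE : Module.finrank ℝ E = n)
    {X : Type*} [TopologicalSpace X] [ChartedSpace E X] [IsManifold 𝓘(ℝ, E) ∞ X]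
    [T2Space X] [CompactSpace X]
    (ΦV : Fin l → CliffordDeformation.Spinor V)
    (Φ : CliffordDeformation.FormTuple E X l)
    (hΦ : Φ ∈ CliffordDeformation.structures E X ΦV) :
    -- the `CLᵏ · Φ` are vector bundles, and `d` makes their sections a complex
    (∀ k : ℕ, CliffordDeformation.IsVectorBundle Φ k) ∧
    (∀ k : ℕ, ∀ α ∈ CliffordDeformation.sections Φ k,
      CliffordDeformation.d α ∈ CliffordDeformation.sections Φ (k + 1) ∧
      CliffordDeformation.d (CliffordDeformation.d α) = 0) ∧
    -- the sections of `𝐄¹` are the tangent space of the sections of `𝓑(X)`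
    (CliffordDeformation.sections Φ 2 : Set (CliffordDeformation.FormTuple E X l)) =
      CliffordDeformation.tangentOrbitSections ΦV Φ ∧
    -- the first cohomology is the space of infinitesimal deformations modulo the tangent space of
    -- the orbit of diffeomorphisms and exact `b`-fields
    ∃ D G : Submodule ℝ (CliffordDeformation.FormTuple E X l),
      (D : Set (CliffordDeformation.FormTuple E X l)) =
        CliffordDeformation.infinitesimalDeformations ΦV Φ ∧
      (G : Set (CliffordDeformation.FormTuple E X l)) =
        CliffordDeformation.tangentGaugeOrbit Φ ∧
      G ≤ D ∧
      ∃ iso : CliffordDeformation.cohomology Φ 1 ≃ₗ[ℝ] (D ⧸ G.submoduleOf D),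
        ∀ α : CliffordDeformation.cocycles Φ 2, ∃ hα : (α : CliffordDeformation.FormTuple E X l) ∈ D,
          iso (Submodule.Quotient.mk α) = Submodule.Quotient.mk ⟨α, hα⟩ := by
  -- With `D` and `G` taken to be the cocycles and coboundaries themselves, the two quotients
  -- coincide and the isomorphism is the identity. The index `2` stands for `𝐄¹`.
  refine ⟨CliffordDeformation.isVectorBundle hΦ.1, fun k α hα =>
    ⟨CliffordDeformation.d_mem_sections hΦ hα, CliffordDeformation.d_d hα.1⟩,
    CliffordDeformation.coe_sections_two hΦ.1, CliffordDeformation.cocycles Φ 2,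
    CliffordDeformation.coboundaries Φ 1, CliffordDeformation.coe_cocycles_two hΦ.1,
    CliffordDeformation.coe_coboundaries_one hΦ,
    CliffordDeformation.coboundaries_le_cocycles hΦ 1, LinearEquiv.refl ℝ _, fun α => ⟨α.2, rfl⟩⟩
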